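/- **The skew fields.** For $l\ge 2$ let $\mathcal K_l$ be the skew field of fractions of the $\mathbb C$-algebra (an Ore domain) with generators $f_i,\alpha_i$ ($i\in\mathbb Z/(l+1)\mathbb Z$), $h$ and relations $[f_i,f_{i+1}]=h$, $[f_i,f_j]=0$ ($j\ne i\pm1$), with all $\alpha_i$ and $h$ central. Let $\mathcal K_1$ be the skew field of fractions of the $\mathbb C$-algebra (an Ore domain) with generators $f_0,f_1,f_2,\alpha_0,\alpha_1,h$ and relations $[f_1,f_0]=2hf_2$, $[f_0,f_2]=[f_2,f_1]=h$, with $\alpha_0,\alpha_1,h$ central. Put $k=\alpha_0+\cdots+\alpha_l$. **The automorphisms.** For $l\ge2$, the $\mathbb C$-automorphisms $s_i,\pi$ of $\mathcal K_l$ ($i\in\mathbb Z/(l+1)\mathbb Z$) are given by $s_i(f_j)=f_j+\frac{\alpha_i}{f_i}u_{ij}$, $s_i(\alpha_j)=\alpha_j-\alpha_ia_{ij}$, $s_i(h)=h$, $\pi(f_j)=f_{j+1}$, $\pi(\alpha_j)=\alpha_{j+1}$, $\pi(h)=h$, where $u_{i,i\pm1}=\pm1$, $u_{ij}=0$ otherwise,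 and $a_{ii}=2$, $a_{i,i\pm1}=-1$, $a_{ij}=0$ otherwise. For $l=1$, $$s_0(f_0)=f_0,\quad s_0(f_1)=f_1-f_2\tfrac{\alpha_0}{f_0}-\tfrac{\alpha_0}{f_0}f_2-\tfrac{\alpha_0^2}{f_0^2},\quad s_0(f_2)=f_2+\tfrac{\alpha_0}{f_0},\quad s_0(\alpha_0)=-\alpha_0,\quad s_0(\alpha_1)=\alpha_1+2\alpha_0,$$ $$s_1(f_0)=f_0+f_2\tfrac{\alpha_1}{f_1}+\tfrac{\alpha_1}{f_1}f_2-\tfrac{\alpha_1^2}{f_1^2},\quad s_1(f_1)=f_1,\quad s_1(f_2)=f_2-\tfrac{\alpha_1}{f_1},\quad s_1(\alpha_0)=\alpha_0+2\alpha_1,\quad s_1(\alpha_1)=-\alpha_1,$$ $\pi$ exchanges $f_0\leftrightarrow f_1$ and $\alpha_0\leftrightarrow\alpha_1$, $\pi(f_2)=-f_2$, and $s_0,s_1,\pi$ fix $h$. **The Hamiltonians.** For $1\le i\le l$ let $\varpi_i=\sum_{r=1}^l\bigl(\min\{i,r\}-\frac{ir}{l+1}\bigr)\alpha_r$, and $\varpi_0=0$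 (indices mod $l+1$). A proper subset $C$ of $\Gamma=\mathbb Z/(l+1)\mathbb Z$ is the disjoint union of its connected components, the maximal cyclic intervals $\{i,i+1,\dots,i+m-1\}\subset C$; $\chi(C)$ is the sum over the components of $\varpi_i-\varpi_{i+1}+\cdots+(-1)^{m-1}\varpi_{i+m-1}$, and $f_C$ is the product over the components of $f_if_{i+1}\cdots f_{i+m-1}$ (these factors commute). Let $S_d$ be the set of $K\subset\Gamma$ with $|K|=d$ such that all components of $\Gamma\setminus K$ have even length. Define - $l=1$: $H_0=\frac12(f_0f_1+f_1f_0)+\alpha_1f_2$; - $l=2$: $H_0=f_0f_1f_2+hf_1+\sum_{K\in S_1}\chi(\Gamma\setminus K)f_K$; - $l=2n$, $n\ge2$: $H_0=\sum_{K\in S_3}f_K+\sum_{K\in S_1}\chi(\Gamma\setminus K)f_K$; - $l=3$: $H_0=f_0f_1f_2f_3+hf_1f_2+\sum_{K\in S_2}\chi(\Gamma\setminus K)f_K+\bigl(\sum_{i=1}^3(-1)^{i-1}\varpi_i\bigr)^2$; - $l=2n+1$, $n\ge2$: $H_0=\sum_{K\in S_4}f_K+\sum_{K\in S_2}\chi(\Gamma\setminus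 K)f_K+\bigl(\sum_{i=1}^l(-1)^{i-1}\varpi_i\bigr)^2$, and $H_j=\pi(H_{j-1})$ for $j=1,\dots,l$. For $l=2n+1$, $n\ge1$, put $x_0=f_0+f_2+\cdots+f_{2n}$ and $x_1=f_1+f_3+\cdots+f_{2n+1}$, with the index of $x_j$ read in $\mathbb Z/2\mathbb Z$. **Proposition.** 1. For $l=1$ and for $l=2n$ ($n\ge1$): $s_i(H_j)=H_j+\delta_{ij}\,k\,\frac{\alpha_j}{f_j}$ for all $i,j=0,\dots,l$. 2. For $l=2n+1$ ($n\ge1$): $s_i(H_j)=H_j+\delta_{ij}\,k\,\frac{\alpha_j}{f_j}\,x_j$ for all $i,j=0,\dots,l$. In particular, for every $l\ge1$ and $j=0,\dots,l$, $H_j$ is invariant under the group $\langle s_0,\dots,s_{j-1},s_{j+1},\dots,s_l\rangle$. -/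

import Mathlib

/-
Overview.  `QPainleve.K l` (for `l ≥ 2`) and `QPainleve.One.K` (for `l = 1`) are the skew fields of
fractions (Ore localizations at the nonzero elements) of the complex algebras `QPainleve.A l` and
`QPainleve.One.A` given by generators and relations.  The first sections prove what is needed for
this to make sense: these algebras are domains satisfying the Ore condition.  After that the
automorphisms `s i`, `π` are constructed from their values on generators, and the last section
defines the Hamiltonians.
-/

namespace QPainleve

section Filtration

open MvPolynomial

variable {G : Type} {A : Type} [Ring A] [Algebra ℂ A]

/-- Polynomials all of whose monomials have degree `< d`. -/
def degLT (G : Type) (d : ℕ) : Submodule ℂ (MvPolynomial G ℂ) where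
  carrier := {p | ∀ m : G →₀ ℕ, d ≤ m.degree → coeff m p = 0}
  add_mem' := by
    intro p q hp hq m hm
    simp [hp m hm, hq m hm]
  zero_mem' := by
    intro m _
    simp
  smul_mem' := by
    intro c p hp m hm
    simp [hp m hm]

theorem degLT_mono {d e : ℕ} (h : d ≤ e) : degLT G d ≤ degLT G e :=
  fun _ hp m hm => hp m (h.trans hm)

theorem X_mul_mem_degLT {d : ℕ} {p : MvPolynomial G ℂ} (hp : p ∈ degLT G d) (g : G) :
    X g * p ∈ degLT G (d + 1) := by
  classical
  intro m hm
  rw [coeff_X_mul']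
  split_ifs with hg
  · apply hp
    have h1 : Finsupp.single g 1 ≤ m := by
      rw [Finsupp.single_le_iff]
      exact Nat.one_le_iff_ne_zero.2 (Finsupp.mem_support_iff.1 hg)
    have h2 : (m - Finsupp.single g 1 + Finsupp.single g 1).degree = m.degree := by
      rw [tsub_add_cancel_of_le h1]
    rw [map_add, Finsupp.degree_single] at h2
    omega
  · rfl

/-- The span of the words of length `< d` in the elements `x g`. -/
def wordLT (x : G → A) (d : ℕ) : Submodule ℂ A :=
  Submodule.span ℂ {a | ∃ w : List G, w.length < d ∧ a = (w.map x).prod}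

theorem word_mem (x : G → A) {d : ℕ} (w : List G) (h : w.length < d) :
    (w.map x).prod ∈ wordLT x d :=
  Submodule.subset_span ⟨w, h, rfl⟩

theorem wordLT_mono (x : G → A) {d e : ℕ} (h : d ≤ e) : wordLT x d ≤ wordLT x e := by
  apply Submodule.span_mono
  rintro a ⟨w, hw, rfl⟩
  exact ⟨w, by omega, rfl⟩

theorem wordLT_mul (x : G → A) {d e : ℕ} {a b : A} (ha : a ∈ wordLT x d)
    (hb : b ∈ wordLT x e) : a * b ∈ wordLT x (d + e) := by
  have h := Submodule.mul_mem_mul ha hb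
  rw [wordLT, wordLT, Submodule.span_mul_span] at h
  refine Submodule.span_mono ?_ h
  rintro _ ⟨_, ⟨w, hw, rfl⟩, _, ⟨v, hv, rfl⟩, rfl⟩
  exact ⟨w ++ v, by simp; omega, by simp⟩

theorem exists_mem_wordLT (x : G → A) (hx : Algebra.adjoin ℂ (Set.range x) = ⊤) (a : A) :
    ∃ d, a ∈ wordLT x d := by
  have ha : a ∈ Algebra.adjoin ℂ (Set.range x) := by rw [hx]; trivial
  induction ha using Algebra.adjoin_induction with
  | mem a ha =>
    obtain ⟨g, rfl⟩ := ha
    exact ⟨2, by simpa using word_mem x (d := 2) [g] (by simp)⟩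
  | algebraMap r =>
    refine ⟨1, ?_⟩
    rw [Algebra.algebraMap_eq_smul_one]
    exact Submodule.smul_mem _ _ (by simpa using word_mem x (d := 1) [] (by simp))
  | add a b _ _ ha hb =>
    obtain ⟨d, hd⟩ := ha
    obtain ⟨e, he⟩ := hb
    exact ⟨max d e, Submodule.add_mem _ (wordLT_mono x (le_max_left _ _) hd)
      (wordLT_mono x (le_max_right _ _) he)⟩
  | mul a b _ _ ha hb =>
    obtain ⟨d, hd⟩ := ha
    obtain ⟨e, he⟩ := hb
    exact ⟨d + e, wordLT_mul x hd he⟩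

theorem word_perm (x : G → A)
    (hc : ∀ a b, x a * x b - x b * x a ∈ Submodule.span ℂ (Set.range x))
    {w v : List G} (h : w.Perm v) :
    (w.map x).prod - (v.map x).prod ∈ wordLT x w.length := by
  induction h with
  | nil => simp
  | @cons g w v _ ih =>
    have h1 : x g ∈ wordLT x 2 := by simpa using word_mem x (d := 2) [g] (by simp)
    have h2 : (w.map x).prod - (v.map x).prod ∈ wordLT x w.length := ih
    simp only [List.map_cons, List.prod_cons, List.length_cons, ← mul_sub]
    refine Submodule.span_induction (p := fun b _ => x g * b ∈ wordLT x (w.length + 1))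
      ?_ ?_ ?_ ?_ h2
    · rintro _ ⟨u, hu, rfl⟩
      simpa using word_mem x (d := w.length + 1) (g :: u) (by simpa using hu)
    · simp
    · intro a b _ _ ha hb
      rw [mul_add]
      exact Submodule.add_mem _ ha hb
    · intro c a _ ha
      rw [mul_smul_comm]
      exact Submodule.smul_mem _ _ ha
  | swap a b w =>
    have h1 : x b * x a - x a * x b ∈ Submodule.span ℂ (Set.range x) := hc b a
    have h2 : ∀ c ∈ Submodule.span ℂ (Set.range x),
        c * (w.map x).prod ∈ wordLT x (w.length + 2) := by
      intro c h
      induction h using Submodule.span_induction with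
      | mem c hc =>
        obtain ⟨g, rfl⟩ := hc
        simpa using word_mem x (d := w.length + 2) (g :: w) (by simp)
      | zero => simp
      | add c d _ _ hc hd => rw [add_mul]; exact Submodule.add_mem _ hc hd
      | smul r c _ hc => rw [smul_mul_assoc]; exact Submodule.smul_mem _ _ hc
    have h3 := h2 _ h1
    simpa [sub_mul, mul_assoc] using h3
  | @trans w v u h1 _ ih1 ih2 =>
    rw [← h1.length_eq] at ih2
    simpa using Submodule.add_mem _ ih1 ih2

/-- The exponent vector of a word. -/
noncomputable def wordExp (w : List G) : G →₀ ℕ := (w.map fun g => Finsupp.single g 1).sum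

theorem toMultiset_wordExp (w : List G) : Finsupp.toMultiset (wordExp w) = (w : Multiset G) := by
  induction w with
  | nil => simp [wordExp]
  | cons g w ih =>
    have : wordExp (g :: w) = Finsupp.single g 1 + wordExp w := by simp [wordExp]
    rw [this, map_add, ih, Finsupp.toMultiset_single]
    simp

theorem degree_wordExp (w : List G) : (wordExp w).degree = w.length := by
  induction w with
  | nil => simp [wordExp]
  | cons g w ih =>
    have : wordExp (g :: w) = Finsupp.single g 1 + wordExp w := by simp [wordExp]
    rw [this, map_add, ih, Finsupp.degree_single]
    simp [add_comm]

theorem prod_X_eq (w : List G) :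
    (w.map (X : G → MvPolynomial G ℂ)).prod = monomial (wordExp w) 1 := by
  induction w with
  | nil => simp [wordExp]
  | cons g w ih =>
    have : wordExp (g :: w) = Finsupp.single g 1 + wordExp w := by simp [wordExp]
    rw [this, List.map_cons, List.prod_cons, ih, X, monomial_mul, one_mul]

/-- A chosen ordering of a monomial, as an element of the algebra. -/
noncomputable def ordWord (x : G → A) (m : G →₀ ℕ) : A :=
  ((Finsupp.toMultiset m).toList.map x).prod

theorem word_sub_ordWord (x : G → A)
    (hc : ∀ a b, x a * x b - x b * x a ∈ Submodule.span ℂ (Set.range x)) (w : List G) :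
    (w.map x).prod - ordWord x (wordExp w) ∈ wordLT x w.length := by
  refine word_perm x hc ?_
  rw [toMultiset_wordExp, ← Multiset.coe_eq_coe, Multiset.coe_toList]

/-- The linear extension of `ordWord`. -/
noncomputable def ordLin (x : G → A) : MvPolynomial G ℂ →ₗ[ℂ] A :=
  (basisMonomials G ℂ).constr ℂ (ordWord x)

theorem ordLin_monomial (x : G → A) (m : G →₀ ℕ) : ordLin x (monomial m 1) = ordWord x m := by
  have := (basisMonomials G ℂ).constr_basis ℂ (ordWord x) m
  rwa [coe_basisMonomials] at this

variable (x : G → A) (ρ : A →ₐ[ℂ] Module.End ℂ (MvPolynomial G ℂ))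

theorem rep_word (hρ : ∀ g d p, p ∈ degLT G d → ρ (x g) p - X g * p ∈ degLT G d)
    (w : List G) (e : ℕ) (p : MvPolynomial G ℂ) (hp : p ∈ degLT G (e + 1)) :
    ρ (w.map x).prod p - (w.map X).prod * p ∈ degLT G (e + w.length) ∧
      ρ (w.map x).prod p ∈ degLT G (e + w.length + 1) := by
  induction w with
  | nil => simpa using hp
  | cons g w ih =>
    obtain ⟨h1, h2⟩ := ih
    have h3 := hρ g _ _ h2
    have h4 := X_mul_mem_degLT h1 g
    have h5 := X_mul_mem_degLT h2 g
    simp only [List.map_cons, List.prod_cons, map_mul, Module.End.mul_apply, List.length_cons]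
    refine ⟨?_, ?_⟩
    · have := Submodule.add_mem _ h3 h4
      rwa [mul_sub, ← mul_assoc, sub_add_sub_cancel] at this
    · have := Submodule.add_mem _ (degLT_mono (by omega) h3) h5
      simpa [← add_assoc] using this

theorem exists_symbol (hρ : ∀ g d p, p ∈ degLT G d → ρ (x g) p - X g * p ∈ degLT G d)
    (hc : ∀ a b, x a * x b - x b * x a ∈ Submodule.span ℂ (Set.range x))
    (d : ℕ) (a : A) (ha : a ∈ wordLT x (d + 1)) :
    ∃ q : MvPolynomial G ℂ, q.IsHomogeneous d ∧ a - ordLin x q ∈ wordLT x d ∧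
      ∀ e p, p ∈ degLT G (e + 1) → ρ a p - q * p ∈ degLT G (e + d) := by
  induction ha using Submodule.span_induction with
  | mem a ha =>
    obtain ⟨w, hw, rfl⟩ := ha
    rcases Nat.lt_succ_iff_lt_or_eq.1 hw with h | h
    · refine ⟨0, isHomogeneous_zero _ _ _, by simpa using word_mem x w h, ?_⟩
      intro e p hp
      simpa using degLT_mono (by omega) (rep_word x ρ hρ w e p hp).2
    · subst h
      refine ⟨(w.map X).prod, ?_, ?_, fun e p hp => (rep_word x ρ hρ w e p hp).1⟩
      · rw [prod_X_eq]
        exact isHomogeneous_monomial _ (degree_wordExp w)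
      · rw [prod_X_eq, ordLin_monomial]
        exact word_sub_ordWord x hc w
  | zero => exact ⟨0, isHomogeneous_zero _ _ _, by simp, by simp⟩
  | add a b _ _ ha hb =>
    obtain ⟨q, h1, h2, h3⟩ := ha
    obtain ⟨r, k1, k2, k3⟩ := hb
    refine ⟨q + r, h1.add k1, ?_, ?_⟩
    · have := Submodule.add_mem _ h2 k2
      convert this using 1
      rw [map_add]; abel
    · intro e p hp
      have := Submodule.add_mem _ (h3 e p hp) (k3 e p hp)
      convert this using 1
      rw [map_add, LinearMap.add_apply]; ring
  | smul c a _ ha =>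
    obtain ⟨q, h1, h2, h3⟩ := ha
    refine ⟨c • q, ?_, ?_, ?_⟩
    · exact (homogeneousSubmodule G ℂ d).smul_mem c h1
    · have := Submodule.smul_mem _ c h2
      rwa [smul_sub, ← map_smul] at this
    · intro e p hp
      have := Submodule.smul_mem _ c (h3 e p hp)
      rwa [smul_sub, ← smul_mul_assoc, ← LinearMap.smul_apply, ← map_smul] at this

theorem wordLT_zero : wordLT x 0 = ⊥ := by
  simp [wordLT]

/-- Every nonzero element has a nonzero leading symbol. -/
theorem exists_leading (hρ : ∀ g d p, p ∈ degLT G d → ρ (x g) p - X g * p ∈ degLT G d)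
    (hc : ∀ a b, x a * x b - x b * x a ∈ Submodule.span ℂ (Set.range x))
    (hx : Algebra.adjoin ℂ (Set.range x) = ⊤) (a : A) (ha : a ≠ 0) :
    ∃ (d : ℕ) (q : MvPolynomial G ℂ), q ≠ 0 ∧ q.IsHomogeneous d ∧
      ∀ e p, p ∈ degLT G (e + 1) → ρ a p - q * p ∈ degLT G (e + d) := by
  classical
  have hex := exists_mem_wordLT x hx a
  have hpos : Nat.find hex ≠ 0 := by
    intro h
    have := Nat.find_spec hex
    rw [h, wordLT_zero] at this
    exact ha (by simpa using this)
  obtain ⟨d, hd⟩ := Nat.exists_eq_succ_of_ne_zero hpos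
  have h1 : a ∈ wordLT x (d + 1) := by
    have := Nat.find_spec hex
    rwa [hd] at this
  obtain ⟨q, hq1, hq2, hq3⟩ := exists_symbol x ρ hρ hc d a h1
  refine ⟨d, q, ?_, hq1, hq3⟩
  rintro rfl
  have h2 : a ∈ wordLT x d := by simpa using hq2
  exact Nat.find_min hex (by omega : d < Nat.find hex) h2

theorem isHomogeneous_eq_zero {d : ℕ} {q : MvPolynomial G ℂ} (hq : q.IsHomogeneous d)
    (h : q ∈ degLT G d) : q = 0 := by
  ext m
  by_contra hm
  have hm' : coeff m q ≠ 0 := by simpa using hm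
  have h1 : m.degree = d := by
    exact (DFunLike.congr_fun (Finsupp.degree_eq_weight_one (R := ℕ)) m).trans (hq hm')
  exact hm' (h m h1.ge)

theorem isHomogeneous_mem_degLT {d : ℕ} {q : MvPolynomial G ℂ} (hq : q.IsHomogeneous d) :
    q ∈ degLT G (d + 1) := by
  intro m hm
  by_contra hm'
  have : m.degree = d :=
    (DFunLike.congr_fun (Finsupp.degree_eq_weight_one (R := ℕ)) m).trans (hq hm')
  omega

theorem noZeroDivisors_of_rep
    (hρ : ∀ g d p, p ∈ degLT G d → ρ (x g) p - X g * p ∈ degLT G d)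
    (hc : ∀ a b, x a * x b - x b * x a ∈ Submodule.span ℂ (Set.range x))
    (hx : Algebra.adjoin ℂ (Set.range x) = ⊤) : NoZeroDivisors A := by
  refine ⟨fun {a b} hab => ?_⟩
  by_contra hcon
  push Not at hcon
  obtain ⟨d, q, hq0, hq, hqρ⟩ := exists_leading x ρ hρ hc hx a hcon.1
  obtain ⟨e, r, hr0, hr, hrρ⟩ := exists_leading x ρ hρ hc hx b hcon.2
  have h1 : (1 : MvPolynomial G ℂ) ∈ degLT G (0 + 1) :=
    isHomogeneous_mem_degLT (isHomogeneous_one _ _)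
  have h2 := hrρ 0 1 h1
  rw [mul_one, zero_add] at h2
  have h3 : ρ b 1 ∈ degLT G (e + 1) := by
    have := Submodule.add_mem _ (degLT_mono (Nat.le_succ e) h2) (isHomogeneous_mem_degLT hr)
    simpa using this
  have h4 := hqρ e _ h3
  have h5 : ρ a (ρ b 1) = 0 := by
    rw [← Module.End.mul_apply, ← map_mul, hab, map_zero, LinearMap.zero_apply]
  rw [h5, zero_sub] at h4
  have h6 : q * (ρ b 1 - r) ∈ degLT G (e + d) := by
    rcases e with _ | e
    · have : ρ b 1 - r = 0 := by
        ext m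
        exact h2 m (Nat.zero_le _)
      rw [this, mul_zero]
      exact Submodule.zero_mem _
    · have h7 : ∀ m ∈ (ρ b 1 - r).support, q * monomial m (coeff m (ρ b 1 - r)) ∈
          degLT G (e + 1 + d) := by
        intro m hm
        have h8 : m.degree < e + 1 := by
          by_contra h
          exact (mem_support_iff.1 hm) (h2 m (by omega))
        have h9 := isHomogeneous_mem_degLT
          (hq.mul (isHomogeneous_monomial (coeff m (ρ b 1 - r)) (rfl : m.degree = m.degree)))
        exact degLT_mono (by omega) h9
      have h8 := Submodule.sum_mem _ h7
      rw [← Finset.mul_sum, ← as_sum] at h8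
      exact h8
  have h7 : q * r ∈ degLT G (d + e) := by
    have := Submodule.add_mem _ h4 h6
    rw [mul_sub, add_comm e d] at this
    have := Submodule.neg_mem _ this
    convert this using 1
    ring
  exact mul_ne_zero hq0 hr0 (isHomogeneous_eq_zero (hq.mul hr) h7)

theorem wordLT_le_span [Finite G]
    (hc : ∀ a b, x a * x b - x b * x a ∈ Submodule.span ℂ (Set.range x)) (n : ℕ) :
    wordLT x n ≤ Submodule.span ℂ (Set.range fun c : G → Fin n =>
      ordWord x (Finsupp.equivFunOnFinite.symm fun g => (c g : ℕ))) := by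
  induction n with
  | zero => rw [wordLT_zero]; exact bot_le
  | succ n ih =>
    refine Submodule.span_le.2 ?_
    rintro _ ⟨w, hw, rfl⟩
    have h1 : wordLT x n ≤ Submodule.span ℂ (Set.range fun c : G → Fin (n + 1) =>
        ordWord x (Finsupp.equivFunOnFinite.symm fun g => (c g : ℕ))) := by
      refine ih.trans (Submodule.span_mono ?_)
      rintro _ ⟨c, rfl⟩
      exact ⟨fun g => (c g).castSucc, by simp⟩
    have h2 := h1 (wordLT_mono x (by omega) (word_sub_ordWord x hc w))
    have h3 : ordWord x (wordExp w) ∈ Submodule.span ℂ (Set.range fun c : G → Fin (n + 1) =>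
        ordWord x (Finsupp.equivFunOnFinite.symm fun g => (c g : ℕ))) := by
      refine Submodule.subset_span ⟨fun g => ⟨wordExp w g, ?_⟩, ?_⟩
      · have := Finsupp.le_degree g (wordExp w)
        rw [degree_wordExp] at this
        omega
      · exact congrArg (ordWord x) (Finsupp.ext fun g => rfl)
    have h4 := Submodule.add_mem _ h2 h3
    rwa [sub_add_cancel] at h4

theorem finrank_wordLT_le [Fintype G]
    (hc : ∀ a b, x a * x b - x b * x a ∈ Submodule.span ℂ (Set.range x)) (n : ℕ) :
    Module.Finite ℂ (wordLT x n) ∧ Module.finrank ℂ (wordLT x n) ≤ n ^ Fintype.card G := by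
  classical
  have hle := wordLT_le_span x hc n
  have hfin : Module.Finite ℂ (Submodule.span ℂ (Set.range fun c : G → Fin n =>
      ordWord x (Finsupp.equivFunOnFinite.symm fun g => (c g : ℕ)))) :=
    Module.Finite.span_of_finite ℂ (Set.finite_range _)
  refine ⟨Submodule.finiteDimensional_of_le hle, (Submodule.finrank_mono hle).trans ?_⟩
  refine (finrank_range_le_card _).trans ?_
  simp

theorem not_two_pow_le (d N : ℕ) : ¬ ∀ k : ℕ, 2 ^ k ≤ (k * d + 1) ^ N := by
  intro h
  have h1 := tendsto_pow_const_div_const_pow_of_one_lt N (one_lt_two : (1 : ℝ) < 2)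
  have hpos : (0 : ℝ) < 1 / ((d : ℝ) + 1) ^ N := by positivity
  obtain ⟨k, hk, hk1⟩ := ((h1.eventually_lt_const hpos).and
    (Filter.eventually_ge_atTop 1)).exists
  have h2 : ((2 : ℝ) ^ k) ≤ ((k : ℝ) * (d + 1)) ^ N := by
    have h3 : ((2 : ℝ) ^ k) ≤ ((k : ℝ) * d + 1) ^ N := by exact_mod_cast h k
    refine h3.trans ?_
    gcongr
    have : (1 : ℝ) ≤ k := by exact_mod_cast hk1
    linarith
  rw [div_lt_div_iff₀ (by positivity) (by positivity)] at hk
  rw [mul_pow] at h2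
  linarith

theorem exists_common_multiple [Finite G] [NoZeroDivisors A] [Nontrivial A]
    (hc : ∀ a b, x a * x b - x b * x a ∈ Submodule.span ℂ (Set.range x))
    (hx : Algebra.adjoin ℂ (Set.range x) = ⊤) (a b : A) (hb : b ≠ 0) :
    ∃ u v : A, u ≠ 0 ∧ u * a = v * b := by
  classical
  have := Fintype.ofFinite G
  by_contra hcon
  push Not at hcon
  obtain ⟨d1, hd1⟩ := exists_mem_wordLT x hx a
  obtain ⟨d2, hd2⟩ := exists_mem_wordLT x hx b
  have hda := wordLT_mono x (le_max_left d1 d2) hd1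
  have hdb := wordLT_mono x (le_max_right d1 d2) hd2
  set d := max d1 d2
  have hfin : ∀ n, Module.Finite ℂ (wordLT x n) := fun n => (finrank_wordLT_le x hc n).1
  have hdouble : ∀ n, 2 * Module.finrank ℂ (wordLT x n) ≤
      Module.finrank ℂ (wordLT x (n + d)) := by
    intro n
    let T : (wordLT x n × wordLT x n) →ₗ[ℂ] wordLT x (n + d) :=
      LinearMap.codRestrict _
        ((LinearMap.mulRight ℂ a).comp ((wordLT x n).subtype.comp (LinearMap.fst ℂ _ _)) -
          (LinearMap.mulRight ℂ b).comp ((wordLT x n).subtype.comp (LinearMap.snd ℂ _ _)))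
        (fun c => Submodule.sub_mem _ (wordLT_mul x c.1.2 hda) (wordLT_mul x c.2.2 hdb))
    have hT : Function.Injective T := by
      rw [← LinearMap.ker_eq_bot, LinearMap.ker_eq_bot']
      rintro ⟨u, v⟩ huv
      have h1 : (u : A) * a - (v : A) * b = 0 := congrArg Subtype.val huv
      have hu : (u : A) = 0 := by
        by_contra hu
        exact hcon u v hu (sub_eq_zero.1 h1)
      have hv : (v : A) = 0 := by
        rw [hu, zero_mul, zero_sub, neg_eq_zero] at h1
        exact (mul_eq_zero.1 h1).resolve_right hb
      ext
      · exact hu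
      · exact hv
    have := LinearMap.finrank_le_finrank_of_injective hT
    rw [Module.finrank_prod] at this
    omega
  have hone : 1 ≤ Module.finrank ℂ (wordLT x 1) := by
    have h1 : (1 : A) ∈ wordLT x 1 := by simpa using word_mem x (d := 1) [] (by simp)
    have : Nontrivial (wordLT x 1) :=
      ⟨⟨⟨1, h1⟩, 0, fun h => one_ne_zero (congrArg Subtype.val h)⟩⟩
    exact Module.finrank_pos
  refine not_two_pow_le d (Fintype.card G) fun k => ?_
  refine le_trans ?_ (finrank_wordLT_le x hc (k * d + 1)).2
  induction k with
  | zero => simpa using hone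
  | succ k ih =>
    have := hdouble (k * d + 1)
    have e : (k + 1) * d + 1 = k * d + 1 + d := by ring
    rw [e, pow_succ]
    omega

open scoped nonZeroDivisors in
theorem nonempty_oreSet [Finite G] [NoZeroDivisors A] [Nontrivial A]
    (hc : ∀ a b, x a * x b - x b * x a ∈ Submodule.span ℂ (Set.range x))
    (hx : Algebra.adjoin ℂ (Set.range x) = ⊤) : Nonempty (OreLocalization.OreSet A⁰) := by
  rw [OreLocalization.nonempty_oreSet_iff_of_noZeroDivisors]
  intro r s
  obtain ⟨u, v, hu, huv⟩ :=
    exists_common_multiple x hc hx r s (nonZeroDivisors.coe_ne_zero s)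
  exact ⟨v, ⟨u, mem_nonZeroDivisors_of_ne_zero hu⟩, huv⟩

end Filtration

end QPainleve

namespace QPainleve

section Movable

variable {A : Type} [Ring A]

/-- Elements that can be moved past powers of `f`, up to enlarging the power. -/
def Movable (f b : A) : Prop := ∀ n : ℕ, ∃ (N : ℕ) (c : A), b * f ^ N = f ^ n * c

theorem Movable.large {f b : A} (hb : Movable f b) (n N₀ : ℕ) :
    ∃ N, ∀ M, N + N₀ ≤ M → ∃ c, b * f ^ M = f ^ n * c := by
  obtain ⟨N, c, h⟩ := hb n
  refine ⟨N, fun M hM => ⟨c * f ^ (M - N), ?_⟩⟩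
  rw [← mul_assoc, ← h, mul_assoc, ← pow_add]
  congr 2
  omega

theorem Movable.add {f a b : A} (ha : Movable f a) (hb : Movable f b) : Movable f (a + b) := by
  intro n
  obtain ⟨N, hN⟩ := ha.large n 0
  obtain ⟨M, hM⟩ := hb.large n 0
  obtain ⟨c, hc⟩ := hN (N + M) (by omega)
  obtain ⟨d, hd⟩ := hM (N + M) (by omega)
  exact ⟨N + M, c + d, by rw [add_mul, mul_add, hc, hd]⟩

theorem Movable.mul {f a b : A} (ha : Movable f a) (hb : Movable f b) : Movable f (a * b) := by
  intro n
  obtain ⟨N, c, hc⟩ := ha n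
  obtain ⟨M, d, hd⟩ := hb N
  exact ⟨M, c * d, by rw [mul_assoc, hd, ← mul_assoc, hc, mul_assoc]⟩

/-- If the commutator of `b` with `f` is movable, so is `b`. -/
theorem Movable.of_comm {f b c : A} (hc : Movable f c) (h : b * f = f * b + c) :
    Movable f b := by
  intro n
  induction n with
  | zero => exact ⟨0, b, by simp⟩
  | succ n ih =>
    obtain ⟨N, d, hd⟩ := ih
    obtain ⟨M, hM⟩ := hc.large (n + 1) 0
    obtain ⟨e, he⟩ := hM (N + M) (by omega)
    refine ⟨N + M + 1, d * f ^ M + e, ?_⟩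
    rw [pow_succ' f (N + M), ← mul_assoc, h, add_mul, he, pow_add, mul_assoc f b,
      ← mul_assoc b, hd, mul_add, pow_succ']
    simp only [mul_assoc]

theorem Movable.of_commute {f b : A} (h : b * f = f * b) : Movable f b := by
  intro n
  refine ⟨n, b, ?_⟩
  have : Commute b f := h
  exact (this.pow_right n).eq

theorem Movable.all [Algebra ℂ A] {G : Type} {x : G → A} (hx : Algebra.adjoin ℂ (Set.range x) = ⊤) {f : A}
    (h : ∀ g, Movable f (x g)) (a : A) : Movable f a := by
  have ha : a ∈ Algebra.adjoin ℂ (Set.range x) := by rw [hx]; trivial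
  induction ha using Algebra.adjoin_induction with
  | mem a ha =>
    obtain ⟨g, rfl⟩ := ha
    exact h g
  | algebraMap r => exact Movable.of_commute (Algebra.commutes r f)
  | add a b _ _ ha hb => exact ha.add hb
  | mul a b _ _ ha hb => exact ha.mul hb

end Movable

section Fractions

open OreLocalization
open scoped nonZeroDivisors

variable {A : Type} [Ring A] [Algebra ℂ A] [NoZeroDivisors A] [Nontrivial A] [OreSet A⁰]

/-- The inclusion of an Ore domain into its skew field of fractions. -/
noncomputable def fracHom (A : Type) [Ring A] [Algebra ℂ A] [NoZeroDivisors A] [Nontrivial A]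
    [OreSet A⁰] : A →ₐ[ℂ] OreLocalization A⁰ A :=
  { (numeratorRingHom : A →+* OreLocalization A⁰ A) with
    commutes' := fun _ => rfl }

theorem fracHom_injective : Function.Injective (fracHom A) :=
  numeratorHom_inj inf_le_left

theorem fracHom_ne_zero {a : A} (ha : a ≠ 0) : fracHom A a ≠ 0 := fun h =>
  ha (fracHom_injective (h.trans (map_zero _).symm))

theorem oreDiv_eq (r : A) (s : A⁰) : r /ₒ s = (fracHom A s)⁻¹ * fracHom A r := by
  have hs : fracHom A s ≠ 0 := fracHom_ne_zero (nonZeroDivisors.coe_ne_zero s)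
  have h : fracHom A s * (r /ₒ s) = fracHom A r := by
    change ((s : A) /ₒ 1) * (r /ₒ s) = r /ₒ 1
    exact OreLocalization.mul_cancel
  rw [← h, inv_mul_cancel_left₀ hs]

/-- An injective algebra homomorphism from an Ore domain to its skew field of fractions extends
to the skew field of fractions. -/
noncomputable def fracLift (φ : A →ₐ[ℂ] OreLocalization A⁰ A) (hφ : Function.Injective φ) :
    OreLocalization A⁰ A →ₐ[ℂ] OreLocalization A⁰ A :=
  have hs : ∀ s : A⁰, φ s ≠ 0 := fun s h =>
    nonZeroDivisors.coe_ne_zero s (hφ (h.trans (map_zero φ).symm))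
  { universalHom (φ : A →+* OreLocalization A⁰ A)
      { toFun := fun s => Units.mk0 (φ s) (hs s)
        map_one' := by ext; simp
        map_mul' := fun s t => by ext; simp } (fun _ => rfl) with
    commutes' := fun c => by
      have := universalHom_commutes (φ : A →+* OreLocalization A⁰ A)
        { toFun := fun s => Units.mk0 (φ s) (hs s)
          map_one' := by ext; simp
          map_mul' := fun s t => by ext; simp } (fun _ => rfl) (r := algebraMap ℂ A c)
      exact this.trans (φ.commutes c) }

theorem fracLift_fracHom (φ : A →ₐ[ℂ] OreLocalization A⁰ A) (hφ : Function.Injective φ) (a : A) :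
    fracLift φ hφ (fracHom A a) = φ a := by
  have hs : ∀ s : A⁰, φ s ≠ 0 := fun s h =>
    nonZeroDivisors.coe_ne_zero s (hφ (h.trans (map_zero φ).symm))
  exact universalHom_commutes (φ : A →+* OreLocalization A⁰ A)
        { toFun := fun s => Units.mk0 (φ s) (hs s)
          map_one' := by ext; simp
          map_mul' := fun s t => by ext; simp } (fun _ => rfl) (r := a)

theorem frac_ext {φ ψ : OreLocalization A⁰ A →ₐ[ℂ] OreLocalization A⁰ A}
    (h : φ.comp (fracHom A) = ψ.comp (fracHom A)) : φ = ψ := by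
  have h' : ∀ a, φ (fracHom A a) = ψ (fracHom A a) := fun a => DFunLike.congr_fun h a
  ext z
  induction z using OreLocalization.ind with
  | _ r s => rw [oreDiv_eq, map_mul, map_mul, map_inv₀, map_inv₀, h', h']

/-- A homomorphism to the skew field of fractions which fixes `f`, only introduces powers of `f`
as denominators, and squares to the identity, is injective. -/
theorem injective_of_involutive {G : Type} {x : G → A}
    (hx : Algebra.adjoin ℂ (Set.range x) = ⊤) (φ : A →ₐ[ℂ] OreLocalization A⁰ A)
    {f : A} (hf0 : f ≠ 0) (hf : φ f = fracHom A f) (hmov : ∀ g, Movable f (x g))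
    (hgood : ∀ g, ∃ (n : ℕ) (b : A), φ (x g) * fracHom A (f ^ n) = fracHom A b ∧
      φ b = fracHom A (x g) * fracHom A (f ^ n)) : Function.Injective φ := by
  have hfn : ∀ n, φ (f ^ n) = fracHom A (f ^ n) := fun n => by rw [map_pow, map_pow, hf]
  have key : ∀ a : A, ∃ (n : ℕ) (b : A), φ a * fracHom A (f ^ n) = fracHom A b ∧
      φ b = fracHom A a * fracHom A (f ^ n) := by
    intro a
    have ha : a ∈ Algebra.adjoin ℂ (Set.range x) := by rw [hx]; trivial
    induction ha using Algebra.adjoin_induction with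
    | mem a ha =>
      obtain ⟨g, rfl⟩ := ha
      exact hgood g
    | algebraMap r => exact ⟨0, algebraMap ℂ A r, by simp, by simp⟩
    | add a a' _ _ ha ha' =>
      obtain ⟨n, b, h1, h2⟩ := ha
      obtain ⟨n', b', h1', h2'⟩ := ha'
      refine ⟨n + n', b * f ^ n' + b' * f ^ n, ?_, ?_⟩
      · have e : φ (a + a') * fracHom A (f ^ (n + n')) =
            φ a * fracHom A (f ^ n) * fracHom A (f ^ n') +
              φ a' * fracHom A (f ^ n') * fracHom A (f ^ n) := by
          rw [mul_assoc, mul_assoc, ← map_mul (fracHom A), ← map_mul (fracHom A), ← pow_add,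
            ← pow_add, add_comm n' n, ← add_mul, map_add]
        rw [e, h1, h1', map_add, map_mul, map_mul]
      · have e : fracHom A (a + a') * fracHom A (f ^ (n + n')) =
            fracHom A a * fracHom A (f ^ n) * fracHom A (f ^ n') +
              fracHom A a' * fracHom A (f ^ n') * fracHom A (f ^ n) := by
          rw [mul_assoc, mul_assoc, ← map_mul (fracHom A) (f ^ n), ← map_mul (fracHom A) (f ^ n'),
            ← pow_add, ← pow_add, add_comm n' n, ← add_mul, map_add]
        rw [e, map_add, map_mul, map_mul, h2, h2', hfn, hfn]
    | mul a a' _ _ ha ha' =>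
      obtain ⟨n, b, h1, h2⟩ := ha
      obtain ⟨n', b', h1', h2'⟩ := ha'
      obtain ⟨N, c, hc⟩ := Movable.all hx hmov b' n
      have hc1 : fracHom A b' * fracHom A (f ^ N) = fracHom A (f ^ n) * fracHom A c := by
        rw [← map_mul, hc, map_mul]
      have hc2 : φ b' * fracHom A (f ^ N) = fracHom A (f ^ n) * φ c := by
        rw [← hfn, ← map_mul, hc, map_mul, hfn]
      refine ⟨n' + N, b * c, ?_, ?_⟩
      · rw [pow_add, map_mul, map_mul, map_mul, mul_assoc, ← mul_assoc (φ a'), h1', hc1,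
          ← mul_assoc, h1]
      · rw [map_mul, h2, mul_assoc, ← hc2, h2', pow_add, map_mul, map_mul]
        simp only [mul_assoc]
  rw [injective_iff_map_eq_zero]
  intro a ha
  obtain ⟨n, b, h1, h2⟩ := key a
  rw [ha, zero_mul] at h1
  have hb : b = 0 := fracHom_injective (h1.symm.trans (map_zero _).symm)
  rw [hb, map_zero, ← map_mul] at h2
  have h3 : a * f ^ n = 0 := fracHom_injective (h2.symm.trans (map_zero _).symm)
  exact (mul_eq_zero.1 h3).resolve_right (pow_ne_zero n hf0)

end Fractions

end QPainleve

namespace QPainleve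

section Operators

open MvPolynomial

variable {G : Type}

theorem X_mul_pderiv_mem_degLT {d : ℕ} {p : MvPolynomial G ℂ} (hp : p ∈ degLT G d) (a g : G) :
    X a * pderiv g p ∈ degLT G d := by
  classical
  have h1 : ∀ m ∈ p.support, X a * pderiv g (monomial m (coeff m p)) ∈ degLT G d := by
    intro m hm
    have hd : m.degree < d := by
      by_contra h
      exact (mem_support_iff.1 hm) (hp m (by omega))
    rw [pderiv_monomial]
    rcases Nat.eq_zero_or_pos (m g) with h0 | h0
    · simp [h0]
    · have hle : Finsupp.single g 1 ≤ m := by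
        rw [Finsupp.single_le_iff]; exact h0
      have h2 : (m - Finsupp.single g 1 + Finsupp.single g 1).degree = m.degree := by
        rw [tsub_add_cancel_of_le hle]
      rw [map_add, Finsupp.degree_single] at h2
      rw [X, monomial_mul]
      refine degLT_mono ?_ (isHomogeneous_mem_degLT (isHomogeneous_monomial _ rfl))
      rw [map_add, Finsupp.degree_single]
      omega
  have h2 := Submodule.sum_mem _ h1
  rwa [← Finset.mul_sum, ← map_sum, ← as_sum] at h2

theorem pderiv_comm' (a b : G) (p : MvPolynomial G ℂ) :
    pderiv a (pderiv b p) = pderiv b (pderiv a p) := by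
  classical
  have h : ⁅(pderiv a : Derivation ℂ (MvPolynomial G ℂ) (MvPolynomial G ℂ)),
      (pderiv b : Derivation ℂ (MvPolynomial G ℂ) (MvPolynomial G ℂ))⁆ = 0 := by
    apply derivation_ext
    intro i
    rw [Derivation.commutator_apply, pderiv_X, pderiv_X]
    simp [Pi.single_apply, apply_ite]
  have := DFunLike.congr_fun h p
  rw [Derivation.commutator_apply] at this
  exact sub_eq_zero.1 this

end Operators

section General

variable (l : ℕ)

/-- The orientation matrix `U = (u_ij)` of type `A_l^{(1)}` for `l ≥ 2`:
`u_{i,i+1} = 1`, `u_{i,i-1} = -1` and all other entries vanish. -/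
def u (i j : ZMod (l + 1)) : ℂ := (if j = i + 1 then 1 else 0) - (if j = i - 1 then 1 else 0)

/-- The generalized Cartan matrix of type `A_l^{(1)}` for `l ≥ 2`. -/
def cartan (i j : ZMod (l + 1)) : ℂ :=
  if j = i then 2 else if j = i + 1 ∨ j = i - 1 then -1 else 0

theorem u_antisymm (i j : ZMod (l + 1)) : u l j i = -u l i j := by
  have h1 : i = j + 1 ↔ j = i - 1 := by rw [eq_sub_iff_add_eq, eq_comm]
  have h2 : i = j - 1 ↔ j = i + 1 := by rw [eq_sub_iff_add_eq, eq_comm]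
  simp only [u, h1, h2]
  ring

theorem u_self (i : ZMod (l + 1)) : u l i i = 0 := by
  have := u_antisymm l i i
  exact self_eq_neg.1 this

theorem cartan_self (i : ZMod (l + 1)) : cartan l i i = 2 := if_pos rfl

/-- The generators of the algebra. -/
inductive Gen : Type
  | f (i : ZMod (l + 1)) : Gen
  | α (i : ZMod (l + 1)) : Gen
  | h : Gen

instance : Finite (Gen l) :=
  Finite.of_surjective
    (fun t : Option (ZMod (l + 1) ⊕ ZMod (l + 1)) => match t with
      | some (Sum.inl i) => Gen.f i
      | some (Sum.inr i) => Gen.α i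
      | none => Gen.h)
    (fun g => match g with
      | Gen.f i => ⟨some (Sum.inl i), rfl⟩
      | Gen.α i => ⟨some (Sum.inr i), rfl⟩
      | Gen.h => ⟨none, rfl⟩)

/-- The defining relations `[f_i, f_j] = u_ij h`, with all `α_i` and `h` central. For `l ≥ 2` the
first one says `[f_i, f_{i+1}] = h` and `[f_i, f_j] = 0` for `j ≠ i ± 1`. -/
inductive Rel : FreeAlgebra ℂ (Gen l) → FreeAlgebra ℂ (Gen l) → Prop
  | ff (i j : ZMod (l + 1)) :
      Rel (FreeAlgebra.ι ℂ (Gen.f i) * FreeAlgebra.ι ℂ (Gen.f j) -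
        FreeAlgebra.ι ℂ (Gen.f j) * FreeAlgebra.ι ℂ (Gen.f i)) (u l i j • FreeAlgebra.ι ℂ Gen.h)
  | fα (i j : ZMod (l + 1)) :
      Rel (FreeAlgebra.ι ℂ (Gen.f i) * FreeAlgebra.ι ℂ (Gen.α j) -
        FreeAlgebra.ι ℂ (Gen.α j) * FreeAlgebra.ι ℂ (Gen.f i)) 0
  | αα (i j : ZMod (l + 1)) :
      Rel (FreeAlgebra.ι ℂ (Gen.α i) * FreeAlgebra.ι ℂ (Gen.α j) -
        FreeAlgebra.ι ℂ (Gen.α j) * FreeAlgebra.ι ℂ (Gen.α i)) 0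
  | hf (j : ZMod (l + 1)) :
      Rel (FreeAlgebra.ι ℂ Gen.h * FreeAlgebra.ι ℂ (Gen.f j) -
        FreeAlgebra.ι ℂ (Gen.f j) * FreeAlgebra.ι ℂ Gen.h) 0
  | hα (j : ZMod (l + 1)) :
      Rel (FreeAlgebra.ι ℂ Gen.h * FreeAlgebra.ι ℂ (Gen.α j) -
        FreeAlgebra.ι ℂ (Gen.α j) * FreeAlgebra.ι ℂ Gen.h) 0

/-- The associative algebra with generators `f_i, α_i, h` and the above relations. -/
def A : Type := RingQuot (Rel l)

noncomputable instance : Ring (A l) := inferInstanceAs (Ring (RingQuot (Rel l)))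

noncomputable instance : Algebra ℂ (A l) := inferInstanceAs (Algebra ℂ (RingQuot (Rel l)))

/-- The generators as elements of the algebra. -/
noncomputable def gen (g : Gen l) : A l := RingQuot.mkAlgHom ℂ (Rel l) (FreeAlgebra.ι ℂ g)

section Lift

variable {B : Type} [Ring B] [Algebra ℂ B]

/-- A map of generators respecting the defining relations. -/
structure IsRep (F : Gen l → B) : Prop where
  ff : ∀ i j, F (Gen.f i) * F (Gen.f j) - F (Gen.f j) * F (Gen.f i) = u l i j • F Gen.h
  fα : ∀ i j, F (Gen.f i) * F (Gen.α j) - F (Gen.α j) * F (Gen.f i) = 0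
  αα : ∀ i j, F (Gen.α i) * F (Gen.α j) - F (Gen.α j) * F (Gen.α i) = 0
  hf : ∀ j, F Gen.h * F (Gen.f j) - F (Gen.f j) * F Gen.h = 0
  hα : ∀ j, F Gen.h * F (Gen.α j) - F (Gen.α j) * F Gen.h = 0

variable {l}

/-- The homomorphism out of the algebra determined by the images of the generators. -/
noncomputable def lift {F : Gen l → B} (hF : IsRep l F) : A l →ₐ[ℂ] B :=
  RingQuot.liftAlgHom ℂ ⟨FreeAlgebra.lift ℂ F, by
    intro a b hab
    cases hab with
    | ff i j => simpa using hF.ff i j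
    | fα i j => simpa using hF.fα i j
    | αα i j => simpa using hF.αα i j
    | hf j => simpa using hF.hf j
    | hα j => simpa using hF.hα j⟩

theorem lift_gen {F : Gen l → B} (hF : IsRep l F) (g : Gen l) : lift hF (gen l g) = F g :=
  (RingQuot.liftAlgHom_mkAlgHom_apply (S := ℂ) _ _ _).trans (FreeAlgebra.lift_ι_apply _ _)

theorem alg_ext {φ ψ : A l →ₐ[ℂ] B} (h : ∀ g, φ (gen l g) = ψ (gen l g)) : φ = ψ :=
  RingQuot.ringQuot_ext' _ _ _ (FreeAlgebra.hom_ext (funext h))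

theorem isRep_comp (φ : A l →ₐ[ℂ] B) : IsRep l fun g => φ (gen l g) := by
  have key : ∀ a b, Rel l a b →
      φ (RingQuot.mkAlgHom ℂ (Rel l) a) = φ (RingQuot.mkAlgHom ℂ (Rel l) b) :=
    fun a b h => congrArg φ (RingQuot.mkAlgHom_rel ℂ h)
  have e : ∀ a b, φ (RingQuot.mkAlgHom ℂ (Rel l) (a - b)) =
      φ (RingQuot.mkAlgHom ℂ (Rel l) a) - φ (RingQuot.mkAlgHom ℂ (Rel l) b) :=
    fun a b => (congrArg φ (map_sub _ a b)).trans (map_sub φ _ _)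
  have e' : ∀ a b, φ (RingQuot.mkAlgHom ℂ (Rel l) (a * b)) =
      φ (RingQuot.mkAlgHom ℂ (Rel l) a) * φ (RingQuot.mkAlgHom ℂ (Rel l) b) :=
    fun a b => (congrArg φ (map_mul _ a b)).trans (map_mul φ _ _)
  have e0 : φ (RingQuot.mkAlgHom ℂ (Rel l) 0) = 0 := (congrArg φ (map_zero _)).trans (map_zero φ)
  have es : ∀ (c : ℂ) a, φ (RingQuot.mkAlgHom ℂ (Rel l) (c • a)) =
      c • φ (RingQuot.mkAlgHom ℂ (Rel l) a) :=
    fun c a => (congrArg φ (map_smul (RingQuot.mkAlgHom ℂ (Rel l)) c a)).trans (map_smul φ _ _)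
  refine ⟨fun i j => ?_, fun i j => ?_, fun i j => ?_, fun j => ?_, fun j => ?_⟩
  · have := key _ _ (Rel.ff i j)
    rwa [e, e', e', es] at this
  · have := key _ _ (Rel.fα i j)
    rwa [e, e', e', e0] at this
  · have := key _ _ (Rel.αα i j)
    rwa [e, e', e', e0] at this
  · have := key _ _ (Rel.hf j)
    rwa [e, e', e', e0] at this
  · have := key _ _ (Rel.hα j)
    rwa [e, e', e', e0] at this

end Lift

theorem adjoin_gen : Algebra.adjoin ℂ (Set.range (gen l)) = ⊤ := by
  let S := Algebra.adjoin ℂ (Set.range (gen l))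
  have hS : ∀ g, gen l g ∈ S := fun g => Algebra.subset_adjoin ⟨g, rfl⟩
  have h0 := isRep_comp (AlgHom.id ℂ (A l))
  have hr : IsRep l (fun g => (⟨gen l g, hS g⟩ : S)) :=
    ⟨fun i j => Subtype.ext (h0.ff i j), fun i j => Subtype.ext (h0.fα i j),
      fun i j => Subtype.ext (h0.αα i j), fun j => Subtype.ext (h0.hf j),
      fun j => Subtype.ext (h0.hα j)⟩
  have h1 : S.val.comp (lift hr) = AlgHom.id ℂ (A l) := by
    apply alg_ext
    intro g
    rw [AlgHom.comp_apply, lift_gen]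
    rfl
  rw [eq_top_iff]
  intro a _
  have := DFunLike.congr_fun h1 a
  rw [AlgHom.id_apply] at this
  rw [← this]
  exact (lift hr a).2

open MvPolynomial in
/-- The operators representing the generators on commutative polynomials. -/
noncomputable def repGen : Gen l → Module.End ℂ (MvPolynomial (Gen l) ℂ)
  | Gen.f i => LinearMap.mulLeft ℂ (X (Gen.f i)) + (1 / 2 : ℂ) • (LinearMap.mulLeft ℂ (X Gen.h)).comp
      ((pderiv (Gen.f (i + 1))).toLinearMap - (pderiv (Gen.f (i - 1))).toLinearMap)
  | Gen.α i => LinearMap.mulLeft ℂ (X (Gen.α i))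
  | Gen.h => LinearMap.mulLeft ℂ (X Gen.h)

open MvPolynomial in
theorem isRep_repGen : IsRep l (repGen l) := by
  classical
  have half : (C (2⁻¹ : ℂ) + C (2⁻¹ : ℂ) : MvPolynomial (Gen l) ℂ) = 1 := by
    rw [← C_add]; norm_num
  refine ⟨fun i j => ?_, fun i j => ?_, fun i j => ?_, fun j => ?_, fun j => ?_⟩
  · refine LinearMap.ext fun p => ?_
    have hu : C (u l i j) * (X Gen.h * p) =
        (C (2⁻¹ : ℂ) + C (2⁻¹ : ℂ)) * C (u l i j) * (X Gen.h * p) := by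
      rw [half, one_mul]
    have h1 : i = j + 1 ↔ j = i - 1 := by rw [eq_sub_iff_add_eq, eq_comm]
    have h2 : i = j - 1 ↔ j = i + 1 := by rw [eq_sub_iff_add_eq, eq_comm]
    have h3 := pderiv_comm' (Gen.f (i + 1)) (Gen.f (j + 1)) p
    have h4 := pderiv_comm' (Gen.f (i + 1)) (Gen.f (j - 1)) p
    have h5 := pderiv_comm' (Gen.f (i - 1)) (Gen.f (j + 1)) p
    have h6 := pderiv_comm' (Gen.f (i - 1)) (Gen.f (j - 1)) p
    simp only [repGen, LinearMap.sub_apply, Module.End.mul_apply, LinearMap.add_apply,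
      LinearMap.smul_apply, LinearMap.comp_apply, LinearMap.mulLeft_apply, one_div,
      Derivation.coeFn_coe, smul_eq_C_mul, map_add, map_sub, Derivation.leibniz, pderiv_C,
      pderiv_X, Pi.single_apply, Gen.f.injEq, reduceCtorEq, if_false, smul_eq_mul, h3, h4, h5, h6,
      h1, h2]
    rw [hu, u, C_sub]
    split_ifs <;> simp only [map_one, map_zero] <;> ring
  · refine LinearMap.ext fun p => ?_
    simp only [repGen, LinearMap.sub_apply, Module.End.mul_apply, LinearMap.add_apply,
      LinearMap.smul_apply, LinearMap.comp_apply, LinearMap.mulLeft_apply, one_div,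
      Derivation.coeFn_coe, smul_eq_C_mul, map_add, map_sub, Derivation.leibniz,
      pderiv_X, Pi.single_apply, reduceCtorEq, if_false, smul_eq_mul, LinearMap.zero_apply]
    ring
  · refine LinearMap.ext fun p => ?_
    simp only [repGen, LinearMap.sub_apply, Module.End.mul_apply, LinearMap.mulLeft_apply,
      LinearMap.zero_apply]
    ring
  · refine LinearMap.ext fun p => ?_
    simp only [repGen, LinearMap.sub_apply, Module.End.mul_apply, LinearMap.add_apply,
      LinearMap.smul_apply, LinearMap.comp_apply, LinearMap.mulLeft_apply, one_div,
      Derivation.coeFn_coe, smul_eq_C_mul, map_add, map_sub, Derivation.leibniz,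
      pderiv_X, Pi.single_apply, reduceCtorEq, if_false, smul_eq_mul, LinearMap.zero_apply]
    ring
  · refine LinearMap.ext fun p => ?_
    simp only [repGen, LinearMap.sub_apply, Module.End.mul_apply, LinearMap.mulLeft_apply,
      LinearMap.zero_apply]
    ring

open MvPolynomial in
theorem repGen_sub (g : Gen l) (d : ℕ) (p : MvPolynomial (Gen l) ℂ) (hp : p ∈ degLT (Gen l) d) :
    lift (isRep_repGen l) (gen l g) p - X g * p ∈ degLT (Gen l) d := by
  rw [lift_gen]
  cases g with
  | f i =>
    have h1 := Submodule.sub_mem _ (X_mul_pderiv_mem_degLT hp Gen.h (Gen.f (i + 1)))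
      (X_mul_pderiv_mem_degLT hp Gen.h (Gen.f (i - 1)))
    have h2 := Submodule.smul_mem _ (1 / 2 : ℂ) h1
    rw [← mul_sub] at h2
    simpa [repGen] using h2
  | α i => simp [repGen]
  | h => simp [repGen]

theorem gen_comm (a b : Gen l) :
    gen l a * gen l b - gen l b * gen l a ∈ Submodule.span ℂ (Set.range (gen l)) := by
  have h0 := isRep_comp (AlgHom.id ℂ (A l))
  have hz := Submodule.zero_mem (Submodule.span ℂ (Set.range (gen l)))
  have hneg : ∀ a b : A l, a * b - b * a = -(b * a - a * b) := fun a b => by abel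
  cases a with
  | f i =>
    cases b with
    | f j =>
      have := h0.ff i j
      simp only [AlgHom.id_apply] at this
      rw [this]
      exact Submodule.smul_mem _ _ (Submodule.subset_span ⟨_, rfl⟩)
    | α j =>
      have := h0.fα i j
      simp only [AlgHom.id_apply] at this
      rwa [this]
    | h =>
      have := h0.hf i
      simp only [AlgHom.id_apply] at this
      rwa [hneg, this, neg_zero]
  | α i =>
    cases b with
    | f j =>
      have := h0.fα j i
      simp only [AlgHom.id_apply] at this
      rwa [hneg, this, neg_zero]
    | α j =>
      have := h0.αα i j
      simp only [AlgHom.id_apply] at this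
      rwa [this]
    | h =>
      have := h0.hα i
      simp only [AlgHom.id_apply] at this
      rwa [hneg, this, neg_zero]
  | h =>
    cases b with
    | f j =>
      have := h0.hf j
      simp only [AlgHom.id_apply] at this
      rwa [this]
    | α j =>
      have := h0.hα j
      simp only [AlgHom.id_apply] at this
      rwa [this]
    | h => rwa [sub_self]

theorem gen_ne_zero (g : Gen l) : gen l g ≠ 0 := by
  intro h
  have h1 := congrArg (fun a => lift (isRep_repGen l) a 1) h
  simp only [lift_gen, map_zero, LinearMap.zero_apply] at h1
  have h2 : repGen l g 1 = MvPolynomial.X g := by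
    cases g <;> simp [repGen]
  rw [h2] at h1
  exact MvPolynomial.X_ne_zero g h1

instance : Nontrivial (A l) := ⟨⟨gen l Gen.h, 0, gen_ne_zero l Gen.h⟩⟩

instance : NoZeroDivisors (A l) :=
  noZeroDivisors_of_rep (gen l) (lift (isRep_repGen l)) (repGen_sub l) (gen_comm l) (adjoin_gen l)

open scoped nonZeroDivisors in
noncomputable instance : OreLocalization.OreSet (A l)⁰ :=
  Classical.choice (nonempty_oreSet (gen l) (gen_comm l) (adjoin_gen l))

open scoped nonZeroDivisors in
/-- The skew field of fractions of the Ore domain `A l`. -/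
abbrev K : Type := OreLocalization (A l)⁰ (A l)

/-- The generator `f_i` of the skew field. -/
noncomputable def f (i : ZMod (l + 1)) : K l := fracHom (A l) (gen l (Gen.f i))

/-- The generator `α_i` of the skew field. -/
noncomputable def α (i : ZMod (l + 1)) : K l := fracHom (A l) (gen l (Gen.α i))

/-- The generator `h` of the skew field. -/
noncomputable def h : K l := fracHom (A l) (gen l Gen.h)

end General

end QPainleve

namespace QPainleve

section Extend

open scoped nonZeroDivisors

theorem inv_mul_of_comm {D : Type} [DivisionRing D] {a b c : D} (ha : a ≠ 0)
    (h : a * b = b * a + c) (hc : a * c = c * a) : a⁻¹ * b = b * a⁻¹ - c * a⁻¹ * a⁻¹ := by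
  rw [inv_mul_eq_iff_eq_mul₀ ha, mul_sub, ← mul_assoc, h, add_mul, mul_assoc b, mul_inv_cancel₀ ha,
    ← mul_assoc, ← mul_assoc, hc, mul_assoc c, mul_inv_cancel₀ ha]
  simp

variable {A : Type} [Ring A] [Algebra ℂ A] [NoZeroDivisors A] [Nontrivial A]
  [OreLocalization.OreSet A⁰]

theorem fracLift_comp_symm (e : A ≃ₐ[ℂ] A) :
    (fracLift ((fracHom A).comp (e : A →ₐ[ℂ] A)) (fracHom_injective.comp e.injective)).comp
      (fracLift ((fracHom A).comp (e.symm : A →ₐ[ℂ] A))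
        (fracHom_injective.comp e.symm.injective)) = AlgHom.id ℂ _ := by
  refine frac_ext (AlgHom.ext fun a => ?_)
  have h1 := fracLift_fracHom ((fracHom A).comp (e.symm : A →ₐ[ℂ] A))
    (fracHom_injective.comp e.symm.injective) a
  have h2 := fracLift_fracHom ((fracHom A).comp (e : A →ₐ[ℂ] A))
    (fracHom_injective.comp e.injective) (e.symm a)
  exact (congrArg _ h1).trans (h2.trans (congrArg (fracHom A) (e.apply_symm_apply a)))

/-- The extension of an automorphism of an Ore domain to its skew field of fractions. -/
noncomputable def fracEquiv (e : A ≃ₐ[ℂ] A) : OreLocalization A⁰ A ≃ₐ[ℂ] OreLocalization A⁰ A :=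
  AlgEquiv.ofAlgHom
    (fracLift ((fracHom A).comp (e : A →ₐ[ℂ] A)) (fracHom_injective.comp e.injective))
    (fracLift ((fracHom A).comp (e.symm : A →ₐ[ℂ] A)) (fracHom_injective.comp e.symm.injective))
    (fracLift_comp_symm e) (fracLift_comp_symm e.symm)

theorem fracEquiv_fracHom (e : A ≃ₐ[ℂ] A) (a : A) :
    fracEquiv e (fracHom A a) = fracHom A (e a) :=
  fracLift_fracHom ((fracHom A).comp (e : A →ₐ[ℂ] A)) (fracHom_injective.comp e.injective) a

end Extend

section Action

variable (l : ℕ)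

theorem isRep_K : IsRep l fun g => fracHom (A l) (gen l g) := isRep_comp (fracHom (A l))

theorem f_mul_f (i j : ZMod (l + 1)) : f l i * f l j = f l j * f l i + u l i j • h l := by
  rw [← sub_eq_iff_eq_add']
  exact (isRep_K l).ff i j

theorem commute_α_f (i j : ZMod (l + 1)) : Commute (α l i) (f l j) :=
  (sub_eq_zero.1 ((isRep_K l).fα j i)).symm

theorem commute_α_α (i j : ZMod (l + 1)) : Commute (α l i) (α l j) :=
  sub_eq_zero.1 ((isRep_K l).αα i j)

theorem commute_h_f (j : ZMod (l + 1)) : Commute (h l) (f l j) :=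
  sub_eq_zero.1 ((isRep_K l).hf j)

theorem commute_h_α (j : ZMod (l + 1)) : Commute (h l) (α l j) :=
  sub_eq_zero.1 ((isRep_K l).hα j)

theorem f_ne_zero (i : ZMod (l + 1)) : f l i ≠ 0 := fracHom_ne_zero (gen_ne_zero l _)

theorem div_mul_f (i k : ZMod (l + 1)) : α l i / f l i * f l k =
    f l k * (α l i / f l i) - u l i k • (α l i * h l * (f l i)⁻¹ * (f l i)⁻¹) := by
  have h1 := inv_mul_of_comm (f_ne_zero l i) (f_mul_f l i k)
    (by rw [mul_smul_comm, smul_mul_assoc, (commute_h_f l i).eq])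
  rw [div_eq_mul_inv, mul_assoc, h1, mul_sub, ← mul_assoc, (commute_α_f l i k).eq, mul_assoc]
  simp only [smul_mul_assoc, mul_smul_comm, mul_assoc]

theorem commute_α_div (i j : ZMod (l + 1)) : Commute (α l i) (α l j / f l j) := by
  rw [div_eq_mul_inv]
  exact (commute_α_α l i j).mul_right (commute_α_f l i j).inv_right₀

theorem commute_h_div (j : ZMod (l + 1)) : Commute (h l) (α l j / f l j) := by
  rw [div_eq_mul_inv]
  exact (commute_h_α l j).mul_right (commute_h_f l j).inv_right₀

/-- The images of the generators under `s_i`. -/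
noncomputable def sGen (i : ZMod (l + 1)) : Gen l → K l
  | Gen.f j => f l j + u l i j • (α l i / f l i)
  | Gen.α j => α l j - cartan l i j • α l i
  | Gen.h => h l

theorem isRep_sGen (i : ZMod (l + 1)) : IsRep l (sGen l i) := by
  refine ⟨fun j k => ?_, fun j k => ?_, fun j k => ?_, fun j => ?_, fun j => ?_⟩
  · have h1 := div_mul_f l i j
    have h2 := div_mul_f l i k
    have h3 := f_mul_f l j k
    simp only [sGen, add_mul, mul_add, smul_mul_assoc, mul_smul_comm, h1, h2, h3]
    module
  · rw [sub_eq_zero]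
    have h1 := ((commute_α_f l k j).sub_left ((commute_α_f l i j).smul_left (cartan l i k)))
    have h2 := ((commute_α_div l k i).sub_left ((commute_α_div l i i).smul_left (cartan l i k)))
    exact (h1.add_right (h2.smul_right (u l i j))).symm
  · rw [sub_eq_zero]
    have h1 := ((commute_α_α l j k).sub_left ((commute_α_α l i k).smul_left (cartan l i j)))
    have h2 := ((commute_α_α l j i).sub_left ((commute_α_α l i i).smul_left (cartan l i j)))
    exact h1.sub_right (h2.smul_right (cartan l i k))
  · rw [sub_eq_zero]
    exact (commute_h_f l j).add_right ((commute_h_div l i).smul_right (u l i j))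
  · rw [sub_eq_zero]
    exact (commute_h_α l j).sub_right ((commute_h_α l i).smul_right (cartan l i j))

theorem movable_gen (i : ZMod (l + 1)) (g : Gen l) : Movable (gen l (Gen.f i)) (gen l g) := by
  have h0 := isRep_comp (AlgHom.id ℂ (A l))
  cases g with
  | f j =>
    refine Movable.of_comm (c := u l j i • gen l Gen.h) (Movable.of_commute ?_) ?_
    · have := sub_eq_zero.1 (h0.hf i)
      simp only [AlgHom.id_apply] at this
      rw [smul_mul_assoc, mul_smul_comm, this]
    · rw [← sub_eq_iff_eq_add']
      exact h0.ff j i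
  | α j => exact Movable.of_commute (sub_eq_zero.1 (h0.fα i j)).symm
  | h => exact Movable.of_commute (sub_eq_zero.1 (h0.hf i))

theorem sGen_injective (i : ZMod (l + 1)) : Function.Injective (lift (isRep_sGen l i)) := by
  have hf : lift (isRep_sGen l i) (gen l (Gen.f i)) = fracHom (A l) (gen l (Gen.f i)) := by
    rw [lift_gen, sGen, u_self, zero_smul, add_zero, f]
  have hα : lift (isRep_sGen l i) (gen l (Gen.α i)) = -fracHom (A l) (gen l (Gen.α i)) := by
    rw [lift_gen, sGen, cartan_self, two_smul, α]
    abel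
  refine injective_of_involutive (adjoin_gen l) _ (gen_ne_zero l (Gen.f i)) hf
    (movable_gen l i) ?_
  intro g
  cases g with
  | f j =>
    refine ⟨1, gen l (Gen.f j) * gen l (Gen.f i) + u l i j • gen l (Gen.α i), ?_, ?_⟩
    · rw [lift_gen, sGen, pow_one, map_add, map_mul, map_smul]
      change (_ + _ • (_ / f l i)) * f l i = f l j * f l i + _ • α l i
      rw [add_mul, smul_mul_assoc, div_mul_cancel₀ _ (f_ne_zero l i)]
    · rw [map_add, map_mul, hf, map_smul, hα, lift_gen, sGen, pow_one]
      change (_ + _ • (_ / f l i)) * f l i + _ • -α l i = f l j * f l i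
      rw [add_mul, smul_mul_assoc, div_mul_cancel₀ _ (f_ne_zero l i), smul_neg,
        add_neg_cancel_right]
  | α j =>
    refine ⟨0, gen l (Gen.α j) - cartan l i j • gen l (Gen.α i), ?_, ?_⟩
    · rw [lift_gen, sGen, pow_zero, map_one, mul_one, map_sub, map_smul, α, α]
    · rw [map_sub, map_smul, hα, lift_gen, sGen, pow_zero, map_one, mul_one, α, α]
      rw [smul_neg, sub_neg_eq_add, sub_add_cancel]
  | h =>
    exact ⟨0, gen l Gen.h, by rw [lift_gen, sGen, pow_zero, map_one, mul_one, h],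
      by rw [lift_gen, sGen, pow_zero, map_one, mul_one, h]⟩

/-- The endomorphism `s_i` of the skew field. -/
noncomputable def sHom (i : ZMod (l + 1)) : K l →ₐ[ℂ] K l :=
  fracLift (lift (isRep_sGen l i)) (sGen_injective l i)

theorem sHom_gen (i : ZMod (l + 1)) (g : Gen l) :
    sHom l i (fracHom (A l) (gen l g)) = sGen l i g :=
  (fracLift_fracHom _ _ _).trans (lift_gen _ _)

theorem sHom_sHom (i : ZMod (l + 1)) : (sHom l i).comp (sHom l i) = AlgHom.id ℂ (K l) := by
  have hf : sHom l i (f l i) = f l i := by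
    rw [f, sHom_gen, sGen, u_self, zero_smul, add_zero, f]
  have hα : sHom l i (α l i) = -α l i := by
    rw [α, sHom_gen, sGen, cartan_self, two_smul, α]
    abel
  refine frac_ext (alg_ext fun g => ?_)
  change sHom l i (sHom l i (fracHom (A l) (gen l g))) = fracHom (A l) (gen l g)
  rw [sHom_gen]
  cases g with
  | f j =>
    rw [sGen, map_add, map_smul, map_div₀, hf, hα, f, sHom_gen, sGen, f, neg_div, smul_neg,
      add_neg_cancel_right]
  | α j =>
    rw [sGen, map_sub, map_smul, hα, α, sHom_gen, sGen, α, smul_neg, sub_neg_eq_add,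
      sub_add_cancel]
  | h => rw [sGen, h, sHom_gen, sGen, h]

/-- The automorphism `s_i` of the skew field: `s_i(f_j) = f_j + (α_i / f_i) u_ij`,
`s_i(α_j) = α_j - α_i a_ij`, `s_i(h) = h`. -/
noncomputable def s (i : ZMod (l + 1)) : K l ≃ₐ[ℂ] K l :=
  AlgEquiv.ofAlgHom (sHom l i) (sHom l i) (sHom_sHom l i) (sHom_sHom l i)

theorem s_f (i j : ZMod (l + 1)) : s l i (f l j) = f l j + u l i j • (α l i / f l i) :=
  sHom_gen l i (Gen.f j)

theorem s_α (i j : ZMod (l + 1)) : s l i (α l j) = α l j - cartan l i j • α l i :=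
  sHom_gen l i (Gen.α j)

theorem s_h (i : ZMod (l + 1)) : s l i (h l) = h l := sHom_gen l i Gen.h

/-- The rotation of the generators by `c`. -/
def Gen.shift (c : ZMod (l + 1)) : Gen l → Gen l
  | Gen.f i => Gen.f (i + c)
  | Gen.α i => Gen.α (i + c)
  | Gen.h => Gen.h

theorem isRep_shift (c : ZMod (l + 1)) : IsRep l fun g => gen l (Gen.shift l c g) := by
  have h0 := isRep_comp (AlgHom.id ℂ (A l))
  have hu : ∀ i j, u l (i + c) (j + c) = u l i j := by
    intro i j
    have h1 : j + c = i + c - 1 ↔ j = i - 1 := by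
      rw [add_sub_right_comm]; exact add_left_inj c
    have h2 : j + c = i + c + 1 ↔ j = i + 1 := by
      rw [add_right_comm]; exact add_left_inj c
    simp only [u, h1, h2]
  refine ⟨fun i j => ?_, fun i j => h0.fα _ _, fun i j => h0.αα _ _, fun j => h0.hf _,
    fun j => h0.hα _⟩
  rw [← hu i j]
  exact h0.ff _ _

theorem lift_shift_comp (c d : ZMod (l + 1)) (hcd : d + c = 0) :
    (lift (isRep_shift l c)).comp (lift (isRep_shift l d)) = AlgHom.id ℂ (A l) := by
  refine alg_ext fun g => ?_
  rw [AlgHom.comp_apply, lift_gen, lift_gen, AlgHom.id_apply]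
  cases g <;> simp [Gen.shift, add_assoc, hcd]

/-- The diagram rotation `π` of the skew field: `π(f_j) = f_{j+1}`, `π(α_j) = α_{j+1}`,
`π(h) = h`. -/
noncomputable def π : K l ≃ₐ[ℂ] K l :=
  fracEquiv (AlgEquiv.ofAlgHom (lift (isRep_shift l 1)) (lift (isRep_shift l (-1)))
    (lift_shift_comp l 1 (-1) (by ring)) (lift_shift_comp l (-1) 1 (by ring)))

theorem π_f (j : ZMod (l + 1)) : π l (f l j) = f l (j + 1) :=
  (fracEquiv_fracHom _ _).trans (congrArg _ (lift_gen (isRep_shift l 1) (Gen.f j)))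

theorem π_α (j : ZMod (l + 1)) : π l (α l j) = α l (j + 1) :=
  (fracEquiv_fracHom _ _).trans (congrArg _ (lift_gen (isRep_shift l 1) (Gen.α j)))

theorem π_h : π l (h l) = h l :=
  (fracEquiv_fracHom _ _).trans (congrArg _ (lift_gen (isRep_shift l 1) Gen.h))

end Action

end QPainleve

namespace QPainleve

namespace One

/-- The generators of the algebra for `l = 1`. -/
inductive Gen : Type
  | f₀ | f₁ | f₂ | α₀ | α₁ | h

instance : Finite Gen :=
  Finite.of_surjective
    (fun t : Fin 6 => match t with
      | 0 => Gen.f₀ | 1 => Gen.f₁ | 2 => Gen.f₂ | 3 => Gen.α₀ | 4 => Gen.α₁ | 5 => Gen.h)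
    (fun g => match g with
      | Gen.f₀ => ⟨0, rfl⟩ | Gen.f₁ => ⟨1, rfl⟩ | Gen.f₂ => ⟨2, rfl⟩
      | Gen.α₀ => ⟨3, rfl⟩ | Gen.α₁ => ⟨4, rfl⟩ | Gen.h => ⟨5, rfl⟩)

/-- The generators which are required to be central. -/
def Gen.IsCentral : Gen → Prop
  | Gen.α₀ | Gen.α₁ | Gen.h => True
  | Gen.f₀ | Gen.f₁ | Gen.f₂ => False

/-- The defining relations for `l = 1`: `[f_1, f_0] = 2 h f_2`, `[f_0, f_2] = [f_2, f_1] = h`, and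
`α_0, α_1, h` commute with all generators. -/
inductive Rel : FreeAlgebra ℂ Gen → FreeAlgebra ℂ Gen → Prop
  | f₁f₀ : Rel (FreeAlgebra.ι ℂ Gen.f₁ * FreeAlgebra.ι ℂ Gen.f₀ -
      FreeAlgebra.ι ℂ Gen.f₀ * FreeAlgebra.ι ℂ Gen.f₁)
      (2 * FreeAlgebra.ι ℂ Gen.h * FreeAlgebra.ι ℂ Gen.f₂)
  | f₀f₂ : Rel (FreeAlgebra.ι ℂ Gen.f₀ * FreeAlgebra.ι ℂ Gen.f₂ -
      FreeAlgebra.ι ℂ Gen.f₂ * FreeAlgebra.ι ℂ Gen.f₀) (FreeAlgebra.ι ℂ Gen.h)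
  | f₂f₁ : Rel (FreeAlgebra.ι ℂ Gen.f₂ * FreeAlgebra.ι ℂ Gen.f₁ -
      FreeAlgebra.ι ℂ Gen.f₁ * FreeAlgebra.ι ℂ Gen.f₂) (FreeAlgebra.ι ℂ Gen.h)
  | central (c g : Gen) (hc : c.IsCentral) : Rel (FreeAlgebra.ι ℂ c * FreeAlgebra.ι ℂ g -
      FreeAlgebra.ι ℂ g * FreeAlgebra.ι ℂ c) 0

/-- The associative algebra with generators `f_0, f_1, f_2, α_0, α_1, h` and the above
relations. -/
def A : Type := RingQuot Rel

noncomputable instance : Ring A := inferInstanceAs (Ring (RingQuot Rel))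

noncomputable instance : Algebra ℂ A := inferInstanceAs (Algebra ℂ (RingQuot Rel))

/-- The generators as elements of the algebra. -/
noncomputable def gen (g : Gen) : A := RingQuot.mkAlgHom ℂ Rel (FreeAlgebra.ι ℂ g)

section Lift

variable {B : Type} [Ring B] [Algebra ℂ B]

/-- A map of generators respecting the defining relations. -/
structure IsRep (F : Gen → B) : Prop where
  f₁f₀ : F Gen.f₁ * F Gen.f₀ = F Gen.f₀ * F Gen.f₁ + 2 * F Gen.h * F Gen.f₂
  f₀f₂ : F Gen.f₀ * F Gen.f₂ = F Gen.f₂ * F Gen.f₀ + F Gen.h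
  f₂f₁ : F Gen.f₂ * F Gen.f₁ = F Gen.f₁ * F Gen.f₂ + F Gen.h
  central : ∀ c g : Gen, c.IsCentral → Commute (F c) (F g)

/-- The homomorphism out of the algebra determined by the images of the generators. -/
noncomputable def lift {F : Gen → B} (hF : IsRep F) : A →ₐ[ℂ] B :=
  RingQuot.liftAlgHom ℂ ⟨FreeAlgebra.lift ℂ F, by
    intro a b hab
    cases hab with
    | f₁f₀ =>
      rw [map_sub, map_mul, map_mul, sub_eq_iff_eq_add', map_mul, map_mul, map_ofNat]
      simpa using hF.f₁f₀
    | f₀f₂ => simpa [sub_eq_iff_eq_add'] using hF.f₀f₂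
    | f₂f₁ => simpa [sub_eq_iff_eq_add'] using hF.f₂f₁
    | central c g hc => simpa [sub_eq_zero] using (hF.central c g hc).eq⟩

theorem lift_gen {F : Gen → B} (hF : IsRep F) (g : Gen) : lift hF (gen g) = F g :=
  (RingQuot.liftAlgHom_mkAlgHom_apply (S := ℂ) _ _ _).trans (FreeAlgebra.lift_ι_apply _ _)

theorem alg_ext {φ ψ : A →ₐ[ℂ] B} (h : ∀ g, φ (gen g) = ψ (gen g)) : φ = ψ :=
  RingQuot.ringQuot_ext' _ _ _ (FreeAlgebra.hom_ext (funext h))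

theorem isRep_comp (φ : A →ₐ[ℂ] B) : IsRep fun g => φ (gen g) := by
  let ψ : FreeAlgebra ℂ Gen →ₐ[ℂ] B := AlgHom.comp φ (RingQuot.mkAlgHom ℂ Rel)
  have key : ∀ a b, Rel a b → ψ a = ψ b :=
    fun a b h => congrArg φ (RingQuot.mkAlgHom_rel ℂ h)
  have hψ : ∀ g, φ (gen g) = ψ (FreeAlgebra.ι ℂ g) := fun _ => rfl
  simp only [hψ]
  refine ⟨?_, ?_, ?_, fun c g hc => ?_⟩
  · have := key _ _ Rel.f₁f₀
    rwa [map_sub, map_mul, map_mul, sub_eq_iff_eq_add', map_mul, map_mul, map_ofNat] at this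
  · have := key _ _ Rel.f₀f₂
    rwa [map_sub, map_mul, map_mul, sub_eq_iff_eq_add'] at this
  · have := key _ _ Rel.f₂f₁
    rwa [map_sub, map_mul, map_mul, sub_eq_iff_eq_add'] at this
  · have := key _ _ (Rel.central c g hc)
    rwa [map_sub, map_mul, map_mul, map_zero, sub_eq_zero] at this

end Lift

theorem isRep_gen : IsRep gen := isRep_comp (AlgHom.id ℂ A)

theorem adjoin_gen : Algebra.adjoin ℂ (Set.range gen) = ⊤ := by
  let S := Algebra.adjoin ℂ (Set.range gen)
  have hS : ∀ g, gen g ∈ S := fun g => Algebra.subset_adjoin ⟨g, rfl⟩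
  have h0 := isRep_gen
  have hr : IsRep (fun g => (⟨gen g, hS g⟩ : S)) :=
    ⟨Subtype.ext h0.f₁f₀, Subtype.ext h0.f₀f₂, Subtype.ext h0.f₂f₁,
      fun c g hc => Subtype.ext (h0.central c g hc)⟩
  have h1 : S.val.comp (lift hr) = AlgHom.id ℂ A := by
    apply alg_ext
    intro g
    rw [AlgHom.comp_apply, lift_gen]
    rfl
  rw [eq_top_iff]
  intro a _
  have := DFunLike.congr_fun h1 a
  rw [AlgHom.id_apply] at this
  rw [← this]
  exact (lift hr a).2

/-- Modified generators: `f_0` is replaced by the central element `f_0 + f_1 + f_2²`. -/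
noncomputable def xgen : Gen → A
  | Gen.f₀ => gen Gen.f₀ + gen Gen.f₁ + gen Gen.f₂ * gen Gen.f₂
  | g => gen g

theorem adjoin_xgen : Algebra.adjoin ℂ (Set.range xgen) = ⊤ := by
  have hx : ∀ g, xgen g ∈ Algebra.adjoin ℂ (Set.range xgen) :=
    fun g => Algebra.subset_adjoin ⟨g, rfl⟩
  rw [eq_top_iff, ← adjoin_gen, Algebra.adjoin_le_iff]
  rintro _ ⟨g, rfl⟩
  cases g with
  | f₀ =>
    have e : gen Gen.f₀ = xgen Gen.f₀ - xgen Gen.f₁ - xgen Gen.f₂ * xgen Gen.f₂ := by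
      simp only [xgen]; abel
    rw [e]
    exact sub_mem (sub_mem (hx _) (hx _)) (mul_mem (hx _) (hx _))
  | f₁ => exact hx Gen.f₁
  | f₂ => exact hx Gen.f₂
  | α₀ => exact hx Gen.α₀
  | α₁ => exact hx Gen.α₁
  | h => exact hx Gen.h

theorem commute_xgen {z : A} (hz : ∀ g, Commute z (gen g)) (g : Gen) : Commute z (xgen g) := by
  cases g with
  | f₀ => exact ((hz _).add_right (hz _)).add_right ((hz _).mul_right (hz _))
  | f₁ => exact hz Gen.f₁
  | f₂ => exact hz Gen.f₂
  | α₀ => exact hz Gen.α₀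
  | α₁ => exact hz Gen.α₁
  | h => exact hz Gen.h

theorem xgen_f₀_commute (g : Gen) : Commute (xgen Gen.f₀) (gen g) := by
  have h0 := isRep_gen
  have hc : ∀ c : Gen, c.IsCentral → Commute (xgen Gen.f₀) (gen c) := fun c hc =>
    (commute_xgen (fun g => h0.central c g hc) Gen.f₀).symm
  have e1 := h0.f₁f₀
  have e2 := h0.f₀f₂
  have e3 := h0.f₂f₁
  have k0 := (h0.central Gen.h Gen.f₀ trivial).eq
  have k2 := (h0.central Gen.h Gen.f₂ trivial).eq
  cases g with
  | f₀ =>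
    change (_ + _ + _ * _) * _ = _ * (_ + _ + _ * _)
    have e2' : gen Gen.f₂ * gen Gen.f₀ = gen Gen.f₀ * gen Gen.f₂ - gen Gen.h := by
      rw [e2]; abel
    have : gen Gen.f₂ * gen Gen.f₂ * gen Gen.f₀ =
        gen Gen.f₀ * (gen Gen.f₂ * gen Gen.f₂) - 2 * gen Gen.h * gen Gen.f₂ := by
      rw [mul_assoc, e2', mul_sub, ← mul_assoc, e2', sub_mul, mul_assoc, ← k2, two_mul, add_mul]
      abel
    rw [add_mul, add_mul, mul_add, mul_add, e1, this]
    abel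
  | f₁ =>
    change (_ + _ + _ * _) * _ = _ * (_ + _ + _ * _)
    have : gen Gen.f₂ * gen Gen.f₂ * gen Gen.f₁ =
        gen Gen.f₁ * (gen Gen.f₂ * gen Gen.f₂) + 2 * gen Gen.h * gen Gen.f₂ := by
      rw [mul_assoc, e3, mul_add, ← mul_assoc, e3, add_mul, mul_assoc, ← k2, two_mul, add_mul]
      abel
    rw [add_mul, add_mul, mul_add, mul_add, e1, this]
    abel
  | f₂ =>
    change (_ + _ + _ * _) * _ = _ * (_ + _ + _ * _)
    rw [add_mul, add_mul, mul_add, mul_add, e2, e3, mul_assoc]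
    abel
  | α₀ => exact hc _ trivial
  | α₁ => exact hc _ trivial
  | h => exact hc _ trivial

theorem xgen_comm (a b : Gen) :
    xgen a * xgen b - xgen b * xgen a ∈ Submodule.span ℂ (Set.range xgen) := by
  have h0 := isRep_gen
  have hz : ∀ a b : A, Commute a b → a * b - b * a ∈ Submodule.span ℂ (Set.range xgen) := by
    intro a b h
    rw [h.eq, sub_self]
    exact Submodule.zero_mem _
  have hc : ∀ c : Gen, c ≠ Gen.f₁ → c ≠ Gen.f₂ → ∀ g, Commute (xgen c) (xgen g) := by
    intro c h1 h2
    apply commute_xgen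
    cases c with
    | f₀ => exact xgen_f₀_commute
    | f₁ => exact absurd rfl h1
    | f₂ => exact absurd rfl h2
    | α₀ => exact fun g => h0.central Gen.α₀ g trivial
    | α₁ => exact fun g => h0.central Gen.α₁ g trivial
    | h => exact fun g => h0.central Gen.h g trivial
  have hh : gen Gen.h ∈ Submodule.span ℂ (Set.range xgen) :=
    Submodule.subset_span ⟨Gen.h, rfl⟩
  by_cases ha : a ≠ Gen.f₁ ∧ a ≠ Gen.f₂
  · exact hz _ _ (hc a ha.1 ha.2 b)
  by_cases hb : b ≠ Gen.f₁ ∧ b ≠ Gen.f₂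
  · exact hz _ _ (hc b hb.1 hb.2 a).symm
  have ha' : a = Gen.f₁ ∨ a = Gen.f₂ := by tauto
  have hb' : b = Gen.f₁ ∨ b = Gen.f₂ := by tauto
  rcases ha' with rfl | rfl <;> rcases hb' with rfl | rfl
  · exact hz _ _ rfl
  · change gen Gen.f₁ * gen Gen.f₂ - gen Gen.f₂ * gen Gen.f₁ ∈ _
    rw [h0.f₂f₁, sub_add_cancel_left]
    exact Submodule.neg_mem _ hh
  · change gen Gen.f₂ * gen Gen.f₁ - gen Gen.f₁ * gen Gen.f₂ ∈ _
    rw [h0.f₂f₁, add_sub_cancel_left]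
    exact hh
  · exact hz _ _ rfl

open MvPolynomial in
/-- The operator representing `f_2` on commutative polynomials. -/
noncomputable def opf₂ : Module.End ℂ (MvPolynomial Gen ℂ) :=
  LinearMap.mulLeft ℂ (X Gen.f₂) +
    (LinearMap.mulLeft ℂ (X Gen.h)).comp (pderiv Gen.f₁).toLinearMap

open MvPolynomial in
/-- The operators representing the generators on commutative polynomials. -/
noncomputable def repGen : Gen → Module.End ℂ (MvPolynomial Gen ℂ)
  | Gen.f₀ => LinearMap.mulLeft ℂ (X Gen.f₀) - LinearMap.mulLeft ℂ (X Gen.f₁) - opf₂ * opf₂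
  | Gen.f₂ => opf₂
  | g => LinearMap.mulLeft ℂ (X g)

open MvPolynomial in
theorem isRep_repGen : IsRep repGen := by
  classical
  have hX : ∀ a b : Gen, Commute (LinearMap.mulLeft ℂ (X a : MvPolynomial Gen ℂ))
      (LinearMap.mulLeft ℂ (X b)) := by
    intro a b
    refine LinearMap.ext fun p => ?_
    simp only [Module.End.mul_apply, LinearMap.mulLeft_apply]
    ring
  have hT : ∀ a : Gen, a ≠ Gen.f₁ → Commute (LinearMap.mulLeft ℂ (X a : MvPolynomial Gen ℂ))
      opf₂ := by
    intro a ha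
    refine LinearMap.ext fun p => ?_
    simp only [opf₂, Module.End.mul_apply, LinearMap.add_apply, LinearMap.comp_apply,
      LinearMap.mulLeft_apply, Derivation.coeFn_coe, Derivation.leibniz, pderiv_X, Pi.single_apply,
      smul_eq_mul, if_neg ha]
    ring
  have hT1 : opf₂ * LinearMap.mulLeft ℂ (X Gen.f₁) = LinearMap.mulLeft ℂ (X Gen.f₁) * opf₂ +
      LinearMap.mulLeft ℂ (X Gen.h) := by
    refine LinearMap.ext fun p => ?_
    simp only [opf₂, Module.End.mul_apply, LinearMap.add_apply, LinearMap.comp_apply,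
      LinearMap.mulLeft_apply, Derivation.coeFn_coe, Derivation.leibniz, pderiv_X_self,
      smul_eq_mul]
    ring
  have hh := (hT Gen.h (by simp)).eq
  refine ⟨?_, ?_, hT1, fun c g hc => ?_⟩
  · have h1 := (hX Gen.f₁ Gen.f₀).eq
    have h2 : opf₂ * opf₂ * LinearMap.mulLeft ℂ (X Gen.f₁) =
        LinearMap.mulLeft ℂ (X Gen.f₁) * (opf₂ * opf₂) +
          2 * LinearMap.mulLeft ℂ (X Gen.h) * opf₂ := by
      rw [mul_assoc, hT1, mul_add, ← mul_assoc, hT1, add_mul, mul_assoc, ← hh, two_mul, add_mul]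
      abel
    simp only [repGen]
    rw [mul_sub, mul_sub, sub_mul, sub_mul, h1, h2]
    abel
  · have h1 := (hT Gen.f₀ (by simp)).eq
    simp only [repGen]
    rw [mul_sub, mul_sub, sub_mul, sub_mul, h1, hT1, mul_assoc]
    abel
  · have key : ∀ c : Gen, c ≠ Gen.f₁ → ∀ g, Commute (LinearMap.mulLeft ℂ (X c)) (repGen g) := by
      intro c hc g
      cases g with
      | f₀ =>
        exact ((hX _ _).sub_right (hX _ _)).sub_right ((hT c hc).mul_right (hT c hc))
      | f₁ => exact hX _ _
      | f₂ => exact hT c hc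
      | α₀ => exact hX _ _
      | α₁ => exact hX _ _
      | h => exact hX _ _
    cases c with
    | f₀ => exact hc.elim
    | f₁ => exact hc.elim
    | f₂ => exact hc.elim
    | α₀ => exact key Gen.α₀ (by simp) g
    | α₁ => exact key Gen.α₁ (by simp) g
    | h => exact key Gen.h (by simp) g

open MvPolynomial in
theorem repGen_sub (g : Gen) (d : ℕ) (p : MvPolynomial Gen ℂ) (hp : p ∈ degLT Gen d) :
    lift isRep_repGen (xgen g) p - X g * p ∈ degLT Gen d := by
  have h2 : lift isRep_repGen (gen Gen.f₂) = opf₂ := lift_gen _ _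
  cases g with
  | f₀ =>
    have h0 : lift isRep_repGen (gen Gen.f₀) = LinearMap.mulLeft ℂ (X Gen.f₀) -
      LinearMap.mulLeft ℂ (X Gen.f₁) - opf₂ * opf₂ := lift_gen _ _
    have h1 : lift isRep_repGen (gen Gen.f₁) = LinearMap.mulLeft ℂ (X Gen.f₁) := lift_gen _ _
    have e : lift isRep_repGen (xgen Gen.f₀) p - X Gen.f₀ * p = 0 := by
      simp only [xgen, map_add, map_mul, h0, h1, h2]
      simp only [LinearMap.add_apply, LinearMap.sub_apply, Module.End.mul_apply,
        LinearMap.mulLeft_apply]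
      abel
    rw [e]
    exact Submodule.zero_mem _
  | f₂ =>
    have := X_mul_pderiv_mem_degLT hp Gen.h Gen.f₁
    simpa [xgen, h2, opf₂] using this
  | f₁ => simp [xgen, lift_gen, repGen]
  | α₀ => simp [xgen, lift_gen, repGen]
  | α₁ => simp [xgen, lift_gen, repGen]
  | h => simp [xgen, lift_gen, repGen]

theorem gen_h_ne_zero : gen Gen.h ≠ 0 := by
  intro h
  have h1 := congrArg (fun a => lift isRep_repGen a 1) h
  simp only [lift_gen, map_zero, LinearMap.zero_apply] at h1
  have h2 : repGen Gen.h 1 = MvPolynomial.X Gen.h := by simp [repGen]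
  rw [h2] at h1
  exact MvPolynomial.X_ne_zero Gen.h h1

theorem gen_f₀_ne_zero : gen Gen.f₀ ≠ 0 := by
  intro h
  have := isRep_gen.f₀f₂
  rw [h, zero_mul, mul_zero, zero_add] at this
  exact gen_h_ne_zero this.symm

theorem gen_f₁_ne_zero : gen Gen.f₁ ≠ 0 := by
  intro h
  have := isRep_gen.f₂f₁
  rw [h, zero_mul, mul_zero, zero_add] at this
  exact gen_h_ne_zero this.symm

instance : Nontrivial A := ⟨⟨gen Gen.h, 0, gen_h_ne_zero⟩⟩

instance : NoZeroDivisors A :=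
  noZeroDivisors_of_rep xgen (lift isRep_repGen) repGen_sub xgen_comm adjoin_xgen

open scoped nonZeroDivisors in
noncomputable instance : OreLocalization.OreSet A⁰ :=
  Classical.choice (nonempty_oreSet xgen xgen_comm adjoin_xgen)

open scoped nonZeroDivisors in
/-- The skew field of fractions of the Ore domain `A`. -/
abbrev K : Type := OreLocalization A⁰ A

/-- The generators `f_0, f_1, f_2` of the skew field. -/
noncomputable def f : Fin 3 → K
  | 0 => fracHom A (gen Gen.f₀)
  | 1 => fracHom A (gen Gen.f₁)
  | 2 => fracHom A (gen Gen.f₂)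

/-- The generators `α_0, α_1` of the skew field. -/
noncomputable def α : Fin 2 → K
  | 0 => fracHom A (gen Gen.α₀)
  | 1 => fracHom A (gen Gen.α₁)

/-- The generator `h` of the skew field. -/
noncomputable def h : K := fracHom A (gen Gen.h)

theorem isRep_K : IsRep fun g => fracHom A (gen g) := isRep_comp (fracHom A)

section Identities

variable {D : Type} [DivisionRing D] {a b c η t : D}

/-- The relations among `f_i, f_{1-i}, ± f_2, h, α_i`. -/
structure Config (a b c η t : D) : Prop where
  ne : a ≠ 0
  ac : a * c = c * a + η
  ba : b * a = a * b + 2 * η * c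
  cb : c * b = b * c + η
  ηa : Commute η a
  ηb : Commute η b
  ηc : Commute η c
  ta : Commute t a
  tb : Commute t b
  tc : Commute t c
  tη : Commute t η

theorem Config.div_mul (H : Config a b c η t) : t / a * a = t := div_mul_cancel₀ _ H.ne

theorem Config.mul_div (H : Config a b c η t) : a * (t / a) = t := by
  rw [div_eq_mul_inv, ← mul_assoc, ← H.ta.eq, mul_inv_cancel_right₀ H.ne]

theorem Config.commute_div {z : D} (hz : Commute z t) (hza : Commute z a) : Commute z (t / a) := by
  rw [div_eq_mul_inv]
  exact hz.mul_right hza.inv_right₀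

theorem Config.div_b (H : Config a b c η t) :
    t / a * b = b * (t / a) + c * c * (t / a) - t / a * c * c := by
  have h1 : Commute (b + c * c) a := by
    have e : c * a = a * c - η := by rw [H.ac]; abel
    change (b + c * c) * a = a * (b + c * c)
    have e' : c * c * a = a * (c * c) - 2 * η * c := by
      rw [mul_assoc, e, mul_sub, ← mul_assoc, e, sub_mul, ← H.ηc.eq, two_mul, add_mul, mul_assoc]
      abel
    rw [add_mul, mul_add, H.ba, e']
    abel
  have h2 := (Config.commute_div (H.tb.symm.add_left (H.tc.symm.mul_left H.tc.symm)) h1).eq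
  rw [add_mul, mul_add, ← mul_assoc] at h2
  rw [h2]
  abel

theorem Config.div_sq (H : Config a b c η t) : t ^ 2 / a ^ 2 = t / a * (t / a) := by
  have h1 : Commute a⁻¹ t := H.ta.symm.inv_left₀
  rw [div_eq_mul_inv, div_eq_mul_inv, sq, sq, mul_inv_rev, mul_assoc t a⁻¹, ← mul_assoc a⁻¹ t,
    h1.eq]
  simp only [mul_assoc]

/-- The image of `b`. -/
noncomputable def newB (a b c t : D) : D := b - c * (t / a) - t / a * c - t ^ 2 / a ^ 2

theorem Config.wca (H : Config a b c η t) : t / a * c * a = t * c - η * (t / a) := by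
  have e : c * a = a * c - η := by rw [H.ac]; abel
  rw [mul_assoc, e, mul_sub, ← mul_assoc, H.div_mul, (Config.commute_div H.tη.symm H.ηa).eq]

theorem Config.cwa (H : Config a b c η t) : c * (t / a) * a = t * c := by
  rw [mul_assoc, H.div_mul, H.tc.eq]

theorem Config.wwa (H : Config a b c η t) : t / a * (t / a) * a = t * (t / a) := by
  rw [mul_assoc, H.div_mul, (Config.commute_div (Commute.refl t) H.ta).eq]

theorem Config.rel_ba (H : Config a b c η t) :
    newB a b c t * a = a * newB a b c t + 2 * η * (c + t / a) := by
  have e4 : a * (c * (t / a)) = t * c + η * (t / a) := by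
    rw [← mul_assoc, H.ac, add_mul, mul_assoc, H.mul_div, H.tc.eq]
  have e5 : a * (t / a * c) = t * c := by rw [← mul_assoc, H.mul_div]
  have e6 : a * (t / a * (t / a)) = t * (t / a) := by rw [← mul_assoc, H.mul_div]
  simp only [newB, H.div_sq, sub_mul, mul_sub, mul_add, H.cwa, H.wca, H.wwa, e4, e5, e6, H.ba,
    two_mul, add_mul]
  abel

theorem Config.rel_ac (H : Config a b c η t) :
    a * (c + t / a) = (c + t / a) * a + η := by
  rw [mul_add, add_mul, H.mul_div, H.div_mul, H.ac]
  abel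

theorem Config.rel_cb (H : Config a b c η t) :
    (c + t / a) * newB a b c t = newB a b c t * (c + t / a) + η := by
  rw [newB, H.div_sq]
  simp only [mul_sub, sub_mul, add_mul, mul_add, H.cb, H.div_b, mul_assoc]
  abel

theorem Config.commute_newB (_ : Config a b c η t) {z : D} (za : Commute z a) (zb : Commute z b)
    (zc : Commute z c) (zt : Commute z t) : Commute z (newB a b c t) := by
  have hw := Config.commute_div zt za
  have hsq : Commute z (t ^ 2 / a ^ 2) := by
    rw [div_eq_mul_inv]
    exact (zt.pow_right 2).mul_right (za.pow_right 2).inv_right₀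
  exact ((zb.sub_right (zc.mul_right hw)).sub_right (hw.mul_right zc)).sub_right hsq

theorem Config.newB_mul (H : Config a b c η t) :
    newB a b c t * (a * a) = b * a * a - 2 * t * c * a + t * η - t * t := by
  have h1 : newB a b c t * a = b * a - t * c - (t * c - η * (t / a)) - t * (t / a) := by
    simp only [newB, H.div_sq, sub_mul, H.cwa, H.wca, H.wwa]
  rw [← mul_assoc, h1]
  simp only [sub_mul, mul_assoc, H.div_mul, H.tη.eq, two_mul, add_mul]
  abel

theorem Config.newB_mul' (H : Config a b c η t) :
    newB a b c t * a * a - 2 * (-t) * (c + t / a) * a + (-t) * η - (-t) * (-t) = b * a * a := by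
  have h2 : (c + t / a) * a = c * a + t := by rw [add_mul, H.div_mul]
  rw [mul_assoc (newB a b c t), H.newB_mul, mul_assoc (2 * -t), h2]
  noncomm_ring

theorem Config.newB_newB (H : Config a b c η t) :
    newB a (newB a b c t) (c + t / a) (-t) = b := by
  have h : (-t) ^ 2 / a ^ 2 = t / a * (t / a) := by rw [neg_sq, H.div_sq]
  rw [newB, h, newB, H.div_sq, neg_div]
  noncomm_ring

end Identities

section Action

/-- The relations seen from `f_0`. -/
theorem config₀ : Config (f 0) (f 1) (f 2) h (α 0) := by
  have H := isRep_K
  exact ⟨fracHom_ne_zero gen_f₀_ne_zero, H.f₀f₂, H.f₁f₀, H.f₂f₁, H.central _ _ trivial,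
    H.central _ _ trivial, H.central _ _ trivial, H.central _ _ trivial, H.central _ _ trivial,
    H.central _ _ trivial, H.central _ _ trivial⟩

/-- The relations seen from `f_1`. -/
theorem config₁ : Config (f 1) (f 0) (-f 2) h (α 1) := by
  have H := isRep_K
  have e1 : f 1 * f 0 = f 0 * f 1 + 2 * h * f 2 := H.f₁f₀
  have e2 : f 0 * f 2 = f 2 * f 0 + h := H.f₀f₂
  have e3 : f 2 * f 1 = f 1 * f 2 + h := H.f₂f₁
  refine ⟨fracHom_ne_zero gen_f₁_ne_zero, ?_, ?_, ?_, H.central _ _ trivial,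
    H.central _ _ trivial, (H.central Gen.h Gen.f₂ trivial).neg_right, H.central _ _ trivial,
    H.central _ _ trivial, (H.central Gen.α₁ Gen.f₂ trivial).neg_right, H.central _ _ trivial⟩
  · rw [mul_neg, neg_mul, e3]; abel
  · rw [e1, mul_neg]; abel
  · rw [neg_mul, mul_neg, e2]; abel

/-- The images of the generators under `s_0` and `s_1`. -/
noncomputable def sGen : Fin 2 → Gen → K
  | 0, Gen.f₀ => f 0
  | 0, Gen.f₁ => f 1 - f 2 * (α 0 / f 0) - α 0 / f 0 * f 2 - α 0 ^ 2 / f 0 ^ 2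
  | 0, Gen.f₂ => f 2 + α 0 / f 0
  | 0, Gen.α₀ => -α 0
  | 0, Gen.α₁ => α 1 + 2 * α 0
  | 0, Gen.h => h
  | 1, Gen.f₀ => f 0 + f 2 * (α 1 / f 1) + α 1 / f 1 * f 2 - α 1 ^ 2 / f 1 ^ 2
  | 1, Gen.f₁ => f 1
  | 1, Gen.f₂ => f 2 - α 1 / f 1
  | 1, Gen.α₀ => α 0 + 2 * α 1
  | 1, Gen.α₁ => -α 1
  | 1, Gen.h => h

theorem sGen_f₀_one : sGen 1 Gen.f₀ = newB (f 1) (f 0) (-f 2) (α 1) := by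
  simp only [sGen, newB, neg_mul, mul_neg, sub_neg_eq_add]

theorem sGen_f₂_one : sGen 1 Gen.f₂ = -(-f 2 + α 1 / f 1) := by
  simp only [sGen]; abel

theorem commute_sGen (i : Fin 2) {z : K} (hz : ∀ g, Commute z (fracHom A (gen g))) (g : Gen) :
    Commute z (sGen i g) := by
  have hf0 : Commute z (f 0) := hz Gen.f₀
  have hf1 : Commute z (f 1) := hz Gen.f₁
  have hf2 : Commute z (f 2) := hz Gen.f₂
  have hα0 : Commute z (α 0) := hz Gen.α₀
  have hα1 : Commute z (α 1) := hz Gen.α₁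
  have hh : Commute z h := hz Gen.h
  have h2 : Commute z 2 := (Commute.ofNat_right z 2)
  fin_cases i <;> cases g
  · exact hf0
  · exact config₀.commute_newB hf0 hf1 hf2 hα0
  · exact hf2.add_right (Config.commute_div hα0 hf0)
  · exact hα0.neg_right
  · exact hα1.add_right (h2.mul_right hα0)
  · exact hh
  · change Commute z (sGen 1 Gen.f₀)
    rw [sGen_f₀_one]
    exact config₁.commute_newB hf1 hf0 hf2.neg_right hα1
  · exact hf1
  · exact hf2.sub_right (Config.commute_div hα1 hf1)
  · exact hα0.add_right (h2.mul_right hα1)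
  · exact hα1.neg_right
  · exact hh

theorem sGen_central (i : Fin 2) (c : Gen) (hc : c.IsCentral) (z : K)
    (hz : ∀ d : Gen, d.IsCentral → Commute z (fracHom A (gen d))) : Commute z (sGen i c) := by
  have hα0 : Commute z (α 0) := hz Gen.α₀ trivial
  have hα1 : Commute z (α 1) := hz Gen.α₁ trivial
  have hh : Commute z h := hz Gen.h trivial
  have h2 : Commute z 2 := (Commute.ofNat_right z 2)
  fin_cases i <;> cases c
  · exact hc.elim
  · exact hc.elim
  · exact hc.elim
  · exact hα0.neg_right
  · exact hα1.add_right (h2.mul_right hα0)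
  · exact hh
  · exact hc.elim
  · exact hc.elim
  · exact hc.elim
  · exact hα0.add_right (h2.mul_right hα1)
  · exact hα1.neg_right
  · exact hh

theorem isRep_sGen (i : Fin 2) : IsRep (sGen i) := by
  have hcen : ∀ c g : Gen, c.IsCentral → Commute (sGen i c) (sGen i g) := by
    intro c g hc
    refine (sGen_central i c hc _ fun d hd => ?_).symm
    exact (commute_sGen i (fun g => isRep_K.central d g hd) g).symm
  have H0 := config₀
  have H1 := config₁
  match i with
  | 0 => exact ⟨H0.rel_ba, H0.rel_ac, H0.rel_cb, hcen⟩
  | 1 =>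
    refine ⟨?_, ?_, ?_, hcen⟩
    · have := H1.rel_ba
      rw [sGen_f₀_one, sGen_f₂_one, mul_neg]
      change f 1 * _ = newB (f 1) (f 0) (-f 2) (α 1) * f 1 + -(2 * h * _)
      rw [this]
      exact (add_neg_cancel_right _ _).symm
    · have := H1.rel_cb
      rw [sGen_f₀_one, sGen_f₂_one, mul_neg, neg_mul, this, neg_add]
      exact (neg_add_cancel_right _ _).symm
    · have := H1.rel_ac
      rw [sGen_f₂_one, mul_neg, neg_mul]
      change _ = -(f 1 * _) + h
      rw [this, neg_add]
      exact (neg_add_cancel_right _ _).symm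

theorem movable_gen₀ (g : Gen) : Movable (gen Gen.f₀) (gen g) := by
  have H := isRep_gen
  have hc : ∀ c : Gen, c.IsCentral → Movable (gen Gen.f₀) (gen c) :=
    fun c hc => Movable.of_commute (H.central c _ hc).eq
  have h2 : Movable (gen Gen.f₀) (gen Gen.f₂) := by
    refine Movable.of_comm (c := -gen Gen.h) (Movable.of_commute ?_) ?_
    · rw [neg_mul, mul_neg, (H.central Gen.h Gen.f₀ trivial).eq]
    · rw [H.f₀f₂]; abel
  cases g with
  | f₀ => exact Movable.of_commute rfl
  | f₁ =>
    exact Movable.of_comm (((Movable.of_commute (Commute.ofNat_left 2 _).eq).mul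
      (hc Gen.h trivial)).mul h2) H.f₁f₀
  | f₂ => exact h2
  | α₀ => exact hc _ trivial
  | α₁ => exact hc _ trivial
  | h => exact hc _ trivial

theorem movable_gen₁ (g : Gen) : Movable (gen Gen.f₁) (gen g) := by
  have H := isRep_gen
  have hc : ∀ c : Gen, c.IsCentral → Movable (gen Gen.f₁) (gen c) :=
    fun c hc => Movable.of_commute (H.central c _ hc).eq
  have h2 : Movable (gen Gen.f₁) (gen Gen.f₂) :=
    Movable.of_comm (hc Gen.h trivial) H.f₂f₁
  cases g with
  | f₀ =>
    refine Movable.of_comm (c := (-2) * gen Gen.h * gen Gen.f₂)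
      (((Movable.of_commute ?_).mul (hc Gen.h trivial)).mul h2) ?_
    · rw [neg_mul, mul_neg, (Commute.ofNat_left 2 (gen Gen.f₁)).eq]
    · rw [H.f₁f₀]
      noncomm_ring
  | f₁ => exact Movable.of_commute rfl
  | f₂ => exact h2
  | α₀ => exact hc _ trivial
  | α₁ => exact hc _ trivial
  | h => exact hc _ trivial

theorem sGen_injective (i : Fin 2) : Function.Injective (lift (isRep_sGen i)) := by
  match i with
  | 0 =>
    have hf : lift (isRep_sGen 0) (gen Gen.f₀) = f 0 := lift_gen _ _
    have hα : lift (isRep_sGen 0) (gen Gen.α₀) = -α 0 := lift_gen _ _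
    have hα1 : lift (isRep_sGen 0) (gen Gen.α₁) = α 1 + 2 * α 0 := lift_gen _ _
    have hη : lift (isRep_sGen 0) (gen Gen.h) = h := lift_gen _ _
    have hf2 : lift (isRep_sGen 0) (gen Gen.f₂) = f 2 + α 0 / f 0 := lift_gen _ _
    have hf1 : lift (isRep_sGen 0) (gen Gen.f₁) = newB (f 0) (f 1) (f 2) (α 0) := lift_gen _ _
    have H := config₀
    refine injective_of_involutive adjoin_gen _ gen_f₀_ne_zero hf movable_gen₀ ?_
    intro g
    cases g with
    | f₀ => exact ⟨0, gen Gen.f₀, by rw [hf, pow_zero, map_one, mul_one]; rfl,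
        by rw [hf, pow_zero, map_one, mul_one]; rfl⟩
    | f₁ =>
      refine ⟨2, gen Gen.f₁ * gen Gen.f₀ * gen Gen.f₀ - 2 * gen Gen.α₀ * gen Gen.f₂ * gen Gen.f₀ +
        gen Gen.α₀ * gen Gen.h - gen Gen.α₀ * gen Gen.α₀, ?_, ?_⟩
      · simp only [sq, map_sub, map_add, map_mul, map_ofNat, hf1]
        exact H.newB_mul
      · simp only [sq, map_sub, map_add, map_mul, map_ofNat, hf1, hf, hα, hf2, hη]
        exact H.newB_mul'.trans (mul_assoc _ _ _)
    | f₂ =>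
      refine ⟨1, gen Gen.f₂ * gen Gen.f₀ + gen Gen.α₀, ?_, ?_⟩
      · rw [hf2, pow_one, map_add, map_mul]
        change (_ + _) * f 0 = f 2 * f 0 + α 0
        rw [add_mul, H.div_mul]
      · rw [map_add, map_mul, hf2, hf, hα, add_mul, H.div_mul, pow_one]
        exact add_neg_cancel_right _ _
    | α₀ =>
      refine ⟨0, -gen Gen.α₀, ?_, ?_⟩
      · rw [hα, pow_zero, map_one, mul_one, map_neg]; rfl
      · rw [map_neg, hα, pow_zero, map_one, mul_one, neg_neg]; rfl
    | α₁ =>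
      refine ⟨0, gen Gen.α₁ + 2 * gen Gen.α₀, ?_, ?_⟩
      · rw [hα1, pow_zero, map_one, mul_one, map_add, map_mul, map_ofNat]; rfl
      · rw [map_add, map_mul, map_ofNat, hα, hα1, pow_zero, map_one, mul_one, mul_neg]
        exact add_neg_cancel_right _ _
    | h => exact ⟨0, gen Gen.h, by rw [hη, pow_zero, map_one, mul_one]; rfl,
        by rw [hη, pow_zero, map_one, mul_one]; rfl⟩
  | 1 =>
    have hf : lift (isRep_sGen 1) (gen Gen.f₁) = f 1 := lift_gen _ _
    have hα : lift (isRep_sGen 1) (gen Gen.α₁) = -α 1 := lift_gen _ _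
    have hα1 : lift (isRep_sGen 1) (gen Gen.α₀) = α 0 + 2 * α 1 := lift_gen _ _
    have hη : lift (isRep_sGen 1) (gen Gen.h) = h := lift_gen _ _
    have hf2 : lift (isRep_sGen 1) (gen Gen.f₂) = f 2 - α 1 / f 1 := lift_gen _ _
    have hf2' : -lift (isRep_sGen 1) (gen Gen.f₂) = -f 2 + α 1 / f 1 := by rw [hf2]; abel
    have hf1 : lift (isRep_sGen 1) (gen Gen.f₀) = newB (f 1) (f 0) (-f 2) (α 1) :=
      (lift_gen _ _).trans sGen_f₀_one
    have H := config₁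
    refine injective_of_involutive adjoin_gen _ gen_f₁_ne_zero hf movable_gen₁ ?_
    intro g
    cases g with
    | f₁ => exact ⟨0, gen Gen.f₁, by rw [hf, pow_zero, map_one, mul_one]; rfl,
        by rw [hf, pow_zero, map_one, mul_one]; rfl⟩
    | f₀ =>
      refine ⟨2, gen Gen.f₀ * gen Gen.f₁ * gen Gen.f₁ -
        2 * gen Gen.α₁ * (-gen Gen.f₂) * gen Gen.f₁ +
        gen Gen.α₁ * gen Gen.h - gen Gen.α₁ * gen Gen.α₁, ?_, ?_⟩
      · simp only [sq, map_sub, map_add, map_mul, map_ofNat, map_neg, hf1]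
        exact H.newB_mul
      · simp only [sq, map_sub, map_add, map_mul, map_ofNat, map_neg, hf1, hf, hα, hf2', hη]
        exact H.newB_mul'.trans (mul_assoc _ _ _)
    | f₂ =>
      refine ⟨1, gen Gen.f₂ * gen Gen.f₁ - gen Gen.α₁, ?_, ?_⟩
      · rw [hf2, pow_one, map_sub, map_mul]
        change (_ - _) * f 1 = f 2 * f 1 - α 1
        rw [sub_mul, H.div_mul]
      · rw [map_sub, map_mul, hf2, hf, hα, sub_mul, H.div_mul, pow_one, sub_neg_eq_add]
        exact sub_add_cancel _ _
    | α₁ =>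
      refine ⟨0, -gen Gen.α₁, ?_, ?_⟩
      · rw [hα, pow_zero, map_one, mul_one, map_neg]; rfl
      · rw [map_neg, hα, pow_zero, map_one, mul_one, neg_neg]; rfl
    | α₀ =>
      refine ⟨0, gen Gen.α₀ + 2 * gen Gen.α₁, ?_, ?_⟩
      · rw [hα1, pow_zero, map_one, mul_one, map_add, map_mul, map_ofNat]; rfl
      · rw [map_add, map_mul, map_ofNat, hα, hα1, pow_zero, map_one, mul_one, mul_neg]
        exact add_neg_cancel_right _ _
    | h => exact ⟨0, gen Gen.h, by rw [hη, pow_zero, map_one, mul_one]; rfl,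
        by rw [hη, pow_zero, map_one, mul_one]; rfl⟩

/-- The endomorphism `s_i` of the skew field. -/
noncomputable def sHom (i : Fin 2) : K →ₐ[ℂ] K := fracLift (lift (isRep_sGen i)) (sGen_injective i)

theorem sHom_gen (i : Fin 2) (g : Gen) : sHom i (fracHom A (gen g)) = sGen i g :=
  (fracLift_fracHom _ _ _).trans (lift_gen _ _)

theorem sHom_sHom (i : Fin 2) : (sHom i).comp (sHom i) = AlgHom.id ℂ K := by
  refine frac_ext (alg_ext fun g => ?_)
  change sHom i (sHom i (fracHom A (gen g))) = fracHom A (gen g)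
  rw [sHom_gen]
  match i with
  | 0 =>
    have hf : sHom 0 (f 0) = f 0 := sHom_gen _ Gen.f₀
    have hα : sHom 0 (α 0) = -α 0 := sHom_gen _ Gen.α₀
    have hα1 : sHom 0 (α 1) = α 1 + 2 * α 0 := sHom_gen _ Gen.α₁
    have hη : sHom 0 h = h := sHom_gen _ Gen.h
    have hf2 : sHom 0 (f 2) = f 2 + α 0 / f 0 := sHom_gen _ Gen.f₂
    have hf1 : sHom 0 (f 1) = newB (f 0) (f 1) (f 2) (α 0) := sHom_gen _ Gen.f₁
    cases g with
    | f₀ => exact hf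
    | f₁ =>
      change sHom 0 (newB (f 0) (f 1) (f 2) (α 0)) = f 1
      rw [newB]
      simp only [map_sub, map_mul, map_div₀, map_pow, hf, hf1, hf2, hα]
      exact config₀.newB_newB
    | f₂ =>
      change sHom 0 (f 2 + α 0 / f 0) = f 2
      rw [map_add, map_div₀, hf2, hf, hα, neg_div, add_neg_cancel_right]
    | α₀ =>
      change sHom 0 (-α 0) = α 0
      rw [map_neg, hα, neg_neg]
    | α₁ =>
      change sHom 0 (α 1 + 2 * α 0) = α 1
      rw [map_add, map_mul, map_ofNat, hα, hα1, mul_neg, add_neg_cancel_right]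
    | h => exact hη
  | 1 =>
    have hf : sHom 1 (f 1) = f 1 := sHom_gen _ Gen.f₁
    have hα : sHom 1 (α 1) = -α 1 := sHom_gen _ Gen.α₁
    have hα1 : sHom 1 (α 0) = α 0 + 2 * α 1 := sHom_gen _ Gen.α₀
    have hη : sHom 1 h = h := sHom_gen _ Gen.h
    have hf2 : sHom 1 (f 2) = f 2 - α 1 / f 1 := sHom_gen _ Gen.f₂
    have hf2' : -sHom 1 (f 2) = -f 2 + α 1 / f 1 := by rw [hf2]; abel
    have hf1 : sHom 1 (f 0) = newB (f 1) (f 0) (-f 2) (α 1) :=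
      (sHom_gen _ Gen.f₀).trans sGen_f₀_one
    cases g with
    | f₁ => exact hf
    | f₀ =>
      rw [sGen_f₀_one, newB]
      simp only [map_sub, map_mul, map_div₀, map_pow, map_neg, hf, hf1, hf2', hα]
      exact config₁.newB_newB
    | f₂ =>
      change sHom 1 (f 2 - α 1 / f 1) = f 2
      rw [map_sub, map_div₀, hf2, hf, hα, neg_div, sub_neg_eq_add, sub_add_cancel]
    | α₁ =>
      change sHom 1 (-α 1) = α 1
      rw [map_neg, hα, neg_neg]
    | α₀ =>
      change sHom 1 (α 0 + 2 * α 1) = α 0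
      rw [map_add, map_mul, map_ofNat, hα, hα1, mul_neg, add_neg_cancel_right]
    | h => exact hη

/-- The automorphisms `s_0, s_1` of the skew field, given on generators by `sGen`. -/
noncomputable def s (i : Fin 2) : K ≃ₐ[ℂ] K :=
  AlgEquiv.ofAlgHom (sHom i) (sHom i) (sHom_sHom i) (sHom_sHom i)

theorem s_gen (i : Fin 2) (g : Gen) : s i (fracHom A (gen g)) = sGen i g := sHom_gen i g

/-- The images of the generators under the diagram rotation. -/
noncomputable def rotGen : Gen → A
  | Gen.f₀ => gen Gen.f₁
  | Gen.f₁ => gen Gen.f₀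
  | Gen.f₂ => -gen Gen.f₂
  | Gen.α₀ => gen Gen.α₁
  | Gen.α₁ => gen Gen.α₀
  | Gen.h => gen Gen.h

theorem isRep_rotGen : IsRep rotGen := by
  have H := isRep_gen
  refine ⟨?_, ?_, ?_, fun c g hc => ?_⟩
  · change gen Gen.f₀ * gen Gen.f₁ = gen Gen.f₁ * gen Gen.f₀ + 2 * gen Gen.h * -gen Gen.f₂
    rw [H.f₁f₀, mul_neg, add_neg_cancel_right]
  · change gen Gen.f₁ * -gen Gen.f₂ = -gen Gen.f₂ * gen Gen.f₁ + gen Gen.h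
    rw [neg_mul, H.f₂f₁, mul_neg, neg_add, neg_add_cancel_right]
  · change -gen Gen.f₂ * gen Gen.f₀ = gen Gen.f₀ * -gen Gen.f₂ + gen Gen.h
    rw [mul_neg, H.f₀f₂, neg_mul, neg_add, neg_add_cancel_right]
  · have key : ∀ d : Gen, d.IsCentral → Commute (gen d) (rotGen g) := by
      intro d hd
      cases g with
      | f₂ => exact (H.central d Gen.f₂ hd).neg_right
      | f₀ => exact H.central d Gen.f₁ hd
      | f₁ => exact H.central d Gen.f₀ hd
      | α₀ => exact H.central d Gen.α₁ hd
      | α₁ => exact H.central d Gen.α₀ hd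
      | h => exact H.central d Gen.h hd
    cases c with
    | f₀ => exact hc.elim
    | f₁ => exact hc.elim
    | f₂ => exact hc.elim
    | α₀ => exact key Gen.α₁ trivial
    | α₁ => exact key Gen.α₀ trivial
    | h => exact key Gen.h trivial

theorem rot_rot : (lift isRep_rotGen).comp (lift isRep_rotGen) = AlgHom.id ℂ A := by
  refine alg_ext fun g => ?_
  rw [AlgHom.comp_apply, lift_gen, AlgHom.id_apply]
  cases g with
  | f₂ => exact (map_neg _ _).trans ((congrArg Neg.neg (lift_gen _ Gen.f₂)).trans (neg_neg _))
  | f₀ => exact lift_gen _ Gen.f₁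
  | f₁ => exact lift_gen _ Gen.f₀
  | α₀ => exact lift_gen _ Gen.α₁
  | α₁ => exact lift_gen _ Gen.α₀
  | h => exact lift_gen _ Gen.h

/-- The diagram rotation `π` of the skew field: it exchanges `f_0` and `f_1`, exchanges `α_0` and
`α_1`, fixes `h`, and sends `f_2` to `-f_2`. -/
noncomputable def π : K ≃ₐ[ℂ] K :=
  fracEquiv (AlgEquiv.ofAlgHom (lift isRep_rotGen) (lift isRep_rotGen) rot_rot rot_rot)

theorem π_gen (g : Gen) : π (fracHom A (gen g)) = fracHom A (rotGen g) :=
  (fracEquiv_fracHom _ _).trans (congrArg _ (lift_gen isRep_rotGen g))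

end Action

end One

end QPainleve

namespace QPainleve

section Hamiltonian

variable (l : ℕ)

/-- `k = α_0 + ⋯ + α_l`. -/
noncomputable def k : K l := ∑ i : ZMod (l + 1), α l i

/-- The fundamental weights `ϖ_i = ∑_{r=1}^l (min{i,r} - ir/(l+1)) α_r` for `i = 1, …, l`, and
`ϖ_0 = 0`. -/
noncomputable def ϖ (i : ZMod (l + 1)) : K l :=
  ∑ r ∈ Finset.Icc 1 l, ((min i.val r : ℕ) - (i.val * r : ℂ) / (l + 1)) • α l (r : ZMod (l + 1))

/-- The initial elements `i` of the connected components `{i, i+1, …, i+m-1}` of a proper subset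
of `ℤ/(l+1)ℤ`. -/
def starts (C : Finset (ZMod (l + 1))) : Finset (ZMod (l + 1)) := C.filter fun i => i - 1 ∉ C

/-- The length `m` of the connected component `{i, i+1, …, i+m-1}` with initial element `i`. -/
noncomputable def runLength (C : Finset (ZMod (l + 1))) (i : ZMod (l + 1)) : ℕ :=
  sInf {m : ℕ | i + (m : ZMod (l + 1)) ∉ C}

/-- `χ({i, …, i+m-1}) = ϖ_i - ϖ_{i+1} + ⋯ + (-1)^{m-1} ϖ_{i+m-1}`. -/
noncomputable def χRun (i : ZMod (l + 1)) (m : ℕ) : K l :=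
  ∑ r ∈ Finset.range m, (-1) ^ r * ϖ l (i + (r : ZMod (l + 1)))

/-- `χ(C)` for a proper subset `C`: the sum over its connected components. -/
noncomputable def χ (C : Finset (ZMod (l + 1))) : K l :=
  ∑ i ∈ starts l C, χRun l i (runLength l C i)

/-- `S_d`: the subsets `J` with `d` elements such that each connected component of the complement
of `J` has even length. -/
noncomputable def S (d : ℕ) : Finset (Finset (ZMod (l + 1))) :=
  Finset.univ.filter fun J => J.card = d ∧ ∀ i ∈ starts l Jᶜ, Even (runLength l Jᶜ i)

/-- The ordered product `f_i f_{i+1} ⋯ f_{i+m-1}`. -/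
noncomputable def fRun (i : ZMod (l + 1)) (m : ℕ) : K l :=
  ((List.range m).map fun r : ℕ => f l (i + (r : ZMod (l + 1)))).prod

/-- `f_J` for a proper subset `J`: the product of `fRun` over the connected components of `J`
(the factors belonging to distinct components commute, so their order is immaterial). -/
noncomputable def fProd (J : Finset (ZMod (l + 1))) : K l :=
  ((List.range (l + 1)).map fun i : ℕ =>
    if (i : ZMod (l + 1)) ∈ starts l J then fRun l i (runLength l J i) else 1).prod

/-- The constant term `(∑_{i=1}^l (-1)^{i-1} ϖ_i)²`. -/
noncomputable def constTerm : K l :=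
  (∑ i ∈ Finset.Icc 1 l, (-1) ^ (i - 1) * ϖ l (i : ZMod (l + 1))) ^ 2

/-- The Hamiltonian `H_0` for `l ≥ 2`. -/
noncomputable def H₀ : K l :=
  if l = 2 then
    f l 0 * f l 1 * f l 2 + h l * f l 1 + ∑ J ∈ S l 1, χ l Jᶜ * fProd l J
  else if Even l then
    ∑ J ∈ S l 3, fProd l J + ∑ J ∈ S l 1, χ l Jᶜ * fProd l J
  else if l = 3 then
    f l 0 * f l 1 * f l 2 * f l 3 + h l * f l 1 * f l 2 + ∑ J ∈ S l 2, χ l Jᶜ * fProd l J +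
      constTerm l
  else
    ∑ J ∈ S l 4, fProd l J + ∑ J ∈ S l 2, χ l Jᶜ * fProd l J + constTerm l

/-- The rotated Hamiltonians: `H_j = π(H_{j-1})`. -/
noncomputable def H : ℕ → K l
  | 0 => H₀ l
  | j + 1 => π l (H j)

/-- `x_0 = f_0 + f_2 + ⋯` and `x_1 = f_1 + f_3 + ⋯` for odd `l`, indexed by `ℤ/2ℤ`. -/
noncomputable def x (e : ZMod 2) : K l :=
  ∑ r ∈ Finset.range ((l + 1) / 2), f l ((e.val + 2 * r : ℕ) : ZMod (l + 1))

/-- The group of automorphisms generated by the `s_i` with `i ≠ j`. -/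
noncomputable def weyl (j : ZMod (l + 1)) : Subgroup (K l ≃ₐ[ℂ] K l) :=
  Subgroup.closure (s l '' {i | i ≠ j})

end Hamiltonian

namespace One

/-- `k = α_0 + α_1`. -/
noncomputable def k : K := α 0 + α 1

/-- The Hamiltonian `H_0 = (f_0 f_1 + f_1 f_0) / 2 + α_1 f_2` for `l = 1`. -/
noncomputable def H₀ : K := (1 / 2 : ℂ) • (f 0 * f 1 + f 1 * f 0) + α 1 * f 2

/-- The rotated Hamiltonians: `H_j = π(H_{j-1})`. -/
noncomputable def H : ℕ → K
  | 0 => H₀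
  | j + 1 => π (H j)

/-- The group of automorphisms generated by the `s_i` with `i ≠ j`. -/
noncomputable def weyl (j : Fin 2) : Subgroup (K ≃ₐ[ℂ] K) :=
  Subgroup.closure (s '' {i | i ≠ j})

end One

end QPainleve

/-! For `l ≥ 2` the Hamiltonian is a coefficient of a noncommutative cyclic continuant. Grade by an
indeterminate `X`, place the letters `f_i X` around the cycle ℤ/(l+1), and give each deletable
adjacent pair `{i-1, i}` the central weight `1 + (ϖ_{i-1} - ϖ_i) X²`. Expand by deleting disjoint
adjacent pairs and multiplying the surviving letters. Cutting the cycle open imposes an order on the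
letters; adding `h X²` to the weight of the pair that straddles the cut makes the result independent
of the cut (`IsCyclic.wheel_succ`). The outcome is `polyWheel`.

A set of letters survives exactly when all gaps of its complement are even. In a given degree,
taking `1` from every pair gives the products `f_K`; taking one weight difference sums the
differences over the pairs in the gaps, which is the alternating sum `χ(Γ \ K)`. Hence `H₀` is the
coefficient of `X³` for even `l` (`H₀_even`). For odd `l` it is the coefficient of `X⁴` plus half
the sum of the squares of all `ϖ_{i-1} - ϖ_i` (`H₀_odd`): the empty set contributes second
elementary symmetric functions over the two perfect matchings of the cycle, and the squares complete
these to the constant term of `H₀`.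

The reflection `s_i` changes only the two letters next to `f_i` and the two weights of the pairs
containing `i`. Cutting in front of `i - 1` and expanding three letters deep, everything cancels
except a multiple of the defect `α_i - (wt_{i+1} - wt_i)`, where `wt_i = ϖ_{i-1} - ϖ_i`
(`IsCyclic.map_wheel`). By `wt_sub` this defect is `k` for `i = 0` and zero otherwise. So `H₀` is
fixed by `s_i` with `i ≠ 0`, and under `s_0` it gains `k α_0 / f_0` times a low coefficient of the
continuant of the remaining letters `f_2, …, f_{l-1}`. That coefficient is `1` for even `l`. For odd
`l` it is `f_2 + f_4 + ⋯ + f_{l-1}`, and the missing summand `f_0` of `x_0` comes from the change of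
the sum of squares (`s_sum_wt_sq`).

The relation `s_i π = π s_{i-1}` (`s_π`) carries the formula from `H₀` to every `H_j`. The case `l =
1` is a direct computation resting on the anticommutator `Config.anticomm_newB`. -/

namespace QPainleve

/-! ### Noncommutative continuants, cyclic continuants and reflections -/

section Continuant

variable {R : Type*} [Ring R]

/-- The continuant of `F b, …, F (b + n - 2)`, where deleting the adjacent pair `i - 1, i`
contributes the weight `Z i`; by convention it is `0` for `n = 0` and `1` for `n = 1`. -/
def cont (F Z : ℕ → R) : ℕ → ℕ → R
  | _, 0 => 0
  | _, 1 => 1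
  | b, n + 2 => F b * cont F Z (b + 1) (n + 1) + Z (b + 1) * cont F Z (b + 2) n

variable {F Z : ℕ → R}

@[simp] theorem cont_zero (b : ℕ) : cont F Z b 0 = 0 := by simp [cont]

@[simp] theorem cont_one (b : ℕ) : cont F Z b 1 = 1 := by simp [cont]

theorem cont_add_two (b n : ℕ) :
    cont F Z b (n + 2) = F b * cont F Z (b + 1) (n + 1) + Z (b + 1) * cont F Z (b + 2) n := by
  rw [cont]

/-- Expansion at the last letter instead of the first. Deleting pairs is symmetric under reversal,
and central weights let both expansions commute with each other, so no relation among the letters is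
needed. -/
theorem cont_add_two' (hZ : ∀ i x, Commute (Z i) x) (b n : ℕ) :
    cont F Z b (n + 2) = cont F Z b (n + 1) * F (b + n) + Z (b + n) * cont F Z b n := by
  induction n using Nat.twoStepInduction generalizing b with
  | zero => simp [cont_add_two]
  | one => simp [cont_add_two]
  | more n ih1 ih2 =>
    rw [cont_add_two b (n + 2), show n + 2 + 1 = n + 1 + 2 by ring, ih2 (b + 1), ih1 (b + 2),
      cont_add_two b (n + 1), cont_add_two b n,
      show b + 1 + (n + 1) = b + (n + 2) by ring, show b + 2 + n = b + (n + 2) by ring]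
    simp only [mul_add, add_mul, ← mul_assoc, (hZ (b + (n + 2)) (F b)).eq,
      (hZ (b + (n + 2)) (Z (b + 1))).eq]
    abel

theorem commute_cont (hZ : ∀ i x, Commute (Z i) x) {y : R} (b n : ℕ)
    (hy : ∀ i, b ≤ i → i + 1 < b + n → Commute y (F i)) : Commute y (cont F Z b n) := by
  induction n using Nat.twoStepInduction generalizing b with
  | zero => simp
  | one => simp
  | more n ih1 ih2 =>
    rw [cont_add_two]
    exact ((hy b le_rfl (by omega)).mul_right
      (ih2 (b + 1) fun i h1 h2 => hy i (by omega) (by omega))).add_right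
      ((hZ _ _).symm.mul_right (ih1 (b + 2) fun i h1 h2 => hy i (by omega) (by omega)))

/-- Sequences with the commutation relations of the generators `f_i`, read periodically. -/
structure IsCyclic (F Z : ℕ → R) (η : R) (l : ℕ) : Prop where
  Z_comm : ∀ i x, Commute (Z i) x
  η_comm : ∀ x, Commute η x
  F_period : ∀ i, F (i + (l + 1)) = F i
  Z_period : ∀ i, Z (i + (l + 1)) = Z i
  adj : ∀ i, F i * F (i + 1) = F (i + 1) * F i + η
  comm : ∀ i j, i + 2 ≤ j → j + 1 ≤ i + l → Commute (F i) (F j)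

variable {η : R} {l : ℕ}

/-- Among the letters `F b, …, F (b + n - 1)` only the last is adjacent to `F (b + n)`. The bound on
`n` keeps `b + n` from also being adjacent to `b` around the cycle. -/
theorem IsCyclic.cont_mul (H : IsCyclic F Z η l) (b n : ℕ) (hn : n + 1 ≤ l) :
    cont F Z b (n + 1) * F (b + n) = F (b + n) * cont F Z b (n + 1) + η * cont F Z b n := by
  cases n with
  | zero => simp
  | succ n =>
    have h1 : Commute (F (b + (n + 1))) (cont F Z b (n + 1)) :=
      commute_cont H.Z_comm _ _ fun i h1 h2 => (H.comm i _ (by omega) (by omega)).symm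
    have h2 : Commute (F (b + (n + 1))) (cont F Z b n) :=
      commute_cont H.Z_comm _ _ fun i h1 h2 => (H.comm i _ (by omega) (by omega)).symm
    have h3 := H.adj (b + n)
    rw [cont_add_two' H.Z_comm, add_mul, mul_add, mul_assoc, add_assoc] at *
    rw [h3, mul_add, ← mul_assoc, ← h1.eq, (H.η_comm (cont F Z b (n + 1))).eq,
      mul_assoc (Z _), ← h2.eq, ← mul_assoc (Z _), (H.Z_comm _ (F _)).eq]
    simp only [mul_assoc]
    abel

/-- The continuant runs over all letters of the cycle except `F b`, so both neighbours of `b` occur,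
at the two ends. They contribute commutators `η` of opposite sign. -/
theorem IsCyclic.cont_mul_F (H : IsCyclic F Z η l) (hl : 2 ≤ l) (b : ℕ) :
    cont F Z (b + 1) (l + 1) * F b =
      F b * cont F Z (b + 1) (l + 1) + η * cont F Z (b + 1) l - η * cont F Z (b + 2) l := by
  obtain ⟨m, rfl⟩ := Nat.exists_eq_add_of_le' hl
  have h1 := H.cont_mul (b + 2) (m + 1) (by omega)
  have h2 := H.cont_mul (b + 3) m (by omega)
  have hF : F (b + (m + 3)) = F b := H.F_period b
  rw [show b + 2 + (m + 1) = b + (m + 3) by ring, hF] at h1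
  rw [show b + 3 + m = b + (m + 3) by ring, hF] at h2
  have h3 : F (b + 1) * F b = F b * F (b + 1) - η := by rw [H.adj]; abel
  rw [cont_add_two (b + 1) (m + 1), cont_add_two (b + 1) m, add_mul, mul_assoc,
    show b + 1 + 1 = b + 2 by ring, show b + 1 + 2 = b + 3 by ring, h1, mul_assoc, h2]
  simp only [mul_add, ← mul_assoc, h3, sub_mul, (H.η_comm (F (b + 1))).eq,
    (H.Z_comm _ (F b)).eq, (H.η_comm (Z (b + 2))).eq]
  abel

/-- The cyclic continuant, computed by cutting the cycle in front of `b`. -/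
def wheel (F Z : ℕ → R) (η : R) (l b : ℕ) : R :=
  cont F Z b (l + 2) + (Z b + η) * cont F Z (b + 1) l

/-- Moving the cut one step carries `F b` from the front to the back. The commutator terms of
`IsCyclic.cont_mul_F` exchange the summand `η` attached to the old cut pair for the one attached to
the new cut pair; this is why `wheel` adds `η` to the weight there. -/
theorem IsCyclic.wheel_succ (H : IsCyclic F Z η l) (hl : 2 ≤ l) (b : ℕ) :
    wheel F Z η l (b + 1) = wheel F Z η l b := by
  rw [wheel, wheel, cont_add_two b, cont_add_two' H.Z_comm (b + 1),
    show b + 1 + l = b + (l + 1) by ring, H.F_period, H.Z_period, H.cont_mul_F hl]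
  simp only [add_mul]
  abel

theorem IsCyclic.wheel_eq (H : IsCyclic F Z η l) (hl : 2 ≤ l) (b : ℕ) :
    wheel F Z η l b = wheel F Z η l 0 := by
  induction b with
  | zero => rfl
  | succ b ih => rw [H.wheel_succ hl, ih]

theorem map_cont_of_fixed (σ : R →+* R) (b n : ℕ)
    (hF : ∀ i, b ≤ i → i + 1 < b + n → σ (F i) = F i)
    (hZ : ∀ i, b < i → i + 1 < b + n → σ (Z i) = Z i) :
    σ (cont F Z b n) = cont F Z b n := by
  induction n using Nat.twoStepInduction generalizing b with
  | zero => simp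
  | one => simp
  | more n ih1 ih2 =>
    rw [cont_add_two, map_add, map_mul, map_mul, hF b le_rfl (by omega),
      ih2 (b + 1) (fun i h1 h2 => hF i (by omega) (by omega))
        (fun i h1 h2 => hZ i (by omega) (by omega)),
      ih1 (b + 2) (fun i h1 h2 => hF i (by omega) (by omega))
        (fun i h1 h2 => hZ i (by omega) (by omega))]
    rcases n with _ | n
    · simp
    · rw [hZ (b + 1) (by omega) (by omega)]

/-- The effect of a reflection at `b + 1` on the cyclic continuant. -/
theorem IsCyclic.map_wheel (H : IsCyclic F Z η l) (hl : 2 ≤ l) (b : ℕ) (σ : R →+* R) {G κ : R}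
    (hη : σ η = η) (hF0 : σ (F b) = F b - G) (hF1 : σ (F (b + 1)) = F (b + 1))
    (hF2 : σ (F (b + 2)) = F (b + 2) + G)
    (hF : ∀ i, b + 3 ≤ i → i ≤ b + l → σ (F i) = F i)
    (hZ1 : σ (Z (b + 1)) = Z (b + 1) + G * F (b + 1))
    (hZ2 : σ (Z (b + 2)) = Z (b + 2) - G * F (b + 1))
    (hZ : ∀ i, b + 3 ≤ i → i ≤ b + l + 1 → σ (Z i) = Z i)
    (hG : F (b + 1) * G = G * F (b + 1)) (hκ : G * F (b + 1) = Z (b + 2) - Z (b + 1) + κ) :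
    σ (wheel F Z η l b) = wheel F Z η l b + κ * G * cont F Z (b + 3) (l - 1) := by
  obtain ⟨m, rfl⟩ := Nat.exists_eq_add_of_le' hl
  -- The pair in front of `b` is, by periodicity, the one ending at `b + l + 1`, which avoids `b +
  -- 1`.
  have hZ0 : σ (Z b) = Z b := by
    rw [← H.Z_period b]
    exact hZ _ (by omega) (by omega)
  -- Starting at `b + 2`, only the first letter is affected: the weight `Z (b + 2)` belongs to a
  -- pair that begins before the window.
  have hU : ∀ n, n ≤ m + 1 → σ (cont F Z (b + 2) (n + 1)) =
      cont F Z (b + 2) (n + 1) + G * cont F Z (b + 3) n := by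
    intro n hn
    rcases n with _ | n
    · simp
    · rw [cont_add_two, map_add, map_mul, map_mul, hF2,
        map_cont_of_fixed σ _ _ (fun i h1 h2 => hF i (by omega) (by omega))
          (fun i h1 h2 => hZ i (by omega) (by omega)),
        map_cont_of_fixed σ _ _ (fun i h1 h2 => hF i (by omega) (by omega))
          (fun i h1 h2 => hZ i (by omega) (by omega)), hZ (b + 2 + 1) (by omega) (by omega)]
      simp only [add_mul]
      abel
  -- Starting at `b + 1` nothing changes in total: the shift of the letter `b + 2` and the shift of
  -- the weight of the pair `{b + 1, b + 2}` cancel because `G` commutes with `F (b + 1)`.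
  have hV : ∀ n, n ≤ m + 1 → σ (cont F Z (b + 1) (n + 2)) = cont F Z (b + 1) (n + 2) := by
    intro n hn
    rw [cont_add_two, map_add, map_mul, map_mul, hF1, hU n hn, hZ2,
      map_cont_of_fixed σ _ _ (fun i h1 h2 => hF i (by omega) (by omega))
        (fun i h1 h2 => hZ i (by omega) (by omega)), mul_add, ← mul_assoc _ G, hG]
    simp only [sub_mul]
    abel
  have e1 := hV m (by omega)
  have e2 := hV (m + 1) le_rfl
  have e3 := hU (m + 1) le_rfl
  -- Expand the loss `-G` in `F b` one letter further, and rewrite the second-order term `G * F (b +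
  -- 1) * G` by `hκ`. All contributions then cancel except the one containing `κ`.
  have e4 : G * cont F Z (b + 1) (m + 3) = G * F (b + 1) * cont F Z (b + 2) (m + 2) +
      Z (b + 2) * G * cont F Z (b + 3) (m + 1) := by
    rw [cont_add_two, mul_add, ← mul_assoc, ← mul_assoc, (H.Z_comm _ G).eq]
  have e5 : G * F (b + 1) * (G * cont F Z (b + 3) (m + 1)) =
      Z (b + 2) * G * cont F Z (b + 3) (m + 1) - Z (b + 1) * G * cont F Z (b + 3) (m + 1) +
        κ * G * cont F Z (b + 3) (m + 1) := by
    rw [hκ, ← mul_assoc, add_mul, sub_mul, add_mul, sub_mul]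
  rw [wheel, cont_add_two b, map_add, map_mul (f := σ) (_ + _), map_add, map_add, map_mul, map_mul,
    hF0, hZ1, hZ0, hη, e1, e2, e3, sub_mul, e4, add_mul (Z (b + 1)), mul_add (G * F (b + 1)), e5]
  simp only [mul_add, ← mul_assoc, show m + 2 - 1 = m + 1 from rfl]
  abel

end Continuant

/-! ### Subsets of an interval whose complement splits into adjacent pairs -/

section Admissible

open Finset

/-- The subsets `J` of `{0, …, m - 1}` with `d` elements such that the `r`-th smallest element
(counting from `0`) is congruent to `r + ε` modulo `2`, and likewise for the end point `m`. -/
def adm (ε m d : ℕ) : Finset (Finset ℕ) :=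
  (powersetCard d (range m)).filter fun J =>
    Even (m + d + ε) ∧ ∀ i ∈ J, Even (i + #{j ∈ J | j < i} + ε)

theorem mem_adm {ε m d : ℕ} {J : Finset ℕ} : J ∈ adm ε m d ↔
    ((∀ i ∈ J, i < m) ∧ #J = d) ∧ Even (m + d + ε) ∧ ∀ i ∈ J, Even (i + #{j ∈ J | j < i} + ε) := by
  simp [adm, mem_powersetCard, subset_iff]

theorem filter_lt_of_lt {m : ℕ} {J : Finset ℕ} (h : ∀ i ∈ J, i < m) : J.filter (· < m) = J :=
  filter_true_of_mem h

theorem filter_insert_lt {m i : ℕ} {J : Finset ℕ} (h : i ≤ m) :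
    (insert m J).filter (· < i) = J.filter (· < i) := by
  rw [filter_insert, if_neg (by omega)]

theorem notMem_of_lt {m n : ℕ} {J : Finset ℕ} (h : ∀ i ∈ J, i < m) (hn : m ≤ n) : n ∉ J :=
  fun hm => absurd (h n hm) (by omega)

theorem insert_mem_adm {ε m d : ℕ} {J : Finset ℕ} (h : J ∈ adm ε (m + 1) d) :
    insert (m + 1) J ∈ adm ε (m + 2) (d + 1) := by
  rw [mem_adm] at h ⊢
  obtain ⟨⟨h1, h2⟩, h3, h4⟩ := h
  have hm := notMem_of_lt h1 le_rfl
  refine ⟨⟨?_, by rw [card_insert_of_notMem hm, h2]⟩, by grind, ?_⟩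
  · intro i hi
    rcases mem_insert.1 hi with rfl | hi
    · omega
    · have := h1 i hi; omega
  · intro i hi
    rcases mem_insert.1 hi with rfl | hi
    · rw [filter_insert_lt le_rfl, filter_lt_of_lt h1, h2]
      exact h3
    · rw [filter_insert_lt (h1 i hi).le]
      exact h4 i hi

/-- The dichotomy behind the last-letter expansion of a continuant: either `m + 1` is kept, or `m`
and `m + 1` are deleted together. -/
theorem adm_succ (ε m d : ℕ) : adm ε (m + 2) (d + 1) =
    (adm ε (m + 1) d).image (insert (m + 1)) ∪ adm ε m (d + 1) := by
  ext J
  rw [mem_union, mem_image]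
  constructor
  · intro h
    obtain ⟨⟨h1, h2⟩, h3, h4⟩ := mem_adm.1 h
    by_cases hm : m + 1 ∈ J
    · left
      have h5 : ∀ i ∈ J.erase (m + 1), i < m + 1 := by
        intro i hi
        have := h1 i (mem_of_mem_erase hi)
        have := ne_of_mem_erase hi
        omega
      refine ⟨J.erase (m + 1), ?_, insert_erase hm⟩
      rw [mem_adm]
      refine ⟨⟨h5, by rw [card_erase_of_mem hm, h2]; rfl⟩, by grind, ?_⟩
      intro i hi
      have h6 := h4 i (mem_of_mem_erase hi)
      rw [← insert_erase hm, filter_insert_lt (h5 i hi).le] at h6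
      exact h6
    · right
      have h5 : ∀ i ∈ J, i ≤ m := by
        intro i hi
        have := h1 i hi
        have : i ≠ m + 1 := fun h => hm (h ▸ hi)
        omega
      have h6 : ∀ i ∈ J, i < m := by
        intro i hi
        refine lt_of_le_of_ne (h5 i hi) ?_
        rintro rfl
        -- If `m` were kept without `m + 1`, it would be the largest element, of rank `d`. Its
        -- parity condition would then contradict the one at the end point `m + 2`.
        have h7 := h4 i hi
        have h8 : J.filter (· < i) = J.erase i := by
          ext j
          rw [mem_filter, mem_erase, and_comm]
          refine and_congr_left fun hj => ?_
          have := h5 j hj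
          omega
        rw [h8, card_erase_of_mem hi, h2] at h7
        grind
      exact mem_adm.2 ⟨⟨h6, h2⟩, by grind, h4⟩
  · rintro (⟨J', h, rfl⟩ | h)
    · exact insert_mem_adm h
    · obtain ⟨⟨h1, h2⟩, h3, h4⟩ := mem_adm.1 h
      exact mem_adm.2 ⟨⟨fun i hi => (h1 i hi).trans (by omega), h2⟩, by grind, h4⟩

theorem sum_adm_succ {D : Type*} [AddCommMonoid D] (ε m d : ℕ) (Φ : Finset ℕ → D) :
    ∑ J ∈ adm ε (m + 2) (d + 1), Φ J =
      ∑ J ∈ adm ε (m + 1) d, Φ (insert (m + 1) J) + ∑ J ∈ adm ε m (d + 1), Φ J := by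
  rw [adm_succ, sum_union, sum_image]
  · intro J hJ J' hJ' h
    have h1 := notMem_of_lt (mem_adm.1 hJ).1.1 le_rfl
    have h2 := notMem_of_lt (mem_adm.1 hJ').1.1 le_rfl
    rw [← erase_insert h1, ← erase_insert h2]
    exact congrArg (fun s => s.erase (m + 1)) h
  · rw [disjoint_right]
    intro J hJ hJ'
    obtain ⟨J', -, rfl⟩ := mem_image.1 hJ'
    exact notMem_of_lt (mem_adm.1 hJ).1.1 (Nat.le_succ m) (mem_insert_self _ _)

theorem mem_adm_zero {ε m : ℕ} {J : Finset ℕ} : J ∈ adm ε m 0 ↔ J = ∅ ∧ Even (m + ε) := by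
  rw [mem_adm, card_eq_zero]
  constructor
  · rintro ⟨⟨-, rfl⟩, h, -⟩
    exact ⟨rfl, h⟩
  · rintro ⟨rfl, h⟩
    simpa using h

theorem adm_zero (ε m : ℕ) : adm ε m 0 = if Even (m + ε) then {∅} else ∅ := by
  ext J
  rw [mem_adm_zero]
  split_ifs with h <;> simp [h]

theorem adm_add_two_zero (ε m : ℕ) : adm ε (m + 2) 0 = adm ε m 0 := by
  rw [adm_zero, adm_zero, show m + 2 + ε = m + ε + 2 by ring]
  simp [Nat.even_add]

theorem adm_eq_empty {ε m d : ℕ} (h : m < d) : adm ε m d = ∅ := by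
  rw [adm, powersetCard_eq_empty.2 (by simpa using h), filter_empty]

theorem adm_one_one : adm 0 1 1 = {{0}} := by decide

theorem adm_one_one' : adm 1 1 1 = ∅ := by decide

variable {D : Type*} [Ring D]

/-- The product of the `f i` with `i ∈ J`, `i < m`, in increasing order. -/
def ordProd (f : ℕ → D) (m : ℕ) (J : Finset ℕ) : D :=
  ((List.range m).map fun i => if i ∈ J then f i else 1).prod

theorem ordProd_succ (f : ℕ → D) (m : ℕ) (J : Finset ℕ) :
    ordProd f (m + 1) J = ordProd f m J * if m ∈ J then f m else 1 := by
  simp [ordProd, List.range_succ]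

theorem ordProd_congr (f : ℕ → D) {m : ℕ} {J J' : Finset ℕ} (h : ∀ i < m, i ∈ J ↔ i ∈ J') :
    ordProd f m J = ordProd f m J' := by
  rw [ordProd, ordProd]
  congr 1
  refine List.map_congr_left fun i hi => ?_
  simp only [h i (List.mem_range.1 hi)]

theorem ordProd_insert (f : ℕ → D) (m : ℕ) (J : Finset ℕ) :
    ordProd f (m + 1) (insert m J) = ordProd f m J * f m := by
  rw [ordProd_succ, if_pos (mem_insert_self m J)]
  congr 1
  refine ordProd_congr f fun i hi => ?_
  rw [mem_insert]
  exact or_iff_right (by omega)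

theorem ordProd_succ_of_notMem (f : ℕ → D) {m : ℕ} {J : Finset ℕ} (h : m ∉ J) :
    ordProd f (m + 1) J = ordProd f m J := by
  rw [ordProd_succ, if_neg h, mul_one]

/-- The alternating sum of the `w i` over `i < m`, `i ∉ J`. -/
def altSum (w : ℕ → D) (ε m : ℕ) (J : Finset ℕ) : D :=
  ∑ i ∈ range m, if i ∈ J then 0 else (-1) ^ (i + #{j ∈ J | j < i} + ε) * w i

theorem altSum_insert (w : ℕ → D) {ε m : ℕ} {J : Finset ℕ} :
    altSum w ε (m + 1) (insert m J) = altSum w ε m J := by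
  rw [altSum, sum_range_succ, if_pos (mem_insert_self m J), add_zero, altSum]
  refine sum_congr rfl fun i hi => ?_
  have hi' := mem_range.1 hi
  rw [filter_insert_lt hi'.le]
  simp only [mem_insert, hi'.ne, false_or]

/-- The end point condition of `adm` makes the sign at `m` positive and the sign at `m + 1`
negative, so a deleted pair contributes exactly its weight difference. -/
theorem altSum_add_two (w : ℕ → D) {ε m d : ℕ} {J : Finset ℕ} (h : J ∈ adm ε m d) :
    altSum w ε (m + 2) J = altSum w ε m J + (w m - w (m + 1)) := by
  obtain ⟨⟨h1, h2⟩, h3, h4⟩ := mem_adm.1 h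
  rw [altSum, sum_range_succ, sum_range_succ, if_neg (notMem_of_lt h1 le_rfl),
    if_neg (notMem_of_lt h1 (Nat.le_succ m)), filter_lt_of_lt h1,
    filter_lt_of_lt fun i hi => (h1 i hi).trans (Nat.lt_succ_self m), h2, altSum, h3.neg_one_pow,
    show m + 1 + d + ε = m + d + ε + 1 by ring, h3.add_one.neg_one_pow]
  simp only [one_mul, neg_mul]
  abel

/-- The sum of the ordered products over the admissible sets. -/
def admSum (f : ℕ → D) (ε d m : ℕ) : D := ∑ J ∈ adm ε m d, ordProd f m J

/-- The sum of the ordered products over the admissible sets, weighted by `altSum`. -/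
def admAltSum (f w : ℕ → D) (ε d m : ℕ) : D := ∑ J ∈ adm ε m d, altSum w ε m J * ordProd f m J

/-- The second order contribution of the empty set. -/
def admQuad (w : ℕ → D) (ε : ℕ) : ℕ → D
  | 0 => 0
  | 1 => 0
  | m + 2 => admQuad w ε m + (w m - w (m + 1)) * ∑ J ∈ adm ε m 0, altSum w ε m J

theorem ordProd_add_two {f : ℕ → D} {ε m d : ℕ} {J : Finset ℕ} (h : J ∈ adm ε m d) :
    ordProd f (m + 2) J = ordProd f m J := by
  obtain ⟨⟨h1, -⟩, -⟩ := mem_adm.1 h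
  rw [ordProd_succ_of_notMem f (notMem_of_lt h1 (Nat.le_succ m)),
    ordProd_succ_of_notMem f (notMem_of_lt h1 le_rfl)]

theorem ordProd_empty (f : ℕ → D) (m : ℕ) : ordProd f m ∅ = 1 := by
  simp [ordProd]

theorem admSum_zero (f : ℕ → D) (ε m : ℕ) : admSum f ε 0 (m + 2) = admSum f ε 0 m := by
  rw [admSum, adm_add_two_zero, admSum]
  exact sum_congr rfl fun J hJ => ordProd_add_two hJ

theorem admSum_succ (f : ℕ → D) (ε d m : ℕ) : admSum f ε (d + 1) (m + 2) =
    admSum f ε d (m + 1) * f (m + 1) + admSum f ε (d + 1) m := by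
  rw [admSum, sum_adm_succ, admSum, sum_mul, admSum]
  congr 1
  · exact sum_congr rfl fun J _ => ordProd_insert f (m + 1) J
  · exact sum_congr rfl fun J hJ => ordProd_add_two hJ

theorem admAltSum_zero (f w : ℕ → D) (ε m : ℕ) : admAltSum f w ε 0 (m + 2) =
    admAltSum f w ε 0 m + (w m - w (m + 1)) * admSum f ε 0 m := by
  rw [admAltSum, adm_add_two_zero, admAltSum, admSum, mul_sum, ← sum_add_distrib]
  refine sum_congr rfl fun J hJ => ?_
  rw [ordProd_add_two hJ, altSum_add_two w hJ, add_mul]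

/-- Either the last letter is kept, or the last pair is deleted; in the latter case the
distinguished weight difference comes from an earlier pair or from this one. -/
theorem admAltSum_succ (f w : ℕ → D) (ε d m : ℕ) : admAltSum f w ε (d + 1) (m + 2) =
    admAltSum f w ε d (m + 1) * f (m + 1) + admAltSum f w ε (d + 1) m +
      (w m - w (m + 1)) * admSum f ε (d + 1) m := by
  rw [admAltSum, sum_adm_succ, admAltSum, sum_mul, admAltSum, admSum, mul_sum, add_assoc,
    ← sum_add_distrib]
  congr 1
  · refine sum_congr rfl fun J _ => ?_
    rw [altSum_insert, ordProd_insert, mul_assoc]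
  · refine sum_congr rfl fun J hJ => ?_
    rw [ordProd_add_two hJ, altSum_add_two w hJ, add_mul]

theorem sum_altSum_eq (f w : ℕ → D) (ε m : ℕ) :
    ∑ J ∈ adm ε m 0, altSum w ε m J = admAltSum f w ε 0 m := by
  rw [admAltSum]
  refine sum_congr rfl fun J hJ => ?_
  rw [(mem_adm_zero.1 hJ).1, ordProd_empty, mul_one]

end Admissible

/-! ### Low-degree coefficients of a continuant as sums over admissible sets -/

section Coefficients

open Polynomial

variable {D : Type*} [Ring D]

/-- The coefficients in low degree of a solution `v` of the recursion of continuants. -/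
theorem coeff_of_recursion (f w : ℕ → D) (hw : w 0 = 0) (ε : ℕ) (v : ℕ → D[X])
    (hv : ∀ m, v (m + 2) = v (m + 1) * (C (f (m + 1)) * X) +
      (1 + C (w m - w (m + 1)) * X ^ 2) * v m)
    (h0 : ε = 0 ∧ v 0 = 1 ∧ v 1 = C (f 0) * X ∨ ε = 1 ∧ v 0 = 0 ∧ v 1 = 1) (m : ℕ) :
    (v m).coeff 0 = admSum f ε 0 m ∧ (v m).coeff 1 = admSum f ε 1 m ∧
      (v m).coeff 2 = admSum f ε 2 m + admAltSum f w ε 0 m ∧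
      (v m).coeff 3 = admSum f ε 3 m + admAltSum f w ε 1 m ∧
      (v m).coeff 4 = admSum f ε 4 m + admAltSum f w ε 2 m + admQuad w ε m := by
  induction m using Nat.twoStepInduction with
  | zero =>
    obtain ⟨rfl, h1, -⟩ | ⟨rfl, h1, -⟩ := h0
    · simp [h1, admSum, admAltSum, admQuad, adm_eq_empty, adm_zero, altSum, ordProd, coeff_one]
    · simp [h1, admSum, admAltSum, admQuad, adm_eq_empty, adm_zero]
  | one =>
    obtain ⟨rfl, -, h1⟩ | ⟨rfl, -, h1⟩ := h0
    · simp [h1, admSum, admAltSum, admQuad, adm_eq_empty, adm_zero, altSum, ordProd, coeff_X,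
        adm_one_one]
    -- For `ε = 1` the letters start at `1`, yet `altSum` also runs over the index `0`; `hw` removes
    -- that spurious term.
    · simp [h1, admSum, admAltSum, admQuad, adm_eq_empty, adm_zero, altSum, ordProd, coeff_one,
        adm_one_one', hw]
  | more m ih1 ih2 =>
    obtain ⟨a0, a1, a2, a3, a4⟩ := ih1
    obtain ⟨b0, b1, b2, b3, b4⟩ := ih2
    -- All powers of `X` are moved to the right, so that each coefficient is a shifted one.
    have e : v (m + 2) = v (m + 1) * C (f (m + 1)) * X +
        (v m + C (w m - w (m + 1)) * v m * X ^ 2) := by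
      rw [hv, ← mul_assoc, add_mul, one_mul, mul_assoc (C _) (X ^ 2), (commute_X_pow (v m) 2).eq]
      simp only [mul_assoc]
    have c0 : (v (m + 2)).coeff 0 = (v m).coeff 0 := by simp [e]
    have c1 : (v (m + 2)).coeff 1 = (v (m + 1)).coeff 0 * f (m + 1) + (v m).coeff 1 := by
      simp [e, coeff_mul_X_pow']
    have c2 : ∀ r, (v (m + 2)).coeff (r + 2) = (v (m + 1)).coeff (r + 1) * f (m + 1) +
        ((v m).coeff (r + 2) + (w m - w (m + 1)) * (v m).coeff r) := by
      intro r
      rw [e, coeff_add, coeff_add, coeff_mul_X_pow, coeff_C_mul, coeff_mul_X, coeff_mul_C]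
    refine ⟨?_, ?_, ?_, ?_, ?_⟩
    · rw [c0, a0, admSum_zero]
    · rw [c1, b0, a1, admSum_succ]
    · rw [c2, b1, a2, a0, admSum_succ, admAltSum_zero]
      abel
    · rw [c2, b2, a3, a1, admSum_succ, admAltSum_succ, add_mul]
      abel
    · rw [c2, b3, a4, a2, admSum_succ, admAltSum_succ, admQuad, sum_altSum_eq f, add_mul, mul_add]
      abel

end Coefficients

/-! ### Even gaps on the cycle, and their description after cutting it between `l` and `0` -/

section Cyclic

open Finset

variable (l : ℕ)

theorem natCast_val' (x : ZMod (l + 1)) : ((x.val : ℕ) : ZMod (l + 1)) = x :=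
  ZMod.natCast_zmod_val x

theorem val_natCast' {i : ℕ} (hi : i < l + 1) : ((i : ZMod (l + 1))).val = i :=
  ZMod.val_cast_of_lt hi

theorem val_add_one' {x : ZMod (l + 1)} (hx : x.val < l) : (x + 1).val = x.val + 1 := by
  have h := val_natCast' l (show x.val + 1 < l + 1 by omega)
  rwa [Nat.cast_add, natCast_val', Nat.cast_one] at h

theorem natCast_succ_self : ((l : ℕ) : ZMod (l + 1)) + 1 = 0 := by
  have := ZMod.natCast_self (l + 1)
  rwa [Nat.cast_add, Nat.cast_one] at this

theorem add_one_eq_zero {x : ZMod (l + 1)} (hx : x.val = l) : x + 1 = 0 := by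
  rw [← natCast_val' l x, hx, natCast_succ_self]

theorem val_lt' (x : ZMod (l + 1)) : x.val < l + 1 := ZMod.val_lt x

theorem eq_of_forall_add_one {β : Type*} {ψ : ZMod (l + 1) → β} (h : ∀ x, ψ (x + 1) = ψ x)
    (x y : ZMod (l + 1)) : ψ x = ψ y := by
  have key : ∀ n : ℕ, ψ (n : ZMod (l + 1)) = ψ 0 := by
    intro n
    induction n with
    | zero => rw [Nat.cast_zero]
    | succ n ih => rw [Nat.cast_succ, h, ih]
  rw [← natCast_val' l x, ← natCast_val' l y, key, key]

theorem sum_zmod_eq_sum_range {M : Type*} [AddCommMonoid M] (F : ZMod (l + 1) → M) :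
    ∑ x, F x = ∑ i ∈ range (l + 1), F (i : ZMod (l + 1)) := by
  symm
  refine sum_bij' (fun i _ => (i : ZMod (l + 1))) (fun x _ => x.val) ?_ ?_ ?_ ?_ ?_
  · simp
  · intro x _
    exact mem_range.2 (val_lt' l x)
  · intro i hi
    exact val_natCast' l (mem_range.1 hi)
  · intro x _
    exact natCast_val' l x
  · simp

theorem sum_add_one {M : Type*} [AddCommMonoid M] (F : ZMod (l + 1) → M) :
    ∑ x, F (x + 1) = ∑ x, F x :=
  Equiv.sum_comp (Equiv.addRight (1 : ZMod (l + 1))) F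

/-- The representatives in `{0, …, l}` of a subset of `ℤ/(l+1)ℤ`. -/
def reps (J : Finset (ZMod (l + 1))) : Finset ℕ := J.image ZMod.val

/-- The subset of `ℤ/(l+1)ℤ` represented by a set of natural numbers. -/
def classes (J : Finset ℕ) : Finset (ZMod (l + 1)) := J.image Nat.cast

variable {l}

theorem mem_reps {J : Finset (ZMod (l + 1))} {i : ℕ} (hi : i < l + 1) :
    i ∈ reps l J ↔ (i : ZMod (l + 1)) ∈ J := by
  rw [reps, mem_image]
  constructor
  · rintro ⟨x, hx, rfl⟩
    rwa [natCast_val']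
  · intro h
    exact ⟨_, h, val_natCast' l hi⟩

theorem lt_of_mem_reps {J : Finset (ZMod (l + 1))} {i : ℕ} (hi : i ∈ reps l J) : i < l + 1 := by
  obtain ⟨x, -, rfl⟩ := mem_image.1 hi
  exact val_lt' l x

theorem val_mem_reps {J : Finset (ZMod (l + 1))} {x : ZMod (l + 1)} : x.val ∈ reps l J ↔ x ∈ J := by
  rw [mem_reps (val_lt' l x), natCast_val']

theorem card_reps (J : Finset (ZMod (l + 1))) : #(reps l J) = #J :=
  card_image_of_injective _ (ZMod.val_injective _)

theorem classes_reps (J : Finset (ZMod (l + 1))) : classes l (reps l J) = J := by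
  ext x
  rw [classes, mem_image]
  constructor
  · rintro ⟨i, hi, rfl⟩
    exact (mem_reps (lt_of_mem_reps hi)).1 hi
  · intro h
    exact ⟨x.val, val_mem_reps.2 h, natCast_val' l x⟩

theorem reps_classes {J : Finset ℕ} (h : ∀ i ∈ J, i < l + 1) : reps l (classes l J) = J := by
  ext i
  constructor
  · intro hi
    have hi' := lt_of_mem_reps hi
    rw [mem_reps hi', classes, mem_image] at hi
    obtain ⟨j, hj, hji⟩ := hi
    rw [← val_natCast' l hi', ← hji, val_natCast' l (h j hj)]
    exact hj
  · intro hi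
    rw [mem_reps (h i hi), classes, mem_image]
    exact ⟨i, hi, rfl⟩

variable (l)

/-- The position of `x` plus the number of smaller elements of `J`. -/
def height (J : Finset (ZMod (l + 1))) (x : ZMod (l + 1)) : ℕ :=
  x.val + #{j ∈ reps l J | j < x.val}

variable {l}

/-- Modulo 2 the height advances by one per step and once more on leaving an element of `J`. Going
once around adds `l + 1 + #J` in all, so the evenness hypothesis makes the rule consistent at the
wrap from `l` to `0`. -/
theorem height_add_one {J : Finset (ZMod (l + 1))} (hJ : Even (l + 1 + #J)) (x : ZMod (l + 1)) :
    ((height l J (x + 1) : ℕ) : ZMod 2) = (height l J x : ℕ) + 1 + if x ∈ J then 1 else 0 := by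
  have key : #{j ∈ reps l J | j < x.val + 1} =
      #{j ∈ reps l J | j < x.val} + if x ∈ J then 1 else 0 := by
    split_ifs with hx
    · rw [← card_insert_of_notMem (a := x.val) (by simp)]
      congr 1
      ext j
      rw [mem_insert, mem_filter, mem_filter]
      constructor
      · rintro ⟨h1, h2⟩
        rcases Nat.lt_succ_iff_lt_or_eq.1 h2 with h | h
        · exact Or.inr ⟨h1, h⟩
        · exact Or.inl h
      · rintro (rfl | ⟨h1, h2⟩)
        · exact ⟨val_mem_reps.2 hx, Nat.lt_succ_self _⟩
        · exact ⟨h1, by omega⟩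
    · rw [add_zero]
      congr 1
      ext j
      rw [mem_filter, mem_filter]
      refine and_congr_right fun hj => ?_
      have : j ≠ x.val := by
        rintro rfl
        exact hx (val_mem_reps.1 hj)
      omega
  rcases Nat.lt_succ_iff_lt_or_eq.1 (val_lt' l x) with hx | hx
  · rw [height, val_add_one' l hx, key, height]
    push_cast
    ring
  -- At the wrap, the elements below `x.val + 1` are all of `J`, so the required congruence is the
  -- evenness of `l + 1 + #J`.
  · have h0 : height l J 0 = 0 := by simp [height]
    have h1 : reps l J = {j ∈ reps l J | j < x.val + 1} := by
      refine (filter_true_of_mem fun i hi => ?_).symm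
      have := lt_of_mem_reps hi
      omega
    rw [add_one_eq_zero l hx, h0, height]
    rw [← card_reps, h1, key, ← ZMod.natCast_eq_zero_iff_even] at hJ
    push_cast at hJ ⊢
    rw [hx] at hJ ⊢
    linear_combination (-1 : ZMod 2) * hJ

theorem runLength_of_notMem {C : Finset (ZMod (l + 1))} {x : ZMod (l + 1)} (hx : x ∉ C) :
    runLength l C x = 0 := by
  rw [runLength, Nat.sInf_eq_zero]
  left
  simpa using hx

theorem exists_add_notMem {C : Finset (ZMod (l + 1))} (hC : ∃ y, y ∉ C) (x : ZMod (l + 1)) :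
    ∃ m : ℕ, x + (m : ZMod (l + 1)) ∉ C := by
  obtain ⟨y, hy⟩ := hC
  refine ⟨(y - x).val, ?_⟩
  rwa [natCast_val', add_sub_cancel]

theorem add_runLength_notMem {C : Finset (ZMod (l + 1))} (hC : ∃ y, y ∉ C) (x : ZMod (l + 1)) :
    x + (runLength l C x : ZMod (l + 1)) ∉ C :=
  Nat.sInf_mem (s := {m : ℕ | x + (m : ZMod (l + 1)) ∉ C}) (exists_add_notMem hC x)

theorem add_mem_of_lt_runLength {C : Finset (ZMod (l + 1))} {x : ZMod (l + 1)} {m : ℕ}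
    (h : m < runLength l C x) : x + (m : ZMod (l + 1)) ∈ C := by
  have := Nat.notMem_of_lt_sInf h
  simpa using this

theorem runLength_of_mem {C : Finset (ZMod (l + 1))} (hC : ∃ y, y ∉ C) {x : ZMod (l + 1)}
    (hx : x ∈ C) : runLength l C x = runLength l C (x + 1) + 1 := by
  have h1 := add_runLength_notMem hC x
  have h2 := add_runLength_notMem hC (x + 1)
  have h0 : runLength l C x ≠ 0 := by
    intro h
    rw [h, Nat.cast_zero, add_zero] at h1
    exact h1 hx
  obtain ⟨r, hr⟩ := Nat.exists_eq_succ_of_ne_zero h0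
  refine le_antisymm (Nat.sInf_le ?_) ?_
  · rw [Set.mem_ofPred_eq]
    push_cast
    rwa [add_comm (_ : ZMod (l + 1)) 1, ← add_assoc]
  · rw [hr]
    refine Nat.succ_le_succ (Nat.sInf_le ?_)
    rw [Set.mem_ofPred_eq]
    rw [hr, Nat.cast_succ, add_comm (_ : ZMod (l + 1)) 1, ← add_assoc] at h1
    exact h1

/-- A component of the complement starts right after an element of `J`. When the successor of an
element of `J` is again in `J`, the gap is empty, and `hG` makes its contribution vanish. This
allows sums over components to be written as sums over `J`. -/
theorem sum_starts {M : Type*} [AddCommMonoid M] (J : Finset (ZMod (l + 1)))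
    (G : ZMod (l + 1) → M) (hG : ∀ x ∈ J, G x = 0) :
    ∑ i ∈ starts l Jᶜ, G i = ∑ x ∈ J, G (x + 1) := by
  have h1 : ∑ x ∈ J, G (x + 1) = ∑ i ∈ univ.filter (fun i => i - 1 ∈ J), G i := by
    refine sum_bij' (fun x _ => x + 1) (fun i _ => i - 1) ?_ ?_ ?_ ?_ ?_ <;> simp
  rw [h1]
  refine sum_subset (fun i hi => ?_) fun i hi hi' => hG i ?_
  · rw [starts, mem_filter, mem_compl, mem_compl, not_not] at hi
    simpa using hi.2
  · rw [starts, mem_filter, mem_compl, mem_compl, not_not] at hi'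
    by_contra h
    exact hi' ⟨h, (mem_filter.1 hi).2⟩

theorem even_runLength_iff (J : Finset (ZMod (l + 1))) :
    (∀ i ∈ starts l Jᶜ, Even (runLength l Jᶜ i)) ↔ ∀ x ∈ J, Even (runLength l Jᶜ (x + 1)) := by
  constructor
  · intro h x hx
    by_cases hx' : x + 1 ∈ J
    · rw [runLength_of_notMem (by simpa using hx')]
      exact Even.zero
    · exact h _ (by simpa [starts] using ⟨hx', hx⟩)
  · intro h i hi
    rw [starts, mem_filter, mem_compl, mem_compl, not_not] at hi
    have := h _ hi.2
    rwa [sub_add_cancel] at this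

/-- Outside `J`, one step forward raises the height by one and shortens the remaining run by one, so
height plus run length is constant modulo 2. On `J` the run length is zero, and the height does not
change modulo 2 from `x` to `x + 1`. Thus the length of each gap measures, modulo 2, the difference
of the heights of the two elements bounding it. -/
theorem even_runLength_iff_height {J : Finset (ZMod (l + 1))} (hne : J.Nonempty)
    (hJ : Even (l + 1 + #J)) : (∀ x ∈ J, Even (runLength l Jᶜ (x + 1))) ↔
      ∀ x ∈ J, ∀ y ∈ J, ((height l J x : ℕ) : ZMod 2) = (height l J y : ℕ) := by
  obtain ⟨y₀, hy₀⟩ := hne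
  have hC : ∃ y, y ∉ Jᶜ := ⟨y₀, by simpa using hy₀⟩
  have hout : ∀ x, x ∉ J → ((height l J (x + 1) + runLength l Jᶜ (x + 1) : ℕ) : ZMod 2) =
      (height l J x + runLength l Jᶜ x : ℕ) := by
    intro x hx
    rw [runLength_of_mem hC (x := x) (by simpa using hx)]
    push_cast
    rw [height_add_one hJ, if_neg hx]
    ring
  have hin : ∀ x ∈ J, ((height l J (x + 1) : ℕ) : ZMod 2) = (height l J x : ℕ) := by
    intro x hx
    rw [height_add_one hJ, if_pos hx, add_assoc, show (1 + 1 : ZMod 2) = 0 from rfl, add_zero]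
  have hrun : ∀ x ∈ J, runLength l Jᶜ x = 0 := fun x hx =>
    runLength_of_notMem (by simpa using hx)
  constructor
  · intro h x hx y hy
    have key := eq_of_forall_add_one l
      (ψ := fun x => ((height l J x + runLength l Jᶜ x : ℕ) : ZMod 2)) (fun x => by
        by_cases hx : x ∈ J
        · have := (ZMod.natCast_eq_zero_iff_even).2 (h x hx)
          rw [Nat.cast_add, Nat.cast_add, this, hrun x hx, hin x hx, Nat.cast_zero]
        · exact hout x hx) x y
    simpa [hrun x hx, hrun y hy] using key
  · intro h x hx
    -- Walk from `z` through the remaining gap to the next element of `J`, where the height parity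
    -- is known.
    have key : ∀ m : ℕ, ∀ z, runLength l Jᶜ z = m →
        ((height l J z + m : ℕ) : ZMod 2) = (height l J y₀ : ℕ) := by
      intro m
      induction m with
      | zero =>
        intro z hz
        have hz' : z ∈ J := by
          by_contra hz'
          rw [runLength_of_mem hC (by simpa using hz')] at hz
          omega
        rw [add_zero]
        exact h z hz' y₀ hy₀
      | succ m ih =>
        intro z hz
        have hz' : z ∉ J := by
          intro hz'
          rw [hrun z hz'] at hz
          omega
        have hz1 := hz
        rw [runLength_of_mem hC (by simpa using hz')] at hz1
        have h2 := hout z hz'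
        rw [hz, Nat.succ_injective hz1] at h2
        rw [← h2]
        exact ih _ (Nat.succ_injective hz1)
    have h1 := key _ (x + 1) rfl
    rw [Nat.cast_add, hin x hx, h x hx y₀ hy₀, add_eq_left] at h1
    exact ZMod.natCast_eq_zero_iff_even.1 h1

theorem natCast_two_eq_iff {a b : ℕ} : ((a : ℕ) : ZMod 2) = b ↔ Even (a + b) := by
  rw [← ZMod.natCast_eq_zero_iff_even, Nat.cast_add, add_eq_zero_iff_eq_neg, ZMod.neg_eq_self_mod_two]

theorem reps_mem_adm_zero {J : Finset (ZMod (l + 1))} (hJ : Even (l + 1 + #J)) :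
    reps l J ∈ adm 0 (l + 1) #J ↔ ∀ x ∈ J, Even (height l J x) := by
  rw [mem_adm, card_reps]
  constructor
  · rintro ⟨-, -, h⟩ x hx
    exact h _ (val_mem_reps.2 hx)
  · intro h
    refine ⟨⟨fun i hi => lt_of_mem_reps hi, rfl⟩, hJ, fun i hi => ?_⟩
    have := h _ ((mem_reps (lt_of_mem_reps hi)).1 hi)
    rwa [height, val_natCast' l (lt_of_mem_reps hi)] at this

theorem reps_mem_adm_one {J : Finset (ZMod (l + 1))} (hJ : Even (l + 1 + #J)) :
    reps l J ∈ adm 1 l #J ↔ ∀ x ∈ J, Even (height l J x + 1) := by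
  rw [mem_adm, card_reps]
  constructor
  · rintro ⟨-, -, h⟩ x hx
    exact h _ (val_mem_reps.2 hx)
  · intro h
    have h' : ∀ i ∈ reps l J, Even (i + #{j ∈ reps l J | j < i} + 1) := by
      intro i hi
      have := h _ ((mem_reps (lt_of_mem_reps hi)).1 hi)
      rwa [height, val_natCast' l (lt_of_mem_reps hi)] at this
    refine ⟨⟨fun i hi => ?_, rfl⟩, by grind, h'⟩
    refine lt_of_le_of_ne (Nat.lt_succ_iff.1 (lt_of_mem_reps hi)) ?_
    rintro rfl
    -- If the last index were kept, it would be the largest element; its rank `#J - 1` gives a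
    -- parity incompatible with the evenness of `l + 1 + #J`.
    have h1 := h' i hi
    have h2 : (reps i J).filter (· < i) = (reps i J).erase i := by
      ext j
      rw [mem_filter, mem_erase, and_comm]
      refine and_congr_left fun hj => ?_
      have := lt_of_mem_reps hj
      omega
    rw [h2, card_erase_of_mem hi, card_reps] at h1
    have h3 : 0 < #J := by rw [← card_reps]; exact card_pos.2 ⟨i, hi⟩
    grind

/-- The gap meeting the cut between `l` and `0` is divided into two pieces of equal parity. If both
are even, the set is admissible with `ε = 0` for the full interval. If both are odd, the pair `{l,
0}` is deleted across the cut, which leaves an admissible set with `ε = 1` for the letters `1, …, l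
- 1`. The common height parity on `J` distinguishes the two cases. -/
theorem mem_S_iff {J : Finset (ZMod (l + 1))} {d : ℕ} (hd : 1 ≤ d) (hl : Even (l + 1 + d)) :
    J ∈ S l d ↔ reps l J ∈ adm 0 (l + 1) d ∨ reps l J ∈ adm 1 l d := by
  by_cases hJ : #J = d
  · subst hJ
    have hne : J.Nonempty := card_pos.1 hd
    rw [S, mem_filter, even_runLength_iff, even_runLength_iff_height hne hl, reps_mem_adm_zero hl,
      reps_mem_adm_one hl]
    simp only [mem_univ, true_and, natCast_two_eq_iff]
    constructor
    · intro h
      obtain ⟨y, hy⟩ := hne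
      rcases Nat.even_or_odd (height l J y) with h1 | h1
      · left
        intro x hx
        have := h x hx y hy
        grind
      · right
        intro x hx
        have := h x hx y hy
        grind
    · rintro (h | h) x hx y hy
      · have := h x hx
        have := h y hy
        grind
      · have := h x hx
        have := h y hy
        grind
  · have h1 : J ∉ S l d := by simp [S, hJ]
    have h2 : ∀ ε m, reps l J ∉ adm ε m d := fun ε m h => hJ (by
      rw [← card_reps]; exact (mem_adm.1 h).1.2)
    simp [h1, h2]

theorem lt_of_mem_adm {ε m d : ℕ} (hm : m ≤ l + 1) {J : Finset ℕ} (h : J ∈ adm ε m d) :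
    ∀ i ∈ J, i < l + 1 := fun i hi => ((mem_adm.1 h).1.1 i hi).trans_le hm

theorem sum_S {M : Type*} [AddCommMonoid M] {d : ℕ} (hd : 1 ≤ d) (hl : Even (l + 1 + d))
    (Φ : Finset (ZMod (l + 1)) → M) : ∑ J ∈ S l d, Φ J =
      ∑ J ∈ adm 0 (l + 1) d, Φ (classes l J) + ∑ J ∈ adm 1 l d, Φ (classes l J) := by
  have hdisj : Disjoint (adm 0 (l + 1) d) (adm 1 l d) := by
    rw [disjoint_left]
    intro J h0 h1
    obtain ⟨⟨-, h2⟩, -, h3⟩ := mem_adm.1 h0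
    obtain ⟨i, hi⟩ := card_pos.1 (by omega : 0 < #J)
    have h4 := h3 i hi
    have h5 := (mem_adm.1 h1).2.2 i hi
    grind
  have hlt : ∀ J ∈ adm 0 (l + 1) d ∪ adm 1 l d, ∀ i ∈ J, i < l + 1 := by
    intro J h
    rcases mem_union.1 h with h | h
    · exact lt_of_mem_adm le_rfl h
    · exact lt_of_mem_adm (Nat.le_succ l) h
  rw [← sum_union hdisj]
  refine sum_bij' (fun J _ => reps l J) (fun J _ => classes l J) ?_ ?_ ?_ ?_ ?_
  · intro J hJ
    exact mem_union.2 ((mem_S_iff hd hl).1 hJ)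
  · intro J hJ
    rw [mem_S_iff hd hl, reps_classes (hlt J hJ)]
    exact mem_union.1 hJ
  · intro J _
    exact classes_reps J
  · intro J hJ
    exact reps_classes (hlt J hJ)
  · intro J _
    rw [classes_reps]

end Cyclic

/-! ### Commutation relations for integer representatives, and central elements -/

section Relations

variable {l : ℕ}

theorem natCast_ne {a b : ℕ} (h1 : a < b) (h2 : b ≤ a + l) : (a : ZMod (l + 1)) ≠ b := by
  intro h
  rw [ZMod.natCast_eq_natCast_iff, Nat.modEq_iff_dvd' h1.le] at h
  have := Nat.le_of_dvd (by omega) h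
  omega

theorem u_add_one (hl : 2 ≤ l) (i : ZMod (l + 1)) : u l i (i + 1) = 1 := by
  have h : i + 1 ≠ i - 1 := by
    intro h
    have h2 : ((0 : ℕ) : ZMod (l + 1)) = (2 : ℕ) := by
      have := congrArg (fun x => x - i + 1) h
      simp only [add_sub_cancel_left] at this
      push_cast
      rw [show (2 : ZMod (l + 1)) = 1 + 1 by norm_num, this]
      ring
    exact natCast_ne (by omega) (by omega) h2
  rw [u, if_pos rfl, if_neg h, sub_zero]

theorem u_natCast_eq_zero {i j : ℕ} (h1 : i + 2 ≤ j) (h2 : j + 1 ≤ i + l) :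
    u l (i : ZMod (l + 1)) (j : ZMod (l + 1)) = 0 := by
  have h3 : (j : ZMod (l + 1)) ≠ i + 1 := by
    have := natCast_ne (l := l) (a := i + 1) (b := j) (by omega) (by omega)
    push_cast at this
    exact this.symm
  have h4 : (j : ZMod (l + 1)) ≠ i - 1 := by
    have := natCast_ne (l := l) (a := j + 1) (b := i + (l + 1)) (by omega) (by omega)
    rw [Nat.cast_add i, ZMod.natCast_self, add_zero, Nat.cast_succ] at this
    rwa [Ne, eq_sub_iff_add_eq]
  rw [u, if_neg h3, if_neg h4, sub_zero]

theorem f_mul_f_add_one (hl : 2 ≤ l) (i : ZMod (l + 1)) :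
    f l i * f l (i + 1) = f l (i + 1) * f l i + h l := by
  rw [f_mul_f, u_add_one hl, one_smul]

theorem commute_f_f {i j : ℕ} (h1 : i + 2 ≤ j) (h2 : j + 1 ≤ i + l) :
    Commute (f l (i : ZMod (l + 1))) (f l (j : ZMod (l + 1))) := by
  have := f_mul_f l (i : ZMod (l + 1)) j
  rwa [u_natCast_eq_zero h1 h2, zero_smul, add_zero] at this

/-- Commutation with the generators passes to the algebra they generate, and then to every left
fraction because commuting with a denominator implies commuting with its inverse. -/
theorem commute_fracHom_of_gen {z : A l} (hz : ∀ g, Commute z (gen l g)) (x : K l) :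
    Commute (fracHom (A l) z) x := by
  have hA : ∀ a : A l, Commute z a := by
    intro a
    have ha : a ∈ Algebra.adjoin ℂ (Set.range (gen l)) := by rw [adjoin_gen]; trivial
    induction ha using Algebra.adjoin_induction with
    | mem a ha =>
      obtain ⟨g, rfl⟩ := ha
      exact hz g
    | algebraMap r => exact (Algebra.commutes r _).symm
    | add a b _ _ ha hb => exact ha.add_right hb
    | mul a b _ _ ha hb => exact ha.mul_right hb
  have hf : ∀ a : A l, Commute (fracHom (A l) z) (fracHom (A l) a) :=
    fun a => (hA a).map (fracHom (A l))
  induction x using OreLocalization.ind with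
  | _ r s =>
    rw [oreDiv_eq]
    exact (hf _).inv_right₀.mul_right (hf r)

theorem commute_h_center (x : K l) : Commute (h l) x := by
  have h0 := isRep_comp (AlgHom.id ℂ (A l))
  refine commute_fracHom_of_gen (fun g => ?_) x
  cases g with
  | f i => exact sub_eq_zero.1 (h0.hf i)
  | α i => exact sub_eq_zero.1 (h0.hα i)
  | h => exact Commute.refl _

theorem commute_α_center (i : ZMod (l + 1)) (x : K l) : Commute (α l i) x := by
  have h0 := isRep_comp (AlgHom.id ℂ (A l))
  refine commute_fracHom_of_gen (fun g => ?_) x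
  cases g with
  | f j => exact (sub_eq_zero.1 (h0.fα j i)).symm
  | α j => exact sub_eq_zero.1 (h0.αα i j)
  | h => exact (sub_eq_zero.1 (h0.hα i)).symm

end Relations

/-! ### The coefficients χ as alternating sums over the cut interval -/

section Weights

open Finset

variable {l : ℕ}

theorem χRun_succ (i : ZMod (l + 1)) (m : ℕ) : χRun l i (m + 1) = ϖ l i - χRun l (i + 1) m := by
  rw [χRun, sum_range_succ', χRun, Nat.cast_zero, add_zero, pow_zero, one_mul, add_comm,
    sub_eq_add_neg, ← sum_neg_distrib]
  congr 1
  refine sum_congr rfl fun r _ => ?_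
  rw [pow_succ, mul_neg_one, neg_mul, Nat.cast_succ, add_comm (r : ZMod (l + 1)), add_assoc]

/-- The component-wise alternating sums are glued into a single signed sum over the complement, the
sign at `x` being given by the parity of the height. The hypothesis `hε` ensures that every
component starts with a positive sign. -/
theorem χ_compl_eq {J : Finset (ZMod (l + 1))} (hne : J.Nonempty) (hJ : Even (l + 1 + #J)) {ε : ℕ}
    (hε : ∀ x ∈ J, Even (height l J x + ε)) :
    χ l Jᶜ = altSum (fun i => ϖ l (i : ZMod (l + 1))) ε (l + 1) (reps l J) := by
  obtain ⟨y₀, hy₀⟩ := hne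
  have hC : ∃ y, y ∉ Jᶜ := ⟨y₀, by simpa using hy₀⟩
  set c : ZMod (l + 1) → K l := fun x => χRun l x (runLength l Jᶜ x) with hc
  set G : ZMod (l + 1) → K l := fun x => (-1) ^ (height l J x + ε) * c x with hG
  have hc0 : ∀ x ∈ J, c x = 0 := by
    intro x hx
    simp only [hc]
    rw [runLength_of_notMem (by simpa using hx), χRun, sum_range_zero]
  have hG0 : ∀ x ∈ J, G x = 0 := fun x hx => by simp only [hG]; rw [hc0 x hx, mul_zero]
  have hG1 : ∀ x ∈ J, G (x + 1) = c (x + 1) := by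
    intro x hx
    have h1 := height_add_one hJ x
    have h2 := hε x hx
    have h3 : Even (height l J (x + 1) + ε) := by
      rw [← ZMod.natCast_eq_zero_iff_even] at h2 ⊢
      rw [Nat.cast_add, h1, if_pos hx, add_assoc (_ : ZMod 2) 1 1,
        show (1 + 1 : ZMod 2) = 0 from rfl, add_zero, ← Nat.cast_add, h2]
    simp only [hG]
    rw [h3.neg_one_pow, one_mul]
  -- With the height sign attached, the remaining alternating sum `c` satisfies a recursion without
  -- sign changes, so summation over the cycle telescopes.
  have hGn : ∀ x, x ∉ J → G x = (-1) ^ (height l J x + ε) * ϖ l x + G (x + 1) := by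
    intro x hx
    have h1 := height_add_one hJ x
    rw [if_neg hx, add_zero, ← Nat.cast_succ, natCast_two_eq_iff] at h1
    have h2 : (-1 : K l) ^ (height l J (x + 1) + ε) = -(-1) ^ (height l J x + ε) := by
      rw [neg_eq_neg_one_mul ((-1 : K l) ^ (height l J x + ε)), ← pow_succ']
      exact neg_one_pow_congr (by grind)
    simp only [hG, hc]
    rw [runLength_of_mem hC (by simpa using hx), χRun_succ, h2, mul_sub, neg_mul, sub_eq_add_neg]
  -- The sum of `G` over the cycle is shift invariant, and `G` vanishes on `J`. Subtracting the part
  -- over the complement leaves the values at the successors of elements of `J`, which are the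
  -- starting values of the components.
  have key : ∑ x ∈ J, G (x + 1) = ∑ x ∈ Jᶜ, (-1) ^ (height l J x + ε) * ϖ l x := by
    have h1 : ∑ x, G x = ∑ x ∈ Jᶜ, G x := by
      rw [← sum_add_sum_compl J, sum_eq_zero hG0, zero_add]
    have h2 : ∑ x ∈ Jᶜ, G x =
        ∑ x ∈ Jᶜ, (-1) ^ (height l J x + ε) * ϖ l x + ∑ x ∈ Jᶜ, G (x + 1) := by
      rw [← sum_add_distrib]
      exact sum_congr rfl fun x hx => hGn x (by simpa using hx)
    have h3 := sum_add_one l G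
    rw [h1, h2, ← sum_add_sum_compl J] at h3
    exact add_right_cancel h3
  have h1 : χ l Jᶜ = ∑ x ∈ J, c (x + 1) := sum_starts J c hc0
  rw [h1, ← sum_congr rfl hG1, key, altSum]
  have h2 : ∑ x ∈ Jᶜ, (-1) ^ (height l J x + ε) * ϖ l x =
      ∑ x, if x ∈ J then 0 else (-1) ^ (height l J x + ε) * ϖ l x := by
    rw [← sum_add_sum_compl J, sum_eq_zero (s := J) (fun x hx => if_pos hx), zero_add]
    exact sum_congr rfl fun x hx => by rw [if_neg (by simpa using hx)]
  rw [h2, sum_zmod_eq_sum_range]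
  refine sum_congr rfl fun i hi => ?_
  have hi' := mem_range.1 hi
  simp only [mem_reps hi', height, val_natCast' l hi']

theorem ϖ_zero : ϖ l 0 = 0 := by
  simp [ϖ]

theorem χ_classes_zero {d : ℕ} (hd : 1 ≤ d) {J : Finset ℕ} (hJ : J ∈ adm 0 (l + 1) d) :
    χ l (classes l J)ᶜ = altSum (fun i => ϖ l (i : ZMod (l + 1))) 0 (l + 1) J := by
  have hr := reps_classes (lt_of_mem_adm le_rfl hJ)
  have hcard : #(classes l J) = d := by rw [← card_reps, hr]; exact (mem_adm.1 hJ).1.2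
  have hl : Even (l + 1 + #(classes l J)) := by rw [hcard]; exact (mem_adm.1 hJ).2.1
  have h1 := (reps_mem_adm_zero hl).1 (by rwa [hr, hcard])
  rw [χ_compl_eq (card_pos.1 (by omega)) hl (ε := 0) h1, hr]

/-- The index `l` belongs to the pair deleted across the cut and lies outside the window of
`altSum`; it contributes separately, with positive sign. Its partner `0` contributes nothing since
`ϖ 0 = 0`. -/
theorem χ_classes_one {d : ℕ} (hd : 1 ≤ d) {J : Finset ℕ} (hJ : J ∈ adm 1 l d) :
    χ l (classes l J)ᶜ =
      altSum (fun i => ϖ l (i : ZMod (l + 1))) 1 l J + ϖ l (l : ZMod (l + 1)) := by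
  have hr := reps_classes (lt_of_mem_adm (Nat.le_succ l) hJ)
  obtain ⟨⟨hlt, hd'⟩, hpar, -⟩ := mem_adm.1 hJ
  have hcard : #(classes l J) = d := by rw [← card_reps, hr, hd']
  have hl : Even (l + 1 + #(classes l J)) := by rw [hcard]; grind
  have h1 := (reps_mem_adm_one hl).1 (by rwa [hr, hcard])
  rw [χ_compl_eq (card_pos.1 (by omega)) hl h1, hr, altSum, sum_range_succ,
    if_neg (notMem_of_lt hlt le_rfl), filter_lt_of_lt hlt, hd', hpar.neg_one_pow, one_mul, altSum]

/-- Inserting `0` raises all ranks by one, which is the effect of passing from `ε = 0` to `ε = 1`.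
The term at `0` is lost, but it vanishes by `hw`. -/
theorem altSum_insert_insert {D : Type*} [Ring D] (w : ℕ → D) (hw : w 0 = 0) {m d : ℕ}
    {J : Finset ℕ} (hJ : J ∈ adm 1 m d) :
    altSum w 0 (m + 1) (insert m (insert 0 J)) = altSum w 1 m J := by
  rw [altSum_insert, altSum, altSum]
  have h0 : 0 ∉ J := by
    intro h
    have := (mem_adm.1 hJ).2.2 0 h
    simp at this
  refine sum_congr rfl fun i _ => ?_
  rcases Nat.eq_zero_or_pos i with rfl | hi
  · simp [hw]
  · rw [filter_insert, if_pos hi, card_insert_of_notMem (by simp [h0])]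
    simp only [mem_insert, hi.ne', false_or, add_zero, add_assoc]

end Weights

/-! ### Cyclically ordered products compared with linearly ordered ones -/

section Products

open Finset

variable {l : ℕ}

theorem fRun_succ (i : ZMod (l + 1)) (m : ℕ) : fRun l i (m + 1) = f l i * fRun l (i + 1) m := by
  rw [fRun, List.range_succ_eq_map, List.map_cons, List.prod_cons, List.map_map, fRun,
    Nat.cast_zero, add_zero]
  congr 2
  refine List.map_congr_left fun r _ => ?_
  rw [Function.comp_apply, Nat.cast_succ, add_comm (r : ZMod (l + 1)), add_assoc]

theorem fRun_zero (i : ZMod (l + 1)) : fRun l i 0 = 1 := by simp [fRun]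

variable (l) in
/-- The generators `f_i`, indexed by representatives. -/
noncomputable def fNat (i : ℕ) : K l := f l (i : ZMod (l + 1))

/-- In `fProd` a component crossing the cut is attached to its start near `l`, so its part `P`
beginning at `0` stands at the far right. In `ordProd` that part stands at the far left. Multiplying
by `P` on opposite sides makes the two products agree letter by letter, with no commutation
relations; `P` is `1` when no component crosses. -/
theorem prefix_mul_fProd {J : Finset (ZMod (l + 1))} (hJ : ∃ y, y ∉ J) :
    (if (l : ZMod (l + 1)) ∈ J then fRun l 0 (runLength l J 0) else 1) * fProd l J =
      ordProd (fNat l) (l + 1) (reps l J) *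
        if (l : ZMod (l + 1)) ∈ J then fRun l 0 (runLength l J 0) else 1 := by
  have hneg : (0 : ZMod (l + 1)) - 1 = (l : ZMod (l + 1)) := by
    rw [sub_eq_iff_eq_add, natCast_succ_self]
  -- The partial product up to `m` contains whole components, so when `m - 1 ∈ J` it overshoots by
  -- the rest of the current component. The right-hand factor records that overshoot.
  have key : ∀ m ≤ l + 1,
      (if (l : ZMod (l + 1)) ∈ J then fRun l 0 (runLength l J 0) else 1) *
        ((List.range m).map fun i : ℕ =>
          if (i : ZMod (l + 1)) ∈ starts l J then fRun l i (runLength l J i) else 1).prod =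
      ordProd (fNat l) m (reps l J) *
        if (m : ZMod (l + 1)) - 1 ∈ J then fRun l m (runLength l J m) else 1 := by
    intro m hm
    induction m with
    | zero => simp [ordProd, hneg]
    | succ m ih =>
      rw [List.range_succ, List.map_append, List.prod_append, ← mul_assoc, ih (by omega),
        ordProd_succ, Nat.cast_succ, add_sub_cancel_right]
      simp only [mem_reps (show m < l + 1 by omega), List.map_cons, List.map_nil, List.prod_cons, List.prod_nil, mul_one, starts,
        mem_filter, mul_assoc]
      congr 1
      by_cases h1 : (m : ZMod (l + 1)) ∈ J
      · have h2 := runLength_of_mem hJ h1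
        by_cases h3 : (m : ZMod (l + 1)) - 1 ∈ J
        · simp [h1, h3, h2, fRun_succ, fNat]
        · simp [h1, h3, h2, fRun_succ, fNat]
      · simp [h1, runLength_of_notMem h1, fRun_zero]
  have := key (l + 1) le_rfl
  rwa [Nat.cast_succ, natCast_succ_self, hneg] at this

theorem fProd_eq_of_notMem {J : Finset (ZMod (l + 1))}
    (h : ¬ (0 ∈ J ∧ (l : ZMod (l + 1)) ∈ J)) :
    fProd l J = ordProd (fNat l) (l + 1) (reps l J) := by
  have hJ : ∃ y, y ∉ J := by
    by_contra hcon
    push Not at hcon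
    exact h ⟨hcon _, hcon _⟩
  have key := prefix_mul_fProd hJ
  split_ifs at key with h1
  · have h0 : (0 : ZMod (l + 1)) ∉ J := fun h0 => h ⟨h0, h1⟩
    rwa [runLength_of_notMem h0, fRun_zero, one_mul, mul_one] at key
  · rwa [one_mul, mul_one] at key

theorem range_eq_cons_append {r n : ℕ} (hr : 1 ≤ r) (hn : r < n) :
    List.range n = 0 :: (List.range' 1 (r - 1) ++ List.range' r (n - r)) := by
  obtain ⟨m, rfl⟩ := Nat.exists_eq_add_of_le' hr
  obtain ⟨k, rfl⟩ := Nat.exists_eq_add_of_lt hn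
  rw [List.range_eq_range', List.range'_succ, Nat.add_sub_cancel, add_comm m 1,
    List.range'_append_1]
  congr 2
  omega

/-- After cancelling the part of the crossing component that begins at `0`, the two orderings differ
only by the exchange of `f_l` and `f_0`. Its commutator `h` leaves the product over `J` without `0`
and `l`. -/
theorem fProd_eq_of_mem (hl : 2 ≤ l) {J : Finset (ZMod (l + 1))} (hJ : ∃ y, y ∉ J)
    (h0 : 0 ∈ J) (h1 : (l : ZMod (l + 1)) ∈ J) :
    fProd l J = ordProd (fNat l) (l + 1) (reps l J) +
      h l * ordProd (fNat l) l ((reps l J).erase 0) := by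
  have key := prefix_mul_fProd hJ
  rw [if_pos h1] at key
  have hr := add_runLength_notMem hJ 0
  have hlt := fun m => add_mem_of_lt_runLength (C := J) (x := 0) (m := m)
  have hpos := runLength_of_mem hJ h0
  set r := runLength l J 0 with hrdef
  rw [zero_add] at hr
  -- The initial run `0, …, r - 1` ends at an index `r` outside `J`, and `l ∈ J`; so `r` separates
  -- it from the remaining letters.
  have hrl : r < l := by
    obtain ⟨y, hy⟩ := hJ
    have h2 : r ≤ y.val := by
      by_contra hcon
      have := hlt y.val (by omega)
      rw [zero_add, natCast_val'] at this
      exact hy this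
    have h3 := val_lt' l y
    have h4 : r ≠ l := by
      intro h
      rw [h] at hr
      exact hr h1
    omega
  set φ : ℕ → K l := fun i => if i ∈ reps l J then fNat l i else 1 with hφ
  set Q : K l := ((List.range' r (l - r)).map φ).prod with hQ
  set B : K l := ((List.range' 1 (r - 1)).map φ).prod with hB
  have hφ0 : φ 0 = fNat l 0 := by
    simp only [hφ]
    rw [if_pos ((mem_reps (by omega)).2 (by simpa using h0))]
  have e1 : fRun l 0 r = fNat l 0 * B := by
    have : fRun l 0 r = ((List.range r).map φ).prod := by
      rw [fRun]
      congr 1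
      refine List.map_congr_left fun i hi => ?_
      have hi' := List.mem_range.1 hi
      have h2 := hlt i hi'
      rw [zero_add] at h2
      simp only [hφ]
      rw [if_pos ((mem_reps (by omega)).2 h2), zero_add, fNat]
    rw [this, List.range_eq_range', hB]
    obtain ⟨r', hr'⟩ : ∃ r', r = r' + 1 := ⟨_, hpos⟩
    rw [hr', List.range'_succ, List.map_cons, List.prod_cons, hφ0]
    rfl
  have e2 : ordProd (fNat l) (l + 1) (reps l J) = fNat l 0 * B * Q * fNat l l := by
    rw [ordProd_succ, if_pos ((mem_reps (by omega)).2 h1)]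
    congr 1
    rw [ordProd]
    rw [range_eq_cons_append (by omega) hrl, List.map_cons, List.prod_cons, List.map_append, List.prod_append, ← mul_assoc]
    congr 2
  have e3 : ordProd (fNat l) l ((reps l J).erase 0) = B * Q := by
    rw [ordProd]
    rw [range_eq_cons_append (by omega) hrl, List.map_cons, List.prod_cons, List.map_append, List.prod_append]
    rw [if_neg (by simp), one_mul]
    have hne : ∀ i : ℕ, 1 ≤ i → (if i ∈ (reps l J).erase 0 then fNat l i else 1) = φ i := by
      intro i hi
      simp only [hφ, mem_erase]
      rw [if_congr (and_iff_right (by omega)) rfl rfl]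
    congr 2
    · exact List.map_congr_left fun i hi => hne i (List.mem_range'_1.1 hi).1
    · exact List.map_congr_left fun i hi => hne i (by
        have := (List.mem_range'_1.1 hi).1; omega)
  -- Since `r ∉ J`, a letter of `J` at a position from `r` to `l - 1` is at least two steps away
  -- from each letter of the initial run, in both directions around the cycle.
  have cφ : ∀ i k : ℕ, k < r → r ≤ i → i < l → Commute (fNat l k) (φ i) := by
    intro i k hk hi hil
    simp only [hφ]
    split_ifs with h2
    · have : i ≠ r := by
        rintro rfl
        exact hr ((mem_reps (by omega)).1 h2)
      exact commute_f_f (by omega) (by omega)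
    · exact Commute.one_right _
  have cQ : ∀ k : ℕ, k < r → Commute (fNat l k) Q := by
    intro k hk
    refine Commute.list_prod_right _ _ fun y hy => ?_
    obtain ⟨i, hi, rfl⟩ := List.mem_map.1 hy
    have := List.mem_range'_1.1 hi
    exact cφ i k hk this.1 (by omega)
  have cB : ∀ y : K l, (∀ k, 1 ≤ k → k < r → Commute (fNat l k) y) → Commute B y := by
    intro y hy
    refine Commute.list_prod_left _ _ fun z hz => ?_
    obtain ⟨i, hi, rfl⟩ := List.mem_map.1 hz
    have := List.mem_range'_1.1 hi
    simp only [hφ]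
    split_ifs
    · exact hy i this.1 (by omega)
    · exact Commute.one_left _
  have cBQ : Commute B Q := cB Q fun k _ hk => cQ k hk
  have cBl : Commute B (fNat l l) := cB _ fun k h2 h3 => commute_f_f (by omega) (by omega)
  have c0 : fNat l l * fNat l 0 = fNat l 0 * fNat l l + h l := by
    have := f_mul_f_add_one hl (l : ZMod (l + 1))
    rw [natCast_succ_self] at this
    simpa [fNat] using this
  have hne : fNat l 0 * B ≠ 0 := by
    refine mul_ne_zero (f_ne_zero l _) (List.prod_ne_zero ?_)
    intro h
    obtain ⟨i, -, hi⟩ := List.mem_map.1 h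
    simp only [hφ] at hi
    split_ifs at hi
    · exact f_ne_zero l _ hi
    · exact one_ne_zero hi
  -- Cancelling `fNat l 0 * B` on the left uses that the skew field has no zero divisors. What
  -- remains is `Q * f_l * f_0 * B`, and only `f_l * f_0` has to be reordered with a correction.
  rw [e1, e2, mul_assoc _ Q, mul_assoc (fNat l 0 * B)] at key
  have key' := mul_left_cancel₀ hne key
  have hh := commute_h_center (B * Q)
  rw [key', e2, e3, mul_assoc Q, ← mul_assoc (fNat l l), c0, add_mul, mul_add]
  congr 1
  · rw [mul_assoc (fNat l 0), ← cBl.eq, ← mul_assoc Q, ← (cQ 0 (by omega)).eq, mul_assoc (fNat l 0),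
      ← mul_assoc Q, ← cBQ.eq]
    simp only [mul_assoc]
  · rw [← mul_assoc, ← (commute_h_center Q).eq, mul_assoc, cBQ.eq]

end Products

/-! ### The sums over `S_d` in the Hamiltonians, in terms of admissible sets -/

section Sums

open Finset

variable {l : ℕ}

theorem pos_of_mem_adm_one {m d i : ℕ} {J : Finset ℕ} (hJ : J ∈ adm 1 m d) (hi : i ∈ J) :
    0 < i := by
  rcases Nat.eq_zero_or_pos i with rfl | h
  · have := (mem_adm.1 hJ).2.2 0 hi
    simp at this
  · exact h

theorem insert_insert_mem_adm_iff {m d : ℕ} {J : Finset ℕ} (h : ∀ i ∈ J, 0 < i ∧ i < m)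
    (hm : 0 < m) : insert m (insert 0 J) ∈ adm 0 (m + 1) (d + 2) ↔ J ∈ adm 1 m d := by
  have h0 : 0 ∉ J := fun h' => (h 0 h').1.ne rfl
  have hmJ : m ∉ insert 0 J := by
    rw [mem_insert]
    rintro (h' | h')
    · omega
    · exact (h m h').2.ne rfl
  have hcount : ∀ i, 0 < i → i ≤ m →
      #{j ∈ insert m (insert 0 J) | j < i} = #{j ∈ J | j < i} + 1 := by
    intro i hi him
    rw [filter_insert_lt him, filter_insert, if_pos hi, card_insert_of_notMem (by simp [h0])]
  rw [mem_adm, mem_adm, card_insert_of_notMem hmJ, card_insert_of_notMem h0]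
  constructor
  · rintro ⟨⟨-, h2⟩, h3, h4⟩
    refine ⟨⟨fun i hi => (h i hi).2, by omega⟩, by grind, fun i hi => ?_⟩
    have h5 := h4 i (mem_insert_of_mem (mem_insert_of_mem hi))
    rw [hcount i (h i hi).1 (h i hi).2.le] at h5
    exact h5
  · rintro ⟨⟨h1, h2⟩, h3, h4⟩
    refine ⟨⟨fun i hi => ?_, by omega⟩, by grind, fun i hi => ?_⟩
    · rw [mem_insert, mem_insert] at hi
      rcases hi with rfl | rfl | hi
      · omega
      · omega
      · have := h1 i hi; omega
    · rw [mem_insert, mem_insert] at hi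
      rcases hi with rfl | rfl | hi
      · rw [hcount i hm le_rfl, filter_lt_of_lt h1, h2]
        grind
      · simp
      · rw [hcount i (h i hi).1 (h i hi).2.le]
        exact h4 i hi

/-- Removing both ends of an admissible set lowers the remaining ranks by one and hence switches `ε`
from `0` to `1`. This matches the reordering corrections of `fProd` with the term that `η`
contributes to `wheel`. -/
theorem sum_adm_both {M : Type*} [AddCommMonoid M] {m d : ℕ} (hm : 0 < m) (Φ : Finset ℕ → M) :
    ∑ J ∈ (adm 0 (m + 1) (d + 2)).filter (fun J => 0 ∈ J ∧ m ∈ J), Φ J =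
      ∑ J ∈ adm 1 m d, Φ (insert m (insert 0 J)) := by
  have hpos : ∀ J ∈ adm 1 m d, ∀ i ∈ J, 0 < i ∧ i < m := fun J hJ i hi =>
    ⟨pos_of_mem_adm_one hJ hi, (mem_adm.1 hJ).1.1 i hi⟩
  have hins : ∀ J : Finset ℕ, 0 ∈ J → m ∈ J → insert m (insert 0 ((J.erase m).erase 0)) = J := by
    intro J h0 hmJ
    rw [insert_erase (mem_erase.2 ⟨hm.ne, h0⟩), insert_erase hmJ]
  refine sum_bij' (fun J _ => (J.erase m).erase 0) (fun J _ => insert m (insert 0 J)) ?_ ?_ ?_ ?_ ?_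
  · intro J hJ
    obtain ⟨h1, h2, h3⟩ := mem_filter.1 hJ
    rw [← insert_insert_mem_adm_iff _ hm, hins J h2 h3]
    · exact h1
    · intro i hi
      rw [mem_erase, mem_erase] at hi
      have := (mem_adm.1 h1).1.1 i hi.2.2
      omega
  · intro J hJ
    rw [mem_filter, insert_insert_mem_adm_iff (hpos J hJ) hm]
    exact ⟨hJ, by simp, by simp⟩
  · intro J hJ
    obtain ⟨h1, h2, h3⟩ := mem_filter.1 hJ
    exact hins J h2 h3
  · intro J hJ
    have h0 : 0 ∉ J := fun h => (hpos J hJ 0 h).1.ne rfl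
    have hmJ : m ∉ insert 0 J := by
      rw [mem_insert]
      rintro (h | h)
      · omega
      · exact (hpos J hJ m h).2.ne rfl
    simp only [erase_insert hmJ, erase_insert h0]
  · intro J hJ
    obtain ⟨h1, h2, h3⟩ := mem_filter.1 hJ
    rw [hins J h2 h3]

theorem exists_notMem_of_card_lt {J : Finset (ZMod (l + 1))} (h : #J < l + 1) : ∃ y, y ∉ J := by
  by_contra hcon
  push Not at hcon
  have : J = univ := eq_univ_iff_forall.2 hcon
  rw [this, card_univ, ZMod.card] at h
  exact lt_irrefl _ h

theorem fProd_classes_zero (hl : 2 ≤ l) {d : ℕ} (hd : d ≤ l) {J : Finset ℕ}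
    (hJ : J ∈ adm 0 (l + 1) d) : fProd l (classes l J) = ordProd (fNat l) (l + 1) J +
      if 0 ∈ J ∧ l ∈ J then h l * ordProd (fNat l) l (J.erase 0) else 0 := by
  have hr := reps_classes (lt_of_mem_adm le_rfl hJ)
  have h0 : 0 ∈ J ↔ (0 : ZMod (l + 1)) ∈ classes l J := by
    rw [← hr, mem_reps (by omega), hr, Nat.cast_zero]
  have h1 : l ∈ J ↔ (l : ZMod (l + 1)) ∈ classes l J := by
    rw [← hr, mem_reps (by omega), hr]
  have hcard : #(classes l J) = d := by rw [← card_reps, hr]; exact (mem_adm.1 hJ).1.2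
  split_ifs with hb
  · rw [fProd_eq_of_mem hl (exists_notMem_of_card_lt (by omega)) (h0.1 hb.1) (h1.1 hb.2), hr]
  · rw [fProd_eq_of_notMem (by rwa [← h0, ← h1]), hr, add_zero]

theorem fProd_classes_one {d : ℕ} {J : Finset ℕ} (hJ : J ∈ adm 1 l d) :
    fProd l (classes l J) = ordProd (fNat l) l J := by
  have hr := reps_classes (lt_of_mem_adm (Nat.le_succ l) hJ)
  have h1 : l ∈ J ↔ (l : ZMod (l + 1)) ∈ classes l J := by
    rw [← hr, mem_reps (by omega), hr]
  have h2 : l ∉ J := notMem_of_lt (mem_adm.1 hJ).1.1 le_rfl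
  rw [fProd_eq_of_notMem (fun h => h2 (h1.2 h.2)), hr, ordProd_succ_of_notMem _ h2]

theorem sum_mul_fProd_zero (hl : 2 ≤ l) {d : ℕ} (hd : d + 2 ≤ l) (c : Finset ℕ → K l) :
    ∑ J ∈ adm 0 (l + 1) (d + 2), c J * fProd l (classes l J) =
      ∑ J ∈ adm 0 (l + 1) (d + 2), c J * ordProd (fNat l) (l + 1) J +
        ∑ J ∈ adm 1 l d, c (insert l (insert 0 J)) * (h l * ordProd (fNat l) l J) := by
  have h1 : ∀ J ∈ adm 0 (l + 1) (d + 2), c J * fProd l (classes l J) =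
      c J * ordProd (fNat l) (l + 1) J +
        if 0 ∈ J ∧ l ∈ J then c J * (h l * ordProd (fNat l) l (J.erase 0)) else 0 := by
    intro J hJ
    rw [fProd_classes_zero hl hd hJ, mul_add, mul_ite, mul_zero]
  rw [sum_congr rfl h1, sum_add_distrib, ← sum_filter, sum_adm_both (by omega)]
  congr 1
  refine sum_congr rfl fun J hJ => ?_
  congr 2
  refine ordProd_congr _ fun i hi => ?_
  have h0 : 0 ∉ J := fun h' => (pos_of_mem_adm_one hJ h').ne rfl
  rw [mem_erase, mem_insert, mem_insert]
  constructor
  · rintro ⟨h1, h2 | h2 | h2⟩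
    · omega
    · omega
    · exact h2
  · intro h2
    exact ⟨(pos_of_mem_adm_one hJ h2).ne', Or.inr (Or.inr h2)⟩

/-- The bound `d + 2 ≤ l` keeps the sets proper, so that products over components make sense; it
excludes `l = 2` and `l = 3` in the leading terms of the Hamiltonians. -/
theorem sum_S_fProd (hl : 2 ≤ l) {d : ℕ} (hd : d + 2 ≤ l) (hpar : Even (l + 1 + d)) :
    ∑ J ∈ S l (d + 2), fProd l J = admSum (fNat l) 0 (d + 2) (l + 1) +
      h l * admSum (fNat l) 1 d l + admSum (fNat l) 1 (d + 2) l := by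
  rw [sum_S (by omega) (by grind)]
  have h1 := sum_mul_fProd_zero hl hd fun _ => (1 : K l)
  simp only [one_mul] at h1
  rw [h1, ← mul_sum, admSum, admSum, admSum]
  congr 1
  exact sum_congr rfl fun J hJ => fProd_classes_one hJ

variable (l) in
/-- The fundamental weights, indexed by representatives. -/
noncomputable def ϖNat (i : ℕ) : K l := ϖ l (i : ZMod (l + 1))

theorem sum_χ_mul_fProd_one {d : ℕ} (hd : 1 ≤ d) :
    ∑ J ∈ adm 1 l d, χ l (classes l J)ᶜ * fProd l (classes l J) =
      admAltSum (fNat l) (ϖNat l) 1 d l + ϖNat l l * admSum (fNat l) 1 d l := by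
  rw [admAltSum, admSum, mul_sum, ← sum_add_distrib]
  refine sum_congr rfl fun J hJ => ?_
  rw [χ_classes_one hd hJ, fProd_classes_one hJ, add_mul]
  rfl

theorem sum_S_one (hl : 2 ≤ l) (hpar : Even l) : ∑ J ∈ S l 1, χ l Jᶜ * fProd l J =
    admAltSum (fNat l) (ϖNat l) 0 1 (l + 1) + admAltSum (fNat l) (ϖNat l) 1 1 l +
      ϖNat l l * admSum (fNat l) 1 1 l := by
  rw [sum_S le_rfl (by grind), sum_χ_mul_fProd_one le_rfl, admAltSum, add_assoc]
  congr 1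
  refine sum_congr rfl fun J hJ => ?_
  -- A single letter cannot cross the cut, so no correction in `h` arises.
  have hb : ¬ (0 ∈ J ∧ l ∈ J) := by
    rintro ⟨h0, h1⟩
    have := card_le_one.1 (mem_adm.1 hJ).1.2.le 0 h0 l h1
    omega
  rw [χ_classes_zero le_rfl hJ, fProd_classes_zero hl (by omega) hJ, if_neg hb, add_zero]
  rfl

/-- The only two-element set whose product crosses the cut is `{0, l}`. Reordering it produces `h`
times its coefficient χ, which is the alternating sum over the interior with `ε = 1`. -/
theorem sum_S_two (hl : 2 ≤ l) (hpar : Odd l) : ∑ J ∈ S l 2, χ l Jᶜ * fProd l J =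
    admAltSum (fNat l) (ϖNat l) 0 2 (l + 1) + h l * admAltSum (fNat l) (ϖNat l) 1 0 l +
      admAltSum (fNat l) (ϖNat l) 1 2 l + ϖNat l l * admSum (fNat l) 1 2 l := by
  have hw : ϖNat l 0 = 0 := by rw [ϖNat, Nat.cast_zero, ϖ_zero]
  rw [sum_S (by omega) (by grind), sum_χ_mul_fProd_one (by omega), add_assoc _ (admAltSum _ _ 1 2 l)]
  congr 1
  have h1 : ∑ J ∈ adm 0 (l + 1) 2, χ l (classes l J)ᶜ * fProd l (classes l J) =
      ∑ J ∈ adm 0 (l + 1) 2, altSum (ϖNat l) 0 (l + 1) J * fProd l (classes l J) :=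
    sum_congr rfl fun J hJ => by rw [χ_classes_zero (by omega) hJ]; rfl
  rw [h1, sum_mul_fProd_zero hl (d := 0) (by omega), admAltSum, admAltSum, mul_sum]
  congr 1
  refine sum_congr rfl fun J hJ => ?_
  rw [altSum_insert_insert _ hw hJ, ← mul_assoc, ← mul_assoc, (commute_h_center _).eq]

end Sums

/-! ### The constant term as a sum over the two perfect matchings of an even cycle -/

section Quadratic

open Finset

variable {D : Type*} [Ring D]

theorem admSum_zero_eq_one (f : ℕ → D) {ε m : ℕ} (h : Even (m + ε)) : admSum f ε 0 m = 1 := by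
  rw [admSum, adm_zero, if_pos h, sum_singleton, ordProd_empty]

theorem admAltSum_zero_even (f w : ℕ → D) (p : ℕ) :
    admAltSum f w 0 0 (2 * p) = ∑ r ∈ range p, (w (2 * r) - w (2 * r + 1)) := by
  induction p with
  | zero => simp [admAltSum, adm_zero, altSum]
  | succ p ih =>
    rw [show 2 * (p + 1) = 2 * p + 2 by ring, admAltSum_zero, ih, sum_range_succ,
      admSum_zero_eq_one f (by simp), mul_one]

theorem admAltSum_zero_odd (f w : ℕ → D) (hw : w 0 = 0) (p : ℕ) :
    admAltSum f w 1 0 (2 * p + 1) = ∑ r ∈ range p, (w (2 * r + 1) - w (2 * r + 2)) := by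
  induction p with
  | zero => simp [admAltSum, adm_zero, altSum, hw]
  | succ p ih =>
    rw [show 2 * (p + 1) + 1 = 2 * p + 1 + 2 by ring, admAltSum_zero, ih, sum_range_succ,
      admSum_zero_eq_one f (by grind), mul_one]

/-- `admQuad` is the second elementary symmetric function of the weight differences over the
matching `{0,1}, {2,3}, …`, so this is the usual relation with the power sums. -/
theorem two_mul_admQuad_even (w : ℕ → D) (hc : ∀ i x, Commute (w i) x) (p : ℕ) :
    2 * admQuad w 0 (2 * p) + ∑ r ∈ range p, (w (2 * r) - w (2 * r + 1)) ^ 2 =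
      (∑ r ∈ range p, (w (2 * r) - w (2 * r + 1))) ^ 2 := by
  induction p with
  | zero => simp [admQuad]
  | succ p ih =>
    have h1 : Commute (w (2 * p) - w (2 * p + 1)) (∑ r ∈ range p, (w (2 * r) - w (2 * r + 1))) :=
      (hc _ _).sub_left (hc _ _)
    rw [sum_range_succ, sum_range_succ, show 2 * (p + 1) = 2 * p + 2 by ring, admQuad,
      sum_altSum_eq w, admAltSum_zero_even, h1.symm.add_sq, ← ih, mul_add, mul_assoc 2, ← h1.eq]
    abel

theorem two_mul_admQuad_odd (w : ℕ → D) (hw : w 0 = 0) (hc : ∀ i x, Commute (w i) x) (p : ℕ) :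
    2 * admQuad w 1 (2 * p + 1) + ∑ r ∈ range p, (w (2 * r + 1) - w (2 * r + 2)) ^ 2 =
      (∑ r ∈ range p, (w (2 * r + 1) - w (2 * r + 2))) ^ 2 := by
  induction p with
  | zero => simp [admQuad]
  | succ p ih =>
    have h1 : Commute (w (2 * p + 1) - w (2 * p + 2))
        (∑ r ∈ range p, (w (2 * r + 1) - w (2 * r + 2))) := (hc _ _).sub_left (hc _ _)
    rw [sum_range_succ, sum_range_succ, show 2 * (p + 1) + 1 = 2 * p + 1 + 2 by ring, admQuad,
      sum_altSum_eq w, admAltSum_zero_odd _ _ hw, h1.symm.add_sq, ← ih, mul_add, mul_assoc 2,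
      ← h1.eq]
    abel

theorem sum_Icc_alternating (w : ℕ → D) (n : ℕ) :
    ∑ i ∈ Icc 1 (2 * n + 1), (-1) ^ (i - 1) * w i =
      ∑ r ∈ range n, (w (2 * r + 1) - w (2 * r + 2)) + w (2 * n + 1) := by
  induction n with
  | zero => simp
  | succ n ih =>
    rw [show 2 * (n + 1) + 1 = 2 * n + 1 + 1 + 1 by ring, sum_Icc_succ_top (by omega),
      sum_Icc_succ_top (by omega), ih, sum_range_succ]
    have h1 : (-1 : D) ^ (2 * n + 1 + 1 - 1) = -1 := by
      rw [Nat.add_sub_cancel]; exact Odd.neg_one_pow (by simp)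
    have h2 : (-1 : D) ^ (2 * n + 1 + 1 + 1 - 1) = 1 := by
      rw [Nat.add_sub_cancel]; exact Even.neg_one_pow (by grind)
    rw [h1, h2]
    noncomm_ring

theorem sum_range_alternating (w : ℕ → D) (n : ℕ) :
    ∑ r ∈ range (n + 1), (w (2 * r) - w (2 * r + 1)) =
      w 0 - (∑ r ∈ range n, (w (2 * r + 1) - w (2 * r + 2)) + w (2 * n + 1)) := by
  induction n with
  | zero => simp
  | succ n ih =>
    rw [sum_range_succ, ih, sum_range_succ, show 2 * (n + 1) = 2 * n + 2 by ring]
    abel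

theorem sum_range_even_odd (g : ℕ → D) (n : ℕ) : ∑ i ∈ range (2 * n + 1), g i =
    ∑ r ∈ range (n + 1), g (2 * r) + ∑ r ∈ range n, g (2 * r + 1) := by
  induction n with
  | zero => simp
  | succ n ih =>
    rw [show 2 * (n + 1) + 1 = 2 * n + 1 + 1 + 1 by ring, sum_range_succ, sum_range_succ, ih,
      sum_range_succ _ (n + 1), sum_range_succ _ n, sum_range_succ (fun r => g (2 * r + 1))]
    rw [show 2 * (n + 1) = 2 * n + 1 + 1 by ring]
    abel

/-- The cycle has two perfect matchings, and the weight differences over each sum to plus or minus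
the alternating sum in the constant term. Adding both square expansions gives twice its square;
every edge of the cycle lies in exactly one matching, so all squared differences appear once. The
edge `{l, 0}` has weight difference `w l`, because `w 0 = 0`. -/
theorem two_mul_sq_sum_alternating (f w : ℕ → D) (hw : w 0 = 0) (hc : ∀ i x, Commute (w i) x)
    (n : ℕ) : 2 * (∑ i ∈ Icc 1 (2 * n + 1), (-1) ^ (i - 1) * w i) ^ 2 =
      2 * (admQuad w 0 (2 * n + 1 + 1) + admQuad w 1 (2 * n + 1) +
        w (2 * n + 1) * admAltSum f w 1 0 (2 * n + 1)) +
      (w (2 * n + 1) ^ 2 + ∑ i ∈ range (2 * n + 1), (w i - w (i + 1)) ^ 2) := by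
  have q0 := two_mul_admQuad_even w hc (n + 1)
  have q1 := two_mul_admQuad_odd w hw hc n
  rw [sum_range_alternating, hw, zero_sub, neg_sq] at q0
  rw [sum_Icc_alternating, admAltSum_zero_odd _ _ hw,
    sum_range_even_odd fun i => (w i - w (i + 1)) ^ 2]
  set B := ∑ r ∈ range n, (w (2 * r + 1) - w (2 * r + 2))
  have hsq : (B + w (2 * n + 1)) ^ 2 = B ^ 2 + 2 * (w (2 * n + 1) * B) + w (2 * n + 1) ^ 2 := by
    rw [(hc (2 * n + 1) B).symm.add_sq, mul_assoc, ← (hc (2 * n + 1) B).eq]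
  rw [two_mul ((B + w (2 * n + 1)) ^ 2)]
  -- One copy of the square is kept for the matching `{0,1}, {2,3}, …`; the other is split so as to
  -- isolate the edge `{l, 0}` of the second matching.
  nth_rewrite 2 [hsq]
  rw [← q0, ← q1, show 2 * (n + 1) = 2 * n + 1 + 1 by ring]
  simp only [mul_add]
  abel

end Quadratic

/-! ### The Hamiltonian as a coefficient of the cyclic continuant -/

section Wheel

open Polynomial

theorem commute_C_mul_X_pow {D : Type*} [Ring D] {z : D} (hz : ∀ x, Commute z x) (n : ℕ)
    (p : D[X]) : Commute (C z * X ^ n) p := by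
  have h1 : Commute (C z) p := by
    refine Polynomial.ext fun m => ?_
    rw [coeff_C_mul, coeff_mul_C, (hz _).eq]
  exact h1.mul_left (commute_X_pow p n)

variable {l : ℕ}

theorem commute_ϖ (i : ZMod (l + 1)) (x : K l) : Commute (ϖ l i) x :=
  Commute.sum_left _ _ _ fun _ _ => (commute_α_center _ x).smul_left _

variable (l) in
/-- The differences `ϖ_{i-1} - ϖ_i`. -/
noncomputable def wt (i : ZMod (l + 1)) : K l := ϖ l (i - 1) - ϖ l i

theorem commute_wt (i : ZMod (l + 1)) (x : K l) : Commute (wt l i) x :=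
  (commute_ϖ _ x).sub_left (commute_ϖ _ x)

theorem wt_succ (m : ℕ) : wt l ((m + 1 : ℕ) : ZMod (l + 1)) = ϖNat l m - ϖNat l (m + 1) := by
  rw [wt, ϖNat, ϖNat, Nat.cast_succ, add_sub_cancel_right]

theorem wt_zero : wt l 0 = ϖNat l l := by
  rw [wt, ϖ_zero, sub_zero, ϖNat, ← natCast_succ_self, add_sub_cancel_right]

theorem ϖNat_zero : ϖNat l 0 = 0 := by rw [ϖNat, Nat.cast_zero, ϖ_zero]

variable (l) in
/-- The generators in degree one. -/
noncomputable def polyF (i : ℕ) : (K l)[X] := C (fNat l i) * X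

variable (l) in
/-- The weights of the adjacent pairs. -/
noncomputable def polyZ (i : ℕ) : (K l)[X] := 1 + C (wt l (i : ZMod (l + 1))) * X ^ 2

variable (l) in
/-- The commutator of adjacent generators in degree two. -/
noncomputable def polyη : (K l)[X] := C (h l) * X ^ 2

theorem isCyclic_poly (hl : 2 ≤ l) : IsCyclic (polyF l) (polyZ l) (polyη l) l where
  Z_comm i x := (Commute.one_left x).add_left (commute_C_mul_X_pow (commute_wt _) 2 x)
  η_comm x := commute_C_mul_X_pow commute_h_center 2 x
  F_period i := by
    rw [polyF, fNat, Nat.cast_add, ZMod.natCast_self, add_zero, polyF, fNat]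
  Z_period i := by
    rw [polyZ, Nat.cast_add, ZMod.natCast_self, add_zero, polyZ]
  adj i := by
    have h1 := f_mul_f_add_one hl (i : ZMod (l + 1))
    rw [polyF, polyF, polyη, mul_assoc, ← mul_assoc X, X_mul_C, mul_assoc, mul_assoc, ← mul_assoc X,
      X_mul_C, mul_assoc, ← mul_assoc, ← mul_assoc (C _) (C _), ← C_mul, ← C_mul, ← sq, ← add_mul,
      ← C_add, fNat, fNat, Nat.cast_succ, h1]
  comm i j h1 h2 := by
    have h3 : Commute (C (fNat l i)) (C (fNat l j)) := (commute_f_f h1 h2).map C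
    exact (h3.mul_right (commute_X _).symm).mul_left (commute_X _)

theorem polyZ_succ (m : ℕ) : polyZ l (m + 1) = 1 + C (ϖNat l m - ϖNat l (m + 1)) * X ^ 2 := by
  rw [polyZ, wt_succ]

/-- The continuant on the letters `0, …, m - 1`, which corresponds to `ε = 0`; the length argument
of `cont` exceeds the number of letters by one. -/
theorem coeff_cont_zero (hl : 2 ≤ l) (m : ℕ) :
    (cont (polyF l) (polyZ l) 0 (m + 1)).coeff 0 = admSum (fNat l) 0 0 m ∧
      (cont (polyF l) (polyZ l) 0 (m + 1)).coeff 1 = admSum (fNat l) 0 1 m ∧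
      (cont (polyF l) (polyZ l) 0 (m + 1)).coeff 2 =
        admSum (fNat l) 0 2 m + admAltSum (fNat l) (ϖNat l) 0 0 m ∧
      (cont (polyF l) (polyZ l) 0 (m + 1)).coeff 3 =
        admSum (fNat l) 0 3 m + admAltSum (fNat l) (ϖNat l) 0 1 m ∧
      (cont (polyF l) (polyZ l) 0 (m + 1)).coeff 4 =
        admSum (fNat l) 0 4 m + admAltSum (fNat l) (ϖNat l) 0 2 m + admQuad (ϖNat l) 0 m :=
  coeff_of_recursion (fNat l) (ϖNat l) ϖNat_zero 0 (fun m => cont (polyF l) (polyZ l) 0 (m + 1))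
    (fun m => by
      rw [← polyZ_succ, show m + 2 + 1 = m + 1 + 2 by ring, cont_add_two' (isCyclic_poly hl).Z_comm,
        zero_add]
      rfl)
    (Or.inl ⟨rfl, by simp, by simp [cont_add_two, polyF]⟩) m

/-- The continuant on the letters `1, …, m - 1`, used after the pair `{l, 0}` has been deleted; it
corresponds to `ε = 1`. -/
theorem coeff_cont_one (hl : 2 ≤ l) (m : ℕ) :
    (cont (polyF l) (polyZ l) 1 m).coeff 0 = admSum (fNat l) 1 0 m ∧
      (cont (polyF l) (polyZ l) 1 m).coeff 1 = admSum (fNat l) 1 1 m ∧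
      (cont (polyF l) (polyZ l) 1 m).coeff 2 =
        admSum (fNat l) 1 2 m + admAltSum (fNat l) (ϖNat l) 1 0 m ∧
      (cont (polyF l) (polyZ l) 1 m).coeff 3 =
        admSum (fNat l) 1 3 m + admAltSum (fNat l) (ϖNat l) 1 1 m ∧
      (cont (polyF l) (polyZ l) 1 m).coeff 4 =
        admSum (fNat l) 1 4 m + admAltSum (fNat l) (ϖNat l) 1 2 m + admQuad (ϖNat l) 1 m :=
  coeff_of_recursion (fNat l) (ϖNat l) ϖNat_zero 1 (fun m => cont (polyF l) (polyZ l) 1 m)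
    (fun m => by
      rw [← polyZ_succ, cont_add_two' (isCyclic_poly hl).Z_comm, add_comm 1 m]
      rfl)
    (Or.inr ⟨rfl, by simp, by simp⟩) m

variable (l) in
/-- The cyclic continuant of the generators. -/
noncomputable def polyWheel : (K l)[X] := wheel (polyF l) (polyZ l) (polyη l) l 0

theorem polyWheel_coeff (r : ℕ) : (polyWheel l).coeff (r + 2) =
    (cont (polyF l) (polyZ l) 0 (l + 2)).coeff (r + 2) +
      ((cont (polyF l) (polyZ l) 1 l).coeff (r + 2) +
        (ϖNat l l + h l) * (cont (polyF l) (polyZ l) 1 l).coeff r) := by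
  have h1 : polyZ l 0 + polyη l = 1 + C (ϖNat l l + h l) * X ^ 2 := by
    rw [polyZ, polyη, Nat.cast_zero, wt_zero, C_add, add_mul, add_assoc]
  rw [polyWheel, wheel, h1, zero_add, add_mul, one_mul, mul_assoc, (commute_X_pow _ 2).eq,
    ← mul_assoc, coeff_add, coeff_add, coeff_mul_X_pow, coeff_C_mul]

theorem coeff_three_polyWheel (hl : 2 ≤ l) : (polyWheel l).coeff 3 =
    admSum (fNat l) 0 3 (l + 1) + admAltSum (fNat l) (ϖNat l) 0 1 (l + 1) +
      (admSum (fNat l) 1 3 l + admAltSum (fNat l) (ϖNat l) 1 1 l +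
        (ϖNat l l + h l) * admSum (fNat l) 1 1 l) := by
  have h0 := coeff_cont_zero hl (l + 1)
  have h1 := coeff_cont_one hl l
  rw [polyWheel_coeff, h0.2.2.2.1, h1.2.1, h1.2.2.2.1]

theorem coeff_four_polyWheel (hl : 2 ≤ l) : (polyWheel l).coeff 4 =
    admSum (fNat l) 0 4 (l + 1) + admAltSum (fNat l) (ϖNat l) 0 2 (l + 1) +
        admQuad (ϖNat l) 0 (l + 1) +
      (admSum (fNat l) 1 4 l + admAltSum (fNat l) (ϖNat l) 1 2 l + admQuad (ϖNat l) 1 l +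
        (ϖNat l l + h l) * (admSum (fNat l) 1 2 l + admAltSum (fNat l) (ϖNat l) 1 0 l)) := by
  have h0 := coeff_cont_zero hl (l + 1)
  have h1 := coeff_cont_one hl l
  rw [polyWheel_coeff, h0.2.2.2.2, h1.2.2.1, h1.2.2.2.2]

theorem H₀_even (hl : 2 ≤ l) (hpar : Even l) : H₀ l = (polyWheel l).coeff 3 := by
  rw [coeff_three_polyWheel hl, H₀]
  split_ifs with h2
  -- All three letters are kept in the leading term, so there is no proper subset to take a cyclic
  -- product of. The explicit summand `h f_1` is the `η` term of the wheel.
  · subst h2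
    have e1 : admSum (fNat 2) 0 3 (2 + 1) = f 2 0 * f 2 1 * f 2 2 := by
      rw [admSum, show adm 0 3 3 = {{0, 1, 2}} by decide]
      simp [ordProd, List.range_succ, fNat, mul_assoc]
    have e2 : admSum (fNat 2) 1 3 2 = 0 := by simp [admSum, adm_eq_empty]
    have e3 : admSum (fNat 2) 1 1 2 = f 2 1 := by
      rw [admSum, show adm 1 2 1 = {{1}} by decide]
      simp [ordProd, List.range_succ, fNat]
    rw [sum_S_one hl hpar, e1, e2, e3, add_mul, zero_add]
    abel
  · rw [sum_S_fProd hl (by grind) (by grind), sum_S_one hl hpar, add_mul]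
    abel

/-- The empty set in degree four contributes the three quadratic expressions; what separates them
from the constant term of `H₀` is half the sum of all squared weight differences. -/
theorem constTerm_eq {n : ℕ} (hln : l = 2 * n + 1) : constTerm l =
    admQuad (ϖNat l) 0 (l + 1) + admQuad (ϖNat l) 1 l +
      ϖNat l l * admAltSum (fNat l) (ϖNat l) 1 0 l + (1 / 2 : ℂ) • ∑ i, wt l i ^ 2 := by
  have h0 := two_mul_sq_sum_alternating (fNat l) (ϖNat l) ϖNat_zero (fun i x => commute_ϖ _ x) n
  have hsum : ∑ i, wt l i ^ 2 = ϖNat l l ^ 2 +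
      ∑ i ∈ Finset.range l, (ϖNat l i - ϖNat l (i + 1)) ^ 2 := by
    rw [sum_zmod_eq_sum_range, Finset.sum_range_succ', Nat.cast_zero, wt_zero, add_comm]
    simp only [wt_succ]
  have hconst : constTerm l = (∑ i ∈ Finset.Icc 1 l, (-1) ^ (i - 1) * ϖNat l i) ^ 2 := rfl
  rw [← hln, ← hconst, ← hsum, two_mul, two_mul, ← two_smul ℂ, ← two_smul ℂ (_ + _)] at h0
  have h1 : constTerm l = (1 / 2 : ℂ) • (2 : ℂ) • constTerm l := by
    rw [smul_smul]; norm_num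
  rw [h1, h0, smul_add, smul_smul]
  norm_num

theorem H₀_odd (hl : 2 ≤ l) (hodd : Odd l) : H₀ l = (polyWheel l).coeff 4 +
    (1 / 2 : ℂ) • ∑ i, wt l i ^ 2 := by
  obtain ⟨n, hn⟩ := hodd
  have hodd : Odd l := ⟨n, hn⟩
  rw [coeff_four_polyWheel hl, H₀, if_neg (by omega), if_neg (Nat.not_even_iff_odd.2 hodd),
    constTerm_eq hn]
  split_ifs with h3
  -- As for `l = 2`, the leading term keeps every letter, and `h f_1 f_2` is the `η` term of the
  -- wheel.
  · subst h3
    have e1 : admSum (fNat 3) 0 4 (3 + 1) = f 3 0 * f 3 1 * f 3 2 * f 3 3 := by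
      rw [admSum, show adm 0 (3 + 1) 4 = {{0, 1, 2, 3}} by decide]
      simp [ordProd, List.range_succ, fNat, mul_assoc]
    have e2 : admSum (fNat 3) 1 4 3 = 0 := by simp [admSum, adm_eq_empty]
    have e3 : admSum (fNat 3) 1 2 3 = f 3 1 * f 3 2 := by
      rw [admSum, show adm 1 3 2 = {{1, 2}} by decide]
      simp [ordProd, List.range_succ, fNat]
    rw [sum_S_two hl hodd, e1, e2, e3]
    simp only [add_mul, mul_add, zero_add, mul_assoc]
    abel
  · rw [sum_S_fProd hl (by grind) (by grind), sum_S_two hl hodd]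
    simp only [add_mul, mul_add]
    abel

end Wheel

/-! ### Action of the reflections on the weight differences -/

section Reflection

open Finset

variable {l : ℕ}

theorem add_one_ne (hl : 1 ≤ l) (i : ZMod (l + 1)) : i + 1 ≠ i := by
  intro h
  have h1 := natCast_ne (l := l) (a := 0) (b := 1) (by omega) (by omega)
  rw [Nat.cast_zero, Nat.cast_one] at h1
  exact h1 (add_eq_left.1 h).symm

theorem add_one_ne_sub_one (hl : 2 ≤ l) (i : ZMod (l + 1)) : i + 1 ≠ i - 1 := by
  intro h
  have h1 := u_add_one hl i
  rw [u, if_pos rfl, if_pos h, sub_self] at h1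
  exact zero_ne_one h1

/-- Written with indicator functions, an entry becomes a second difference, which can be summed and
telescoped without case distinctions. The bound on `l` keeps the two neighbours distinct. -/
theorem cartan_eq (hl : 2 ≤ l) (i j : ZMod (l + 1)) : cartan l i j =
    2 * (if j = i then 1 else 0) - (if j = i + 1 then 1 else 0) - if j + 1 = i then 1 else 0 := by
  have h1 := add_one_ne (by omega : 1 ≤ l) i
  have h2 := add_one_ne (by omega : 1 ≤ l) (i - 1)
  have h3 := add_one_ne_sub_one hl i
  rw [sub_add_cancel] at h2
  have h4 : j + 1 = i ↔ j = i - 1 := eq_sub_iff_add_eq.symm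
  simp only [cartan, h4]
  by_cases e1 : j = i
  · subst e1
    simp [h1.symm, h2]
  · by_cases e2 : j = i + 1
    · subst e2
      simp [h1, h3]
    · by_cases e3 : j = i - 1
      · subst e3
        simp [h2.symm, h3.symm]
      · simp [e1, e2, e3]

theorem sum_cartan (hl : 2 ≤ l) (i : ZMod (l + 1)) : ∑ j, cartan l i j = 0 := by
  have h4 : ∀ j, j + 1 = i ↔ j = i - 1 := fun j => eq_sub_iff_add_eq.symm
  simp only [cartan_eq hl, h4, sum_sub_distrib, ← mul_sum, sum_ite_eq', mem_univ, if_true]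
  norm_num

theorem s_k (hl : 2 ≤ l) (i : ZMod (l + 1)) : s l i (k l) = k l := by
  rw [k, map_sum]
  simp only [s_α]
  rw [sum_sub_distrib, ← sum_smul, sum_cartan hl, zero_smul, sub_zero]

/-- The explicit formula vanishes at `a = l + 1`, in agreement with `ϖ 0 = 0`. This lets the second
difference at `l` be computed without wrapping. -/
theorem ϖ_natCast {a : ℕ} (ha : a ≤ l + 1) : ϖ l (a : ZMod (l + 1)) =
    ∑ r ∈ Icc 1 l, ((min a r : ℕ) - (a * r : ℂ) / (l + 1)) • α l (r : ZMod (l + 1)) := by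
  rcases Nat.lt_or_ge a (l + 1) with h | h
  · rw [ϖ, val_natCast' l h]
  · obtain rfl : a = l + 1 := le_antisymm ha h
    rw [ZMod.natCast_self, ϖ_zero]
    symm
    refine sum_eq_zero fun r hr => ?_
    have h1 : min (l + 1) r = r := min_eq_right (by have := (mem_Icc.1 hr).2; omega)
    have h2 : (l + 1 : ℂ) ≠ 0 := by exact_mod_cast Nat.succ_ne_zero l
    rw [h1]
    push_cast
    rw [mul_comm, mul_div_assoc, div_self h2, mul_one, sub_self, zero_smul]

/-- Negated second difference of `ϖ`: the linear terms drop out, and `min` has a kink only at `r =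
a`. -/
theorem wt_sub_of_pos {a : ℕ} (h1 : 1 ≤ a) (h2 : a ≤ l) :
    wt l ((a : ZMod (l + 1)) + 1) - wt l a = α l a := by
  obtain ⟨b, rfl⟩ := Nat.exists_eq_add_of_le' h1
  have e0 : wt l (((b + 1 : ℕ) : ZMod (l + 1)) + 1) =
      wt l ((b + 1 + 1 : ℕ) : ZMod (l + 1)) := by rw [Nat.cast_succ (b + 1)]
  rw [e0, wt_succ, wt_succ, ϖNat, ϖNat, ϖNat, ϖ_natCast (by omega), ϖ_natCast (by omega),
    ϖ_natCast (by omega), ← sum_sub_distrib, ← sum_sub_distrib, ← sum_sub_distrib,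
    sum_eq_single_of_mem (b + 1) (mem_Icc.2 ⟨h1, h2⟩)]
  · rw [← sub_smul, ← sub_smul, ← sub_smul, min_self, min_eq_left (by omega : b ≤ b + 1),
      min_eq_right (by omega : b + 1 ≤ b + 1 + 1)]
    push_cast
    convert one_smul ℂ _ using 2
    ring
  · intro r _ hr
    rw [← sub_smul, ← sub_smul, ← sub_smul]
    convert zero_smul ℂ _ using 2
    rcases Nat.lt_or_gt_of_ne hr with h | h
    · rw [min_eq_right (by omega : r ≤ b + 1), min_eq_right (by omega : r ≤ b + 1 + 1),
        min_eq_right (by omega : r ≤ b)]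
      push_cast
      ring
    · rw [min_eq_left (by omega : b + 1 ≤ r), min_eq_left (by omega : b + 1 + 1 ≤ r),
        min_eq_left (by omega : b ≤ r)]
      push_cast
      ring

/-- At `i = 0` the value is forced: the differences sum to zero around the cycle, so it is minus the
sum of the other `α`, that is `α 0 - k`. This is the only place where `k` enters for `l ≥ 2`, and it
singles out `s_0`. -/
theorem wt_sub (i : ZMod (l + 1)) :
    wt l (i + 1) - wt l i = α l i - if i = 0 then k l else 0 := by
  have hne : ∀ i : ZMod (l + 1), i ≠ 0 → wt l (i + 1) - wt l i = α l i := by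
    intro i hi
    have h1 := val_lt' l i
    have h2 : i.val ≠ 0 := fun h => hi ((ZMod.val_eq_zero i).1 h)
    have h3 := wt_sub_of_pos (l := l) (a := i.val) (by omega) (by omega)
    rwa [natCast_val'] at h3
  split_ifs with hi
  · subst hi
    have h1 : ∑ x, (wt l (x + 1) - wt l x) = 0 := by
      rw [sum_sub_distrib, sum_add_one l (wt l), sub_self]
    rw [← add_sum_erase univ _ (mem_univ 0),
      sum_congr rfl fun x hx => hne x (ne_of_mem_erase hx)] at h1
    rw [k, ← add_sum_erase univ (α l) (mem_univ 0), eq_neg_of_add_eq_zero_left h1]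
    abel
  · rw [hne i hi, sub_zero]

theorem sum_wt : ∑ i, wt l i = 0 := by
  have h1 := sum_add_one l fun i => wt l i
  have h2 : ∑ i, wt l (i + 1) = ∑ i, ϖ l i - ∑ i, ϖ l (i + 1) := by
    rw [← sum_sub_distrib]
    exact sum_congr rfl fun i _ => by rw [wt, add_sub_cancel_right]
  rw [← h1, h2, sum_add_one l (ϖ l), sub_self]

/-- The consecutive differences of `wt` are known, so the error in the claimed formula is the same
for all `j`. Its sum over the cycle is zero because the `wt` sum to zero, and division by `l + 1`
shows that it vanishes; the fractions in the definition of `ϖ` play no part. -/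
theorem s_wt (hl : 2 ≤ l) (i j : ZMod (l + 1)) : s l i (wt l j) =
    wt l j + ((if j = i then (1 : ℂ) else 0) - if j = i + 1 then 1 else 0) • α l i := by
  set c : ZMod (l + 1) → ℂ := fun j => (if j = i then (1 : ℂ) else 0) - if j = i + 1 then 1 else 0
    with hc
  set E : ZMod (l + 1) → K l := fun j => s l i (wt l j) - wt l j - c j • α l i with hE
  have hstep : ∀ j, E (j + 1) = E j := by
    intro j
    have h1 : s l i (wt l (j + 1)) - s l i (wt l j) =
        wt l (j + 1) - wt l j - cartan l i j • α l i := by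
      rw [← map_sub, wt_sub, map_sub, s_α, apply_ite (s l i), s_k hl, map_zero]
      abel
    have h2 : c (j + 1) - c j = - cartan l i j := by
      simp only [hc, cartan_eq hl, add_left_inj]
      ring
    have h3 : E (j + 1) - E j = (s l i (wt l (j + 1)) - s l i (wt l j)) -
        (wt l (j + 1) - wt l j) - (c (j + 1) - c j) • α l i := by
      simp only [hE, sub_smul]
      abel
    rw [← sub_eq_zero, h3, h1, h2, neg_smul]
    abel
  have hsum : ∑ j, E j = 0 := by
    simp only [hE, sum_sub_distrib, ← map_sum, sum_wt, ← sum_smul, map_zero, hc, sum_ite_eq',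
      mem_univ, if_true, sub_self, zero_smul]
  have hconst : ∑ x, E x = (l + 1) • E j := by
    rw [sum_congr rfl fun x _ => eq_of_forall_add_one l hstep x j, sum_const, card_univ, ZMod.card]
  rw [hsum, ← Nat.cast_smul_eq_nsmul ℂ] at hconst
  have h0 : E j = 0 := (smul_eq_zero.1 hconst.symm).resolve_left
    (by exact_mod_cast Nat.succ_ne_zero l)
  rw [← sub_eq_zero, ← h0]
  simp only [hE]
  abel

/-- Only two squares change, with `wt i` raised and `wt (i + 1)` lowered by `α i`. The total change
is `2 α_i (α_i - (wt_{i+1} - wt_i))`, which `wt_sub` evaluates. -/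
theorem s_sum_wt_sq (hl : 2 ≤ l) (i : ZMod (l + 1)) : s l i (∑ j, wt l j ^ 2) =
    ∑ j, wt l j ^ 2 + 2 * (α l i * if i = 0 then k l else 0) := by
  have hne := add_one_ne (by omega : 1 ≤ l) i
  have h1 : ∀ j, s l i (wt l j ^ 2) = wt l j ^ 2 +
      (if j = i then 2 * (α l i * wt l i) + α l i ^ 2 else 0) +
      if j = i + 1 then α l i ^ 2 - 2 * (α l i * wt l (i + 1)) else 0 := by
    intro j
    rw [map_pow, s_wt hl]
    by_cases e1 : j = i
    · subst e1
      rw [if_pos rfl, if_neg hne.symm, if_pos rfl, if_neg hne.symm, sub_zero, one_smul, add_zero,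
        (commute_wt _ _).add_sq, mul_assoc, (commute_wt _ _).eq, add_assoc]
    · by_cases e2 : j = i + 1
      · subst e2
        rw [if_neg hne, if_pos rfl, if_neg hne, if_pos rfl, zero_sub, neg_smul, one_smul, add_zero,
          ← sub_eq_add_neg, (commute_wt _ _).sub_sq, mul_assoc, (commute_wt _ _).eq]
        abel
      · simp [e1, e2]
  rw [map_sum, sum_congr rfl fun j _ => h1 j, sum_add_distrib, sum_add_distrib, sum_ite_eq',
    sum_ite_eq', if_pos (mem_univ _), if_pos (mem_univ _), add_assoc]
  congr 1
  have h2 : (if i = 0 then k l else 0) = α l i - (wt l (i + 1) - wt l i) := by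
    rw [wt_sub]; abel
  rw [h2, mul_sub, mul_sub, mul_sub, mul_sub, two_mul (α l i * α l i), sq]
  abel

end Reflection

/-! ### Reflections acting on the cyclic continuant of the generators -/

section ReflectionWheel

open Polynomial

variable {l : ℕ}

theorem add_C_neg_mul {D : Type*} [Ring D] (z : D) (p q : D[X]) :
    p + C (-z) * q = p - C z * q := by
  rw [C_neg, neg_mul, ← sub_eq_add_neg]

theorem C_mul_X_sq_mul {D : Type*} [Ring D] (a b : D) (p : D[X]) :
    C a * X ^ 2 * (C b * X) * p = C (a * b) * p * X ^ 3 := by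
  rw [C_mul, mul_assoc (C a), ← mul_assoc (X ^ 2), X_pow_mul, mul_assoc (C b), ← pow_succ,
    mul_assoc, mul_assoc (C b), X_pow_mul]
  simp only [mul_assoc]

/-- The effect of a reflection on the cyclic continuant of the generators. -/
theorem map_s_polyWheel (hl : 2 ≤ l) (i : ZMod (l + 1)) (b : ℕ)
    (hb : ((b + 1 : ℕ) : ZMod (l + 1)) = i) :
    (polyWheel l).map ((s l i : K l →ₐ[ℂ] K l) : K l →+* K l) = polyWheel l +
      C ((if i = 0 then k l else 0) * (α l i / f l i)) * cont (polyF l) (polyZ l) (b + 3) (l - 1) *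
        X ^ 3 := by
  have hσ : ∀ (c : K l) (n : ℕ), mapRingHom ((s l i : K l →ₐ[ℂ] K l) : K l →+* K l) (C c * X ^ n) =
      C (s l i c) * X ^ n := by
    intro c n
    rw [coe_mapRingHom, Polynomial.map_mul, map_C, Polynomial.map_pow, map_X]
    rfl
  have hσ1 : ∀ c : K l, mapRingHom ((s l i : K l →ₐ[ℂ] K l) : K l →+* K l) (C c * X) =
      C (s l i c) * X := by
    intro c
    have := hσ c 1
    rwa [pow_one] at this
  have hcast : ∀ c : ℕ, ((b + 1 + c : ℕ) : ZMod (l + 1)) = i + c := by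
    intro c
    rw [Nat.cast_add (b + 1), hb]
  have hcast1 : ((b + 2 : ℕ) : ZMod (l + 1)) = i + 1 := by
    rw [hcast 1, Nat.cast_one]
  have hcast0 : (b : ZMod (l + 1)) = i - 1 := by
    rw [← hb, Nat.cast_succ, add_sub_cancel_right]
  have hF : ∀ j : ℕ, mapRingHom ((s l i : K l →ₐ[ℂ] K l) : K l →+* K l) (polyF l j) =
      polyF l j + C (u l i j • (α l i / f l i)) * X := by
    intro j
    rw [polyF, hσ1, fNat, s_f, C_add, add_mul]
  have hZ : ∀ j : ℕ, mapRingHom ((s l i : K l →ₐ[ℂ] K l) : K l →+* K l) (polyZ l j) =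
      polyZ l j + C (((if (j : ZMod (l + 1)) = i then (1 : ℂ) else 0) -
        if (j : ZMod (l + 1)) = i + 1 then 1 else 0) • α l i) * X ^ 2 := by
    intro j
    rw [polyZ, map_add, map_one, hσ, s_wt hl, C_add, add_mul, add_assoc]
  have hfi : fNat l (b + 1) = f l i := by rw [fNat, hb]
  -- The shift of the neighbouring letters times `f_i` is the shift of the weights: this is what
  -- makes the hypotheses of `IsCyclic.map_wheel` fit together.
  have hG : C (α l i / f l i) * X * polyF l (b + 1) = C (α l i) * X ^ 2 := by
    rw [polyF, hfi, mul_assoc, ← mul_assoc X, X_mul_C, mul_assoc, ← sq, ← mul_assoc, ← C_mul,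
      div_mul_cancel₀ _ (f_ne_zero l i)]
  have hG' : polyF l (b + 1) * (C (α l i / f l i) * X) = C (α l i) * X ^ 2 := by
    rw [polyF, hfi, mul_assoc, ← mul_assoc X, X_mul_C, mul_assoc, ← sq, ← mul_assoc, ← C_mul,
      div_eq_mul_inv, ← mul_assoc, ← (commute_α_f l i i).eq, mul_assoc,
      mul_inv_cancel₀ (f_ne_zero l i), mul_one]
  have hne := add_one_ne (by omega : 1 ≤ l) i
  have key := (isCyclic_poly hl).map_wheel hl b
    (mapRingHom ((s l i : K l →ₐ[ℂ] K l) : K l →+* K l)) (G := C (α l i / f l i) * X)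
    (κ := C (if i = 0 then k l else 0) * X ^ 2) ?_ ?_ ?_ ?_ ?_ ?_ ?_ ?_ ?_ ?_
  -- The computation was made with the cut in front of `i - 1`; independence of the cut brings it
  -- back to `polyWheel`.
  · rw [(isCyclic_poly hl).wheel_eq hl, coe_mapRingHom] at key
    rw [polyWheel, key, C_mul_X_sq_mul]
  · rw [polyη, hσ, s_h]
  · rw [hF, hcast0, u_antisymm, ← sub_add_cancel i 1, add_sub_cancel_right, u_add_one hl, neg_smul,
      one_smul, add_C_neg_mul]
  · rw [hF, hb, u_self, zero_smul, C_0, zero_mul, add_zero]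
  · rw [hF, hcast1, u_add_one hl, one_smul]
  · intro j h1 h2
    rw [hF, ← hb, u_natCast_eq_zero (by omega) (by omega), zero_smul, C_0, zero_mul, add_zero]
  · rw [hZ, hb, if_pos rfl, if_neg hne.symm, sub_zero, one_smul, hG]
  · rw [hZ, hcast1, if_pos rfl, if_neg hne, zero_sub, neg_smul, one_smul, add_C_neg_mul, hG]
  · intro j h1 h2
    have e1 : (j : ZMod (l + 1)) ≠ i := by
      rw [← hb]
      exact (natCast_ne (by omega) (by omega)).symm
    have e2 : (j : ZMod (l + 1)) ≠ i + 1 := by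
      rw [← hcast1]
      exact (natCast_ne (by omega) (by omega)).symm
    rw [hZ, if_neg e1, if_neg e2, sub_self, zero_smul, C_0, zero_mul, add_zero]
  · rw [hG, hG']
  -- The defect `κ` is `k X²` for `i = 0` and zero otherwise.
  · have h1 := wt_sub i
    rw [hG, polyZ, polyZ, hb, hcast1, add_sub_add_left_eq_sub, ← sub_mul, ← C_sub, h1, ← add_mul,
      ← C_add, sub_add_cancel]

/-- All letters must be deleted in adjacent pairs, each with constant weight `1`: impossible for an
odd number of letters, possible in exactly one way for an even number. -/
theorem coeff_zero_cont (b n : ℕ) : (cont (polyF l) (polyZ l) b (2 * n)).coeff 0 = 0 ∧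
    (cont (polyF l) (polyZ l) b (2 * n + 1)).coeff 0 = 1 := by
  induction n generalizing b with
  | zero => simp
  | succ n ih =>
    have h1 : ∀ m b, (cont (polyF l) (polyZ l) b (m + 2)).coeff 0 =
        (cont (polyF l) (polyZ l) (b + 2) m).coeff 0 := by
      intro m b
      rw [cont_add_two]
      simp [polyF, polyZ, mul_coeff_zero]
    exact ⟨(h1 _ _).trans (ih _).1, (h1 _ _).trans (ih _).2⟩

/-- Exactly one letter survives among an odd number of them, and both gaps are even, so it stands at
even distance from the first. -/
theorem coeff_one_cont (b n : ℕ) : (cont (polyF l) (polyZ l) b (2 * n)).coeff 1 =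
    ∑ j ∈ Finset.range n, fNat l (b + 2 * j) := by
  induction n generalizing b with
  | zero => simp
  | succ n ih =>
    have h1 : cont (polyF l) (polyZ l) b (2 * (n + 1)) =
        C (fNat l b) * (cont (polyF l) (polyZ l) (b + 1) (2 * n + 1) * X) +
          (cont (polyF l) (polyZ l) (b + 2) (2 * n) +
            C (wt l ((b + 1 : ℕ) : ZMod (l + 1))) *
              (cont (polyF l) (polyZ l) (b + 2) (2 * n) * X ^ 2)) := by
      rw [show 2 * (n + 1) = 2 * n + 2 by ring, cont_add_two, polyF, polyZ, add_mul, one_mul,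
        mul_assoc, mul_assoc, X_mul, X_pow_mul]
    rw [h1, coeff_add, coeff_add, coeff_C_mul, coeff_C_mul, coeff_mul_X_pow', if_neg (by omega),
      mul_zero, add_zero, show (1 : ℕ) = 0 + 1 by rfl, coeff_mul_X, (coeff_zero_cont _ _).2, mul_one,
      zero_add, ih, Finset.sum_range_succ']
    rw [add_comm]
    congr 1
    refine Finset.sum_congr rfl fun j _ => ?_
    congr 1
    ring

end ReflectionWheel

/-! ### Rotation of the formula and passage to the generated group -/

section Rotation

variable {l : ℕ}

theorem s_π (i : ZMod (l + 1)) (y : K l) : s l i (π l y) = π l (s l (i - 1) y) := by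
  have h1 : ∀ j : ZMod (l + 1), j + 1 = i + 1 ↔ j = i - 1 + 1 := fun j => by
    rw [sub_add_cancel, add_left_inj]
  have h2 : ∀ j : ZMod (l + 1), j + 1 = i - 1 ↔ j = i - 1 - 1 := fun j => eq_sub_iff_add_eq.symm
  have h3 : ∀ j : ZMod (l + 1), j + 1 = i ↔ j = i - 1 := fun j => eq_sub_iff_add_eq.symm
  have hu : ∀ j, u l i (j + 1) = u l (i - 1) j := fun j => by simp only [u, h1, h2]
  have hc : ∀ j, cartan l i (j + 1) = cartan l (i - 1) j := fun j => by
    simp only [cartan, h1, h2, h3]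
  have key : (s l i : K l →ₐ[ℂ] K l).comp (π l : K l →ₐ[ℂ] K l) =
      (π l : K l →ₐ[ℂ] K l).comp (s l (i - 1) : K l →ₐ[ℂ] K l) := by
    refine frac_ext (alg_ext fun g => ?_)
    cases g with
    | f j =>
      change s l i (π l (f l j)) = π l (s l (i - 1) (f l j))
      rw [π_f, s_f, s_f, map_add, map_smul, map_div₀, π_f, π_f, π_α, sub_add_cancel, hu]
    | α j =>
      change s l i (π l (α l j)) = π l (s l (i - 1) (α l j))
      rw [π_α, s_α, s_α, map_sub, map_smul, π_α, π_α, sub_add_cancel, hc]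
    | h =>
      change s l i (π l (h l)) = π l (s l (i - 1) (h l))
      rw [π_h, s_h, s_h, π_h]
  exact DFunLike.congr_fun key y

theorem π_k : π l (k l) = k l := by
  rw [k, map_sum]
  simp only [π_α]
  exact sum_add_one l (α l)

/-- A formula for the action on `H_0` propagates to all `H_j`. -/
theorem s_H {y : ℕ → K l} (hy : ∀ j, π l (y j) = y (j + 1))
    (h0 : ∀ i, s l i (H₀ l) = H₀ l + if i = 0 then k l * (α l i / f l i) * y 0 else 0)
    (j : ℕ) (i : ZMod (l + 1)) : s l i (H l j) =
      H l j + if i = (j : ZMod (l + 1)) then k l * (α l i / f l i) * y j else 0 := by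
  induction j generalizing i with
  | zero => simpa [H] using h0 i
  | succ j ih =>
    have h1 : i = ((j + 1 : ℕ) : ZMod (l + 1)) ↔ i - 1 = j := by
      rw [sub_eq_iff_eq_add, Nat.cast_succ]
    -- The reflection `s_i` on `π(H_j)` is `π` applied to `s_{i-1}` on `H_j`.
    rw [H, s_π, ih, map_add, apply_ite (π l), map_mul, map_mul, map_div₀, π_k, π_α, π_f, hy,
      sub_add_cancel, map_zero]
    simp only [h1]

theorem natCast_eq_iff {i j : ℕ} (hi : i ≤ l) (hj : j ≤ l) :
    (i : ZMod (l + 1)) = j ↔ i = j := by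
  constructor
  · intro h
    rw [← val_natCast' l (Nat.lt_succ_of_le hi), h, val_natCast' l (Nat.lt_succ_of_le hj)]
  · rintro rfl
    rfl

theorem map_eq_of_mem_weyl {j : ZMod (l + 1)} {y : K l} (hy : ∀ i, i ≠ j → s l i y = y)
    {w : K l ≃ₐ[ℂ] K l} (hw : w ∈ weyl l j) : w y = y := by
  have h1 : weyl l j ≤ MulAction.stabilizer (K l ≃ₐ[ℂ] K l) y := by
    rw [weyl, Subgroup.closure_le]
    rintro _ ⟨i, hi, rfl⟩
    exact hy i hi
  exact h1 hw

end Rotation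

/-! ### Reflection formulas for `H₀` -/

section Reflections

open Polynomial

variable {l : ℕ}

theorem s_coeff_polyWheel (hl : 2 ≤ l) (i : ZMod (l + 1)) (r : ℕ) :
    s l i ((polyWheel l).coeff (r + 3)) = (polyWheel l).coeff (r + 3) +
      (if i = 0 then k l else 0) * (α l i / f l i) *
        (cont (polyF l) (polyZ l) (i.val + l + 3) (l - 1)).coeff r := by
  -- The cut is at `i - 1`, represented by `i.val + l` so as to avoid subtraction of natural
  -- numbers.
  have h1 := map_s_polyWheel hl i (i.val + l) (by
    rw [add_assoc, Nat.cast_add, ZMod.natCast_self, add_zero, natCast_val'])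
  have h2 := congrArg (fun p => coeff p (r + 3)) h1
  simp only [coeff_map, coeff_add, coeff_mul_X_pow, coeff_C_mul] at h2
  exact h2

theorem s_H₀_even (hl : 2 ≤ l) (hpar : Even l) (i : ZMod (l + 1)) :
    s l i (H₀ l) = H₀ l + if i = 0 then k l * (α l i / f l i) * 1 else 0 := by
  obtain ⟨n, hn⟩ := hpar.two_dvd
  have h1 := s_coeff_polyWheel hl i 0
  rw [show l - 1 = 2 * (n - 1) + 1 by omega, (coeff_zero_cont _ _).2] at h1
  rw [H₀_even hl hpar, h1]
  simp

/-- The representatives `l + 3 + 2 * j` stand for `2, 4, …, 2n`, in the form in which they occur in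
the coefficient of the continuant cut in front of `-1`. -/
theorem x_zero {n : ℕ} (hn : l = 2 * n + 1) :
    x l 0 = f l 0 + ∑ j ∈ Finset.range n, fNat l (l + 3 + 2 * j) := by
  rw [x, show (l + 1) / 2 = n + 1 by omega, Finset.sum_range_succ', add_comm]
  congr 1
  refine Finset.sum_congr rfl fun j _ => ?_
  rw [fNat, show l + 3 + 2 * j = 2 * (j + 1) + (l + 1) by ring, Nat.cast_add _ (l + 1),
    ZMod.natCast_self, add_zero, ZMod.val_zero, zero_add]

theorem s_H₀_odd (hl : 2 ≤ l) (hpar : Odd l) (i : ZMod (l + 1)) :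
    s l i (H₀ l) = H₀ l + if i = 0 then k l * (α l i / f l i) * x l (0 : ℕ) else 0 := by
  obtain ⟨n, hn⟩ := hpar
  have h1 := s_coeff_polyWheel hl i 1
  rw [show l - 1 = 2 * n by omega, coeff_one_cont] at h1
  rw [H₀_odd hl ⟨n, hn⟩, map_add, map_smul, h1, s_sum_wt_sq hl]
  split_ifs with hi
  · subst hi
    -- The half sum of squares changes by `α_0 k`, which is the contribution of the summand `f_0` of
    -- `x_0`.
    have h2 : k l * (α l 0 / f l 0) * f l 0 = α l 0 * k l := by
      rw [mul_assoc, div_mul_cancel₀ _ (f_ne_zero l 0), (commute_α_center _ _).eq]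
    rw [Nat.cast_zero, x_zero hn, mul_add, h2, ZMod.val_zero, zero_add, smul_add,
      two_mul (α l 0 * k l), ← two_smul ℂ (α l 0 * k l), smul_smul]
    norm_num
    abel
  · simp

theorem π_x (hpar : Odd l) (e : ℕ) : π l (x l e) = x l (e + 1 : ℕ) := by
  obtain ⟨n, hn⟩ := hpar
  have hcast : ∀ j : ℕ, (e : ZMod 2) = j → ((e + 1 : ℕ) : ZMod 2) = (j + 1 : ℕ) := by
    intro j hj
    rw [Nat.cast_succ, hj, Nat.cast_succ]
  rw [x, map_sum]
  simp only [π_f]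
  rcases Nat.even_or_odd e with he | he
  · have h1 : (e : ZMod 2) = (0 : ℕ) := by
      rw [natCast_two_eq_iff]
      simpa using he
    rw [hcast 0 h1, h1, x]
    refine Finset.sum_congr rfl fun r _ => ?_
    rw [← Nat.cast_succ]
    congr 2
    simp [ZMod.val_one, add_comm]
  · have h1 : (e : ZMod 2) = (1 : ℕ) := by
      rw [natCast_two_eq_iff]
      grind
    have h2 : ((1 + 1 : ℕ) : ZMod 2) = 0 := rfl
    -- The last index `1 + 2n = l` is rotated to `0`, so the final summand on the left is the first
    -- one on the right.
    rw [hcast 1 h1, h1, h2, x, show (l + 1) / 2 = n + 1 by omega, Finset.sum_range_succ,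
      Finset.sum_range_succ']
    congr 1
    · refine Finset.sum_congr rfl fun r _ => ?_
      rw [← Nat.cast_succ]
      congr 2
      simp [ZMod.val_one]
      ring
    · have h3 : (((1 : ℕ) : ZMod 2).val + 2 * n : ℕ) = l := by
        simp [ZMod.val_one, hn, add_comm]
      rw [h3, natCast_succ_self]
      simp

end Reflections

/-! ### The case `l = 1` -/

namespace One

/-- In the symmetrised product the commutator terms in `η` cancel, which is why `H₀` contains `(f_0
f_1 + f_1 f_0) / 2`. -/
theorem Config.anticomm_newB {D : Type} [DivisionRing D] {a b c η t : D} (H : Config a b c η t) :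
    a * newB a b c t + newB a b c t * a = a * b + b * a - 4 * (t * c) - 2 * (t * (t / a)) := by
  have e4 : a * (c * (t / a)) = t * c + η * (t / a) := by
    rw [← mul_assoc, H.ac, add_mul, mul_assoc, H.mul_div, H.tc.eq]
  have e5 : a * (t / a * c) = t * c := by rw [← mul_assoc, H.mul_div]
  have e6 : a * (t / a * (t / a)) = t * (t / a) := by rw [← mul_assoc, H.mul_div]
  simp only [newB, H.div_sq, sub_mul, mul_sub, H.cwa, H.wca, H.wwa, e4, e5, e6]
  noncomm_ring

theorem H_one : H 1 = (1 / 2 : ℂ) • (f 0 * f 1 + f 1 * f 0) - α 0 * f 2 := by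
  have h0 : π (f 0) = f 1 := π_gen Gen.f₀
  have h1 : π (f 1) = f 0 := π_gen Gen.f₁
  have h2 : π (f 2) = -f 2 := (π_gen Gen.f₂).trans (map_neg _ _)
  have h3 : π (α 1) = α 0 := π_gen Gen.α₁
  rw [H, H, H₀, map_add, map_smul, map_add, map_mul, map_mul, map_mul, h0, h1, h2, h3, mul_neg,
    add_comm (f 1 * f 0), sub_eq_add_neg]

theorem half_four_mul {D : Type} [DivisionRing D] [Algebra ℂ D] (P y z : D) :
    (1 / 2 : ℂ) • (P - 4 * y - 2 * z) = (1 / 2 : ℂ) • P - 2 * y - z := by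
  have h4 : (4 : D) * y = (4 : ℂ) • y := by rw [Algebra.smul_def, map_ofNat]
  have h2 : ∀ y : D, (2 : D) * y = (2 : ℂ) • y := fun y => by rw [Algebra.smul_def, map_ofNat]
  rw [h4, h2, h2]
  module

/-- Half the anticommutator changes by `-2 t c - t (t / a)`, with `a` the fixed generator, `t` its
parameter and `c = ± f_2`. Adding the change of the linear term cancels everything when `i ≠ j` and
leaves `k * (t / a)` when `i = j`. -/
theorem s_H (i j : Fin 2) : s i (H j) = H j +
    if i = j then k * (α j / f j.castSucc) else 0 := by
  have c0 := config₀.anticomm_newB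
  have c1 := config₁.anticomm_newB
  have a0 : s 0 (f 0) = f 0 := s_gen 0 Gen.f₀
  have a1 : s 0 (f 1) = newB (f 0) (f 1) (f 2) (α 0) := s_gen 0 Gen.f₁
  have a2 : s 0 (f 2) = f 2 + α 0 / f 0 := s_gen 0 Gen.f₂
  have a3 : s 0 (α 0) = -α 0 := s_gen 0 Gen.α₀
  have a4 : s 0 (α 1) = α 1 + 2 * α 0 := s_gen 0 Gen.α₁
  have b0 : s 1 (f 0) = newB (f 1) (f 0) (-f 2) (α 1) := (s_gen 1 Gen.f₀).trans sGen_f₀_one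
  have b1 : s 1 (f 1) = f 1 := s_gen 1 Gen.f₁
  have b2 : s 1 (f 2) = f 2 - α 1 / f 1 := s_gen 1 Gen.f₂
  have b3 : s 1 (α 0) = α 0 + 2 * α 1 := s_gen 1 Gen.α₀
  have b4 : s 1 (α 1) = -α 1 := s_gen 1 Gen.α₁
  have hH : H 0 = (1 / 2 : ℂ) • (f 0 * f 1 + f 1 * f 0) + α 1 * f 2 := rfl
  fin_cases i <;> fin_cases j
  · change s 0 (H 0) = H 0 + k * (α 0 / f 0)
    rw [hH, map_add, map_smul, map_add, map_mul, map_mul, map_mul, a0, a1, a2, a4, c0,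
      half_four_mul, k]
    noncomm_ring
  · change s 0 (H 1) = H 1 + 0
    rw [H_one, map_sub, map_smul, map_add, map_mul, map_mul, map_mul, a0, a1, a2, a3, c0,
      half_four_mul]
    noncomm_ring
  · change s 1 (H 0) = H 0 + 0
    rw [hH, map_add, map_smul, map_add, map_mul, map_mul, map_mul, b0, b1, b2, b4,
      add_comm (newB _ _ _ _ * _), c1, half_four_mul, add_comm (f 1 * f 0)]
    noncomm_ring
  · change s 1 (H 1) = H 1 + k * (α 1 / f 1)
    rw [H_one, map_sub, map_smul, map_add, map_mul, map_mul, map_mul, b0, b1, b2, b3,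
      add_comm (newB _ _ _ _ * _), c1, half_four_mul, k, add_comm (f 1 * f 0)]
    noncomm_ring

theorem map_eq_of_mem_weyl {j : Fin 2} {y : K} (hy : ∀ i, i ≠ j → s i y = y)
    {w : K ≃ₐ[ℂ] K} (hw : w ∈ weyl j) : w y = y := by
  have h1 : weyl j ≤ MulAction.stabilizer (K ≃ₐ[ℂ] K) y := by
    rw [weyl, Subgroup.closure_le]
    rintro _ ⟨i, hi, rfl⟩
    exact hy i hi
  exact h1 hw

end One

/-! ### Assembly of the two parities and the final statement -/

theorem s_H_even {l : ℕ} (hl : 2 ≤ l) (hpar : Even l) (j : ℕ) (i : ZMod (l + 1)) :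
    s l i (H l j) = H l j + if i = (j : ZMod (l + 1)) then k l * (α l i / f l i) * 1 else 0 :=
  s_H (y := fun _ => 1) (fun _ => map_one _) (s_H₀_even hl hpar) j i

theorem s_H_odd {l : ℕ} (hl : 2 ≤ l) (hpar : Odd l) (j : ℕ) (i : ZMod (l + 1)) :
    s l i (H l j) = H l j + if i = (j : ZMod (l + 1)) then k l * (α l i / f l i) * x l j else 0 :=
  s_H (y := fun j => x l j) (π_x hpar) (s_H₀_odd hl hpar) j i

end QPainleve

theorem propositionA1 :
    -- the case `l = 1`
    ((∀ i j : Fin 2, QPainleve.One.s i (QPainleve.One.H j) = QPainleve.One.H j +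
        if i = j then QPainleve.One.k * (QPainleve.One.α j / QPainleve.One.f j.castSucc) else 0) ∧
      ∀ j : Fin 2, ∀ w ∈ QPainleve.One.weyl j, w (QPainleve.One.H j) = QPainleve.One.H j) ∧
    -- the case `l = 2n`
    (∀ n : ℕ, 1 ≤ n → ∀ i j : ℕ, i ≤ 2 * n → j ≤ 2 * n →
      QPainleve.s (2 * n) i (QPainleve.H (2 * n) j) = QPainleve.H (2 * n) j +
        if i = j then QPainleve.k (2 * n) * (QPainleve.α (2 * n) j / QPainleve.f (2 * n) j)
        else 0) ∧
    -- the case `l = 2n + 1`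
    (∀ n : ℕ, 1 ≤ n → ∀ i j : ℕ, i ≤ 2 * n + 1 → j ≤ 2 * n + 1 →
      QPainleve.s (2 * n + 1) i (QPainleve.H (2 * n + 1) j) = QPainleve.H (2 * n + 1) j +
        if i = j then QPainleve.k (2 * n + 1) *
          (QPainleve.α (2 * n + 1) j / QPainleve.f (2 * n + 1) j) * QPainleve.x (2 * n + 1) j
        else 0) ∧
    -- the invariance of `H_j` for `l ≥ 2`
    (∀ l : ℕ, 2 ≤ l → ∀ j : ℕ, j ≤ l → ∀ w ∈ QPainleve.weyl l j,
      w (QPainleve.H l j) = QPainleve.H l j) := by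

  refine ⟨⟨QPainleve.One.s_H, fun j w hw => ?_⟩, fun n hn i j hi hj => ?_, fun n hn i j hi hj => ?_,
    fun l hl j hj w hw => ?_⟩
  · refine QPainleve.One.map_eq_of_mem_weyl (fun i hi => ?_) hw
    rw [QPainleve.One.s_H, if_neg hi, add_zero]
  · rw [QPainleve.s_H_even (by omega) (even_two_mul n)]
    -- The indices are representatives at most `l`, so equality modulo `l + 1` is equality.
    simp only [QPainleve.natCast_eq_iff hi hj, mul_one]
    split_ifs with hij
    · rw [hij]
    · rfl
  · rw [QPainleve.s_H_odd (by omega) ⟨n, rfl⟩]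
    simp only [QPainleve.natCast_eq_iff hi hj]
    split_ifs with hij
    · rw [hij]
    · rfl
  · refine QPainleve.map_eq_of_mem_weyl (fun i hi => ?_) hw
    rcases Nat.even_or_odd l with hpar | hpar
    · rw [QPainleve.s_H_even hl hpar, if_neg hi, add_zero]
    · rw [QPainleve.s_H_odd hl hpar, if_neg hi, add_zero]
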